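/- Let $n\ge 0$, $\hbar>0$, and write $z=(x,p)\in\mathbb R^{n}\times\mathbb R^{n}=\mathbb R^{2n}$, $\sigma(z,z')=p\cdot x'-p'\cdot x$, $J(x,p)=(p,-x)$. **Heisenberg–Weyl operators and wave-packet transform.** On $L^2(\mathbb R^n)$ and $L^2(\mathbb R^{2n})$ put $$\widehat T(z_0)\psi(x)=e^{\frac i\hbar(p_0\cdot x-\frac12 p_0\cdot x_0)}\psi(x-x_0),\qquad \widehat T_{\rm ph}(z_0)\Psi(z)=e^{\frac{i}{2\hbar}\sigma(z_0,z)}\Psi(z-z_0).$$ For a Schwartz function $\phi\in\mathcal S(\mathbb R^n)$ let $U_\phi:L^2(\mathbb R^n)\to L^2(\mathbb R^{2n})$, $$U_\phi\psi(x,p)=(2\pi\hbar)^{-n/2}e^{\frac{i}{2\hbar}p\cdot x}\int e^{-\frac i\hbar p\cdot x'}\psi(x')\overline{\phi(x-x')}\,d^nx'.$$ Let $\phi^\hbar(x)=(\pi\hbar)^{-n/4}e^{-|x|^2/2\hbar}$, $\phi^\hbar_{z_0}=\widehat T(z_0)\phi^\hbar$ and $\Phi^\hbar_0=U_\phi\phi^\hbar$.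 **Metaplectic operators.** For $W(x,x')=\frac12Px\cdot x-Lx\cdot x'+\frac12Qx'\cdot x'$ with $P,Q$ real symmetric, $\det L\ne0$, and an integer $m$ such that $m\pi$ is an argument of $\det L$, let $\widehat S_{W,m}$ be the unitary operator on $L^2(\mathbb R^n)$ given on Schwartz functions by $$\widehat S_{W,m}\psi(x)=\left(\tfrac1{2\pi i\hbar}\right)^{n/2}i^m\sqrt{|\det L|}\int e^{\frac i\hbar W(x,x')}\psi(x')\,d^nx',$$ and let $S_W$ be the symplectic map with $(x,p)=S_W(x',p')\iff p=\partial_xW(x,x'),\ p'=-\partial_{x'}W(x,x')$. The metaplectic group $\mathrm{Mp}(n)$ is the group generated by the $\widehat S_{W,m}$, and $\pi:\mathrm{Mp}(n)\to\mathrm{Sp}(n)$ is the homomorphism with $\pi(\widehat S_{W,m})=S_W$. If $S=S_W$ satisfies $\det(S-I)\neq0$, let $(\widehat S_{W,m})_{\rm ph}$ be the unitary operator on $L^2(\mathbb R^{2n})$ given on Schwartz functions by $$(\widehat S_{W,m})_{\rm ph}\Psi(z)=\left(\tfrac1{2\pi\hbar}\right)^{n}\frac{i^{\,m-\operatorname{Inert}W_{xx}}}{\sqrt{|\det(S-I)|}}\int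 e^{\frac{i}{2\hbar}M_Sz_0\cdot z_0}\,\widehat T_{\rm ph}(z_0)\Psi(z)\,d^{2n}z_0,\qquad M_S=\tfrac12J(S+I)(S-I)^{-1},$$ where $\operatorname{Inert}W_{xx}$ is the number of negative eigenvalues of the Hessian $P+Q-L-L^T$ of $x\mapsto W(x,x)$. The correspondence $\widehat S\mapsto\widehat S_{\rm ph}$ on $\mathrm{Mp}(n)$ is the multiplicative extension of this one: its graph is the group generated by the pairs $(\widehat S_{W,m},(\widehat S_{W,m})_{\rm ph})$ with $\det(S_W-I)\ne0$. **Nearby-orbit propagator.** Let $H(z,t)$ be a Hamiltonian function on $\mathbb R^{2n}$, possibly time-dependent ($C^2$ in $z$, with $H,\partial_zH,\partial_z^2H$ continuous in $(z,t)$). Let $(f_t)$ be its flow, defined for $t$ in an open interval containing $0$ and for initial points in an open set containing $z_0$: $\frac{d}{dt}f_t(z)=J\partial_zH(f_t(z),t)$, $f_0(z)=z$. Suppose that $f_t$ is differentiable at $z_0$ with invertible Jacobian $S_t(z_0)=Df_t(z_0)$, and let $t\mapsto\widehat S_t(z_0)$ be the strongly continuous path in $\mathrm{Mp}(n)$ with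 $\pi(\widehat S_t(z_0))=S_t(z_0)$ and $\widehat S_0(z_0)=I$. With $z(t)=f_t(z_0)$ put $$\gamma(z_0,t)=\int_0^t\tfrac12\sigma(z(t'),\dot z(t'))-H(z(t'),t')\,dt',\qquad U(t,z_0)\psi_0=e^{\frac i\hbar\gamma(z_0,t)}\,\widehat T(f_t(z_0))\,\widehat S_t(z_0)\,\widehat T(z_0)^{-1}\psi_0 .$$ **Proposition.** Let $\phi\in\mathcal S(\mathbb R^n)$ and let $t$ be in the time interval. The operator $(\widehat S_t(z_0))_{\rm ph}$ exists and is unique. Moreover: (i) For every $\psi_0\in L^2(\mathbb R^n)$, with $\Psi_0=U_\phi\psi_0$, $$U_\phi\bigl(U(t,z_0)\psi_0\bigr)=e^{\frac i\hbar\gamma(z_0,t)}\,\widehat T_{\rm ph}(f_t(z_0))\,(\widehat S_t(z_0))_{\rm ph}\,\widehat T_{\rm ph}(z_0)^{-1}\Psi_0 .$$ (ii) In particular, $$U_\phi\bigl(U(t,z_0)\phi^\hbar_{z_0}\bigr)=e^{\frac i\hbar\gamma(z_0,t)}\,\widehat T_{\rm ph}(f_t(z_0))\,(\widehat S_t(z_0))_{\rm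 ph}\,\Phi^\hbar_0 .$$ -/

import Mathlib

open MeasureTheory
open scoped SchwartzMap ComplexConjugate ENNReal

noncomputable section

namespace NearbyOrbit

/-- Position space `ℝⁿ` with its Euclidean structure. -/
abbrev Position (n : ℕ) : Type := EuclideanSpace ℝ (Fin n)

/-- Phase space `ℝ²ⁿ`, with generic point `z = (x, p)`. -/
abbrev Phase (n : ℕ) : Type := Position n × Position n

/-- `L²(ℝⁿ)`. -/
abbrev WaveFn (n : ℕ) : Type := Lp ℂ 2 (volume : Measure (Position n))

/-- `L²(ℝ²ⁿ)`. -/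
abbrev PhaseFn (n : ℕ) : Type := Lp ℂ 2 (volume : Measure (Phase n))

instance instHaarPhase (n : ℕ) : (volume : Measure (Phase n)).IsAddHaarMeasure :=
  Measure.prod.instIsAddHaarMeasure _ _

/-- The symplectic product `σ(z, z') = p · x' - p' · x`. -/
def sympl {n : ℕ} (z z' : Phase n) : ℝ := inner ℝ z.2 z'.1 - inner ℝ z'.2 z.1

section Translation

variable {E : Type*} [NormedAddCommGroup E] [MeasureSpace E] [BorelSpace E]
  [(volume : Measure E).IsAddRightInvariant]

theorem memLp_phaseTranslate (θ : E → ℝ) (hθ : Continuous θ) (a : E)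
    (ψ : Lp ℂ 2 (volume : Measure E)) :
    MemLp (fun x => Complex.exp (Complex.I * θ x) * ψ (x - a)) 2 volume := by
  have h1 : MemLp (fun x => ψ (x - a)) 2 volume :=
    (Lp.memLp ψ).comp_measurePreserving (measurePreserving_sub_right volume a)
  refine h1.of_le ?_ ?_
  · exact (Continuous.aestronglyMeasurable (by fun_prop)).mul h1.1
  · filter_upwards with x
    rw [norm_mul, mul_comm Complex.I, Complex.norm_exp_ofReal_mul_I, one_mul]

/-- The operator `ψ ↦ e^{iθ(x)} ψ(x - a)` on `L²`. -/
def phaseTranslateFun (θ : E → ℝ) (hθ : Continuous θ) (a : E)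
    (ψ : Lp ℂ 2 (volume : Measure E)) : Lp ℂ 2 (volume : Measure E) :=
  (memLp_phaseTranslate θ hθ a ψ).toLp _

theorem phaseTranslateFun_ae (θ : E → ℝ) (hθ : Continuous θ) (a : E)
    (ψ : Lp ℂ 2 (volume : Measure E)) :
    phaseTranslateFun θ hθ a ψ =ᵐ[volume]
      fun x => Complex.exp (Complex.I * θ x) * ψ (x - a) :=
  MemLp.coeFn_toLp _

theorem ae_sub {f g : E → ℂ} (a : E) (h : f =ᵐ[volume] g) :
    (fun x => f (x - a)) =ᵐ[volume] fun x => g (x - a) :=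
  (measurePreserving_sub_right volume a).quasiMeasurePreserving.ae_eq_comp h

theorem phaseTranslateFun_phaseTranslateFun (θ θ' : E → ℝ) (hθ : Continuous θ)
    (hθ' : Continuous θ') (a b : E) (hab : a + b = 0) (h : ∀ x, θ x + θ' (x - a) = 0)
    (ψ : Lp ℂ 2 (volume : Measure E)) :
    phaseTranslateFun θ hθ a (phaseTranslateFun θ' hθ' b ψ) = ψ := by
  apply Lp.ext
  filter_upwards [phaseTranslateFun_ae θ hθ a (phaseTranslateFun θ' hθ' b ψ),
    ae_sub a (phaseTranslateFun_ae θ' hθ' b ψ)] with x h1 h2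
  rw [h1, h2, ← mul_assoc, ← Complex.exp_add, ← mul_add, ← Complex.ofReal_add, h x]
  simp [sub_sub, hab]

/-- The unitary operator `ψ ↦ e^{iθ(x)} ψ(x - a)` on `L²`, for a continuous real phase `θ`. -/
def phaseTranslate (θ : E → ℝ) (hθ : Continuous θ) (a : E) :
    Lp ℂ 2 (volume : Measure E) ≃ₗᵢ[ℂ] Lp ℂ 2 (volume : Measure E) where
  toFun := phaseTranslateFun θ hθ a
  invFun := phaseTranslateFun (fun x => -θ (x + a)) (by fun_prop) (-a)
  left_inv ψ := phaseTranslateFun_phaseTranslateFun _ _ _ _ _ _ (by simp) (by simp) ψ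
  right_inv ψ := phaseTranslateFun_phaseTranslateFun _ _ _ _ _ _ (by simp) (by simp) ψ
  map_add' ψ χ := by
    apply Lp.ext
    filter_upwards [phaseTranslateFun_ae θ hθ a (ψ + χ), phaseTranslateFun_ae θ hθ a ψ,
      phaseTranslateFun_ae θ hθ a χ, ae_sub a (Lp.coeFn_add ψ χ),
      Lp.coeFn_add (phaseTranslateFun θ hθ a ψ) (phaseTranslateFun θ hθ a χ)] with x h1 h2 h3 h4 h5
    rw [h1, h5, h4, Pi.add_apply, Pi.add_apply, h2, h3, mul_add]
  map_smul' c ψ := by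
    apply Lp.ext
    filter_upwards [phaseTranslateFun_ae θ hθ a (c • ψ), phaseTranslateFun_ae θ hθ a ψ,
      ae_sub a (Lp.coeFn_smul c ψ), Lp.coeFn_smul c (phaseTranslateFun θ hθ a ψ)] with x h1 h2 h3 h4
    rw [h1, h3, RingHom.id_apply, h4, Pi.smul_apply, Pi.smul_apply, h2, smul_eq_mul, smul_eq_mul]
    ring
  norm_map' ψ := by
    change ‖phaseTranslateFun θ hθ a ψ‖ = ‖ψ‖
    have h1 : eLpNorm (phaseTranslateFun θ hθ a ψ) 2 volume = eLpNorm ψ 2 volume := by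
      rw [eLpNorm_congr_ae (phaseTranslateFun_ae θ hθ a ψ)]
      rw [← eLpNorm_comp_measurePreserving (Lp.aestronglyMeasurable ψ)
        (measurePreserving_sub_right volume a)]
      apply eLpNorm_congr_norm_ae
      filter_upwards with x
      rw [norm_mul, mul_comm Complex.I, Complex.norm_exp_ofReal_mul_I, one_mul]
      rfl
    rw [Lp.norm_def, Lp.norm_def, h1]

end Translation

variable {n : ℕ}

/-- The Heisenberg–Weyl operator
`T̂(z₀)ψ(x) = exp((i/ħ)(p₀ · x - (1/2) p₀ · x₀)) ψ(x - x₀)` on `L²(ℝⁿ)`. -/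
def heisenbergWeyl (ħ : ℝ) (z₀ : Phase n) : WaveFn n ≃ₗᵢ[ℂ] WaveFn n :=
  phaseTranslate (fun x => (1 / ħ) * (inner ℝ z₀.2 x - 1 / 2 * inner ℝ z₀.2 z₀.1))
    (by fun_prop) z₀.1

/-- The phase-space Heisenberg–Weyl operator
`T̂_ph(z₀)Ψ(z) = exp((i/2ħ) σ(z₀, z)) Ψ(z - z₀)` on `L²(ℝ²ⁿ)`. -/
def heisenbergWeylPh (ħ : ℝ) (z₀ : Phase n) : PhaseFn n ≃ₗᵢ[ℂ] PhaseFn n :=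
  phaseTranslate (fun z => (1 / (2 * ħ)) * sympl z₀ z) (by unfold sympl; fun_prop) z₀

/-! ### The wave-packet transform -/

/-- The function
`U_φψ(x, p) = (2πħ)^{-n/2} e^{(i/2ħ) p·x} ∫ e^{-(i/ħ) p·x'} ψ(x') conj(φ(x - x')) dx'`. -/
def wavePacketFun (ħ : ℝ) (φ : 𝓢(Position n, ℂ)) (ψ : Position n → ℂ) (z : Phase n) : ℂ :=
  (((1 / (2 * Real.pi * ħ)) ^ ((n : ℝ) / 2) : ℝ) : ℂ) *
    Complex.exp (Complex.I / (2 * ħ) * (inner ℝ z.2 z.1 : ℝ)) *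
    ∫ x' : Position n, Complex.exp (-(Complex.I / ħ) * (inner ℝ z.2 x' : ℝ)) *
      ψ x' * conj (φ (z.1 - x'))

theorem stronglyMeasurable_wavePacketFun (ħ : ℝ) (φ : 𝓢(Position n, ℂ)) {ψ : Position n → ℂ}
    (hψ : StronglyMeasurable ψ) : StronglyMeasurable (wavePacketFun ħ φ ψ) := by
  unfold wavePacketFun
  refine StronglyMeasurable.mul (Continuous.stronglyMeasurable (by fun_prop)) ?_
  refine StronglyMeasurable.integral_prod_right (f := fun (z : Phase n) (x' : Position n) =>
    Complex.exp (-(Complex.I / ħ) * (inner ℝ z.2 x' : ℝ)) * ψ x' * conj (φ (z.1 - x'))) ?_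
  have h1 : StronglyMeasurable (fun q : Phase n × Position n =>
      Complex.exp (-(Complex.I / ħ) * (inner ℝ q.1.2 q.2 : ℝ))) :=
    Continuous.stronglyMeasurable (by fun_prop)
  have h2 : StronglyMeasurable (fun q : Phase n × Position n => ψ q.2) :=
    hψ.comp_measurable measurable_snd
  have h3 : StronglyMeasurable (fun q : Phase n × Position n => conj (φ (q.1.1 - q.2))) := by
    have := φ.continuous
    exact Continuous.stronglyMeasurable (by fun_prop)
  exact (h1.mul h2).mul h3

theorem hasTemperateGrowth_window (φ : 𝓢(Position n, ℂ)) (x : Position n) :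
    Function.HasTemperateGrowth (fun y => conj (φ (x - y))) := by
  have h1 : Function.HasTemperateGrowth (fun y => φ (x - y)) := by
    have := φ.hasTemperateGrowth
    fun_prop
  exact (Complex.conjCLE : ℂ →L[ℝ] ℂ).hasTemperateGrowth.comp h1

theorem lintegral_wavePacketFun_schwartz {ħ : ℝ} (hħ : 0 < ħ) (φ ψ : 𝓢(Position n, ℂ))
    (x : Position n) :
    ∫⁻ p, ‖wavePacketFun ħ φ ψ (x, p)‖ₑ ^ (2 : ℝ) =
      ENNReal.ofReal (((1 / (2 * Real.pi * ħ)) ^ ((n : ℝ) / 2)) ^ 2 *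
        (2 * Real.pi * ħ) ^ n) * ∫⁻ y, ‖ψ y * conj (φ (x - y))‖ₑ ^ (2 : ℝ) := by
  have hpos : 0 < 2 * Real.pi * ħ := by positivity
  set g : 𝓢(Position n, ℂ) :=
    SchwartzMap.bilinLeftCLM (ContinuousLinearMap.mul ℂ ℂ) (hasTemperateGrowth_window φ x) ψ with hg
  have hgv : ∀ y, g y = ψ y * conj (φ (x - y)) := by
    intro y
    rw [hg, SchwartzMap.bilinLeftCLM_apply]
    rfl
  have hU : ∀ p, ‖wavePacketFun ħ φ ψ (x, p)‖ₑ ^ (2 : ℝ) =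
      ENNReal.ofReal (((1 / (2 * Real.pi * ħ)) ^ ((n : ℝ) / 2)) ^ 2) *
        ‖FourierTransform.fourier g ((2 * Real.pi * ħ)⁻¹ • p)‖ₑ ^ (2 : ℝ) := by
    intro p
    have e1 : ‖wavePacketFun ħ φ ψ (x, p)‖ = (1 / (2 * Real.pi * ħ)) ^ ((n : ℝ) / 2) *
        ‖FourierTransform.fourier g ((2 * Real.pi * ħ)⁻¹ • p)‖ := by
      unfold wavePacketFun
      rw [norm_mul, norm_mul, Complex.norm_real, Real.norm_of_nonneg (by positivity)]
      have e2 : ‖Complex.exp (Complex.I / (2 * ħ) * (inner ℝ (x, p).2 (x, p).1 : ℝ))‖ = 1 := by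
        rw [show Complex.I / (2 * ħ) * ((inner ℝ (x, p).2 (x, p).1 : ℝ) : ℂ) =
          ((1 / (2 * ħ) * inner ℝ p x : ℝ) : ℂ) * Complex.I by push_cast; ring]
        exact Complex.norm_exp_ofReal_mul_I _
      rw [e2, mul_one, SchwartzMap.fourier_coe, Real.fourier_eq']
      congr 2
      refine integral_congr_ae (Filter.Eventually.of_forall fun y => ?_)
      simp only [hgv, smul_eq_mul]
      rw [mul_assoc]
      congr 2
      rw [real_inner_smul_right, real_inner_comm]
      have h1 : (ħ : ℂ) ≠ 0 := by exact_mod_cast hħ.ne'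
      have h2 : (Real.pi : ℂ) ≠ 0 := by exact_mod_cast Real.pi_ne_zero
      push_cast
      field_simp
    rw [← ofReal_norm, e1, ENNReal.ofReal_mul (by positivity), ofReal_norm,
      ENNReal.mul_rpow_of_nonneg _ _ (by norm_num), ENNReal.ofReal_rpow_of_nonneg (by positivity)
      (by norm_num), Real.rpow_two]
  have hsm : Measurable fun q => ‖FourierTransform.fourier g q‖ₑ ^ (2 : ℝ) :=
    ((FourierTransform.fourier g).continuous.measurable.enorm).pow_const _
  have hscale : ∫⁻ p : Position n, ‖FourierTransform.fourier g ((2 * Real.pi * ħ)⁻¹ • p)‖ₑ ^ (2 : ℝ)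
      = ENNReal.ofReal ((2 * Real.pi * ħ) ^ n) *
        ∫⁻ q, ‖FourierTransform.fourier g q‖ₑ ^ (2 : ℝ) := by
    rw [← lintegral_map (g := fun p : Position n => (2 * Real.pi * ħ)⁻¹ • p) hsm (by fun_prop),
      Measure.map_addHaar_smul _ (by positivity), lintegral_smul_measure]
    rw [finrank_euclideanSpace, Fintype.card_fin, inv_pow, inv_inv, abs_of_pos (by positivity),
      smul_eq_mul]
  have hpl : ∫⁻ q, ‖FourierTransform.fourier g q‖ₑ ^ (2 : ℝ) = ∫⁻ y, ‖g y‖ₑ ^ (2 : ℝ) := by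
    have e0 := SchwartzMap.norm_fourier_toL2_eq g
    rw [SchwartzMap.norm_toLp, SchwartzMap.norm_toLp, ENNReal.toReal_eq_toReal_iff'
      (SchwartzMap.memLp _ _ _).2.ne (SchwartzMap.memLp _ _ _).2.ne] at e0
    have e1 := eLpNorm_nnreal_pow_eq_lintegral (f := FourierTransform.fourier g)
      (μ := volume) (p := 2) (by norm_num)
    have e2 := eLpNorm_nnreal_pow_eq_lintegral (f := g)
      (μ := volume) (p := 2) (by norm_num)
    simp only [NNReal.coe_ofNat, ENNReal.coe_ofNat] at e1 e2
    rw [← e1, ← e2, e0]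
  simp_rw [hU]
  rw [lintegral_const_mul' _ _ ENNReal.ofReal_ne_top, hscale, hpl, ← mul_assoc,
    ← ENNReal.ofReal_mul (by positivity)]
  simp_rw [hgv]

theorem eLpNorm_wavePacketFun_schwartz {ħ : ℝ} (hħ : 0 < ħ) (φ ψ : 𝓢(Position n, ℂ)) :
    eLpNorm (wavePacketFun ħ φ ψ) 2 volume ^ (2 : ℝ) =
      ENNReal.ofReal (((1 / (2 * Real.pi * ħ)) ^ ((n : ℝ) / 2)) ^ 2 *
        (2 * Real.pi * ħ) ^ n) * eLpNorm φ 2 volume ^ (2 : ℝ) * eLpNorm ψ 2 volume ^ (2 : ℝ) := by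
  have hm := stronglyMeasurable_wavePacketFun ħ φ ψ.continuous.stronglyMeasurable
  have e1 := eLpNorm_nnreal_pow_eq_lintegral (f := wavePacketFun ħ φ ψ)
    (μ := volume) (p := 2) (by norm_num)
  have e2 := eLpNorm_nnreal_pow_eq_lintegral (f := φ) (μ := volume) (p := 2) (by norm_num)
  have e3 := eLpNorm_nnreal_pow_eq_lintegral (f := ψ) (μ := volume) (p := 2) (by norm_num)
  simp only [NNReal.coe_ofNat, ENNReal.coe_ofNat] at e1 e2 e3
  have hcψ := ψ.continuous
  have hcφ := φ.continuous
  rw [e1, e2, e3, Measure.volume_eq_prod, lintegral_prod _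
    (hm.measurable.enorm.pow_const _).aemeasurable]
  simp_rw [lintegral_wavePacketFun_schwartz hħ φ ψ]
  rw [lintegral_const_mul' _ _ ENNReal.ofReal_ne_top, lintegral_lintegral_swap,
    mul_assoc (ENNReal.ofReal _)]
  · congr 1
    have : ∀ y : Position n, ∫⁻ x : Position n, ‖ψ y * conj (φ (x - y))‖ₑ ^ (2 : ℝ) =
        ‖ψ y‖ₑ ^ (2 : ℝ) * ∫⁻ x, ‖φ x‖ₑ ^ (2 : ℝ) := by
      intro y
      rw [← lintegral_sub_right_eq_self (fun x => ‖φ x‖ₑ ^ (2 : ℝ)) y,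
        ← lintegral_const_mul _ (by
          exact Measurable.pow_const (Continuous.measurable (by fun_prop)).enorm _)]
      refine lintegral_congr fun x => ?_
      rw [enorm_mul, ENNReal.mul_rpow_of_nonneg _ _ (by norm_num), RCLike.enorm_conj]
    rw [lintegral_congr this]
    rw [lintegral_mul_const _ (hcψ.measurable.enorm.pow_const _), mul_comm]
  · refine Measurable.aemeasurable (Measurable.pow_const (Measurable.enorm ?_) _)
    exact Continuous.measurable (by fun_prop)

/-- The window `x' ↦ e^{(i/ħ) p·x'} φ(x - x')` against which `ψ` is integrated. -/
theorem memLp_windowFun (ħ : ℝ) (φ : 𝓢(Position n, ℂ)) (z : Phase n) :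
    MemLp (fun x' : Position n => Complex.exp (Complex.I * ((1 / ħ * inner ℝ z.2 x' : ℝ) : ℂ)) *
      φ (z.1 - x')) 2 volume := by
  have h1 : MemLp (fun x' => φ (z.1 - x')) 2 volume :=
    (φ.memLp 2 volume).comp_measurePreserving (Measure.measurePreserving_sub_left volume z.1)
  refine h1.of_le ?_ ?_
  · exact (Continuous.aestronglyMeasurable (by fun_prop)).mul h1.1
  · filter_upwards with x
    rw [norm_mul, mul_comm Complex.I, Complex.norm_exp_ofReal_mul_I, one_mul]

theorem wavePacketFun_eq_inner (ħ : ℝ) (φ : 𝓢(Position n, ℂ)) (ψ : WaveFn n) (z : Phase n) :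
    wavePacketFun ħ φ ψ z = (((1 / (2 * Real.pi * ħ)) ^ ((n : ℝ) / 2) : ℝ) : ℂ) *
      Complex.exp (Complex.I / (2 * ħ) * (inner ℝ z.2 z.1 : ℝ)) *
      inner ℂ ((memLp_windowFun ħ φ z).toLp _) ψ := by
  rw [wavePacketFun, L2.inner_def]
  congr 1
  apply integral_congr_ae
  filter_upwards [(memLp_windowFun ħ φ z).coeFn_toLp] with x' h
  rw [h, RCLike.inner_apply, map_mul, ← Complex.exp_conj, map_mul, Complex.conj_I,
    Complex.conj_ofReal]
  push_cast
  rw [show -(Complex.I / ħ) * ((inner ℝ z.2 x' : ℝ) : ℂ) =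
    -Complex.I * (1 / ħ * ((inner ℝ z.2 x' : ℝ) : ℂ)) by ring]
  ring

theorem memLp_wavePacketFun {ħ : ℝ} (hħ : 0 < ħ) (φ : 𝓢(Position n, ℂ)) (ψ : WaveFn n) :
    MemLp (wavePacketFun ħ φ ψ) 2 volume := by
  refine ⟨(stronglyMeasurable_wavePacketFun ħ φ
    (Lp.stronglyMeasurable ψ)).aestronglyMeasurable, ?_⟩
  obtain ⟨u, hu, hlim⟩ := mem_closure_iff_seq_limit.1
    ((SchwartzMap.denseRange_toLpCLM (E := Position n) (F := ℂ) (p := 2) (μ := volume)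
      (by norm_num)) ψ)
  choose v hv using hu
  have hv' : ∀ k, u k = (v k).toLp 2 volume := fun k => (hv k).symm
  have hfun : ∀ k z, wavePacketFun ħ φ (v k) z = wavePacketFun ħ φ (u k) z := by
    intro k z
    unfold wavePacketFun
    congr 1
    apply integral_congr_ae
    rw [hv' k]
    filter_upwards [(v k).coeFn_toLp 2 volume] with x h
    rw [h]
  have hbdd : ∀ᶠ k in Filter.atTop, eLpNorm (v k) 2 volume ≤ ENNReal.ofReal (‖ψ‖ + 1) := by
    filter_upwards [hlim.norm.eventually (gt_mem_nhds (lt_add_one ‖ψ‖))] with k hk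
    rw [hv' k, SchwartzMap.norm_toLp] at hk
    rw [← ENNReal.ofReal_toReal ((v k).memLp 2 volume).2.ne]
    exact ENNReal.ofReal_le_ofReal hk.le
  set K := ENNReal.ofReal (((1 / (2 * Real.pi * ħ)) ^ ((n : ℝ) / 2)) ^ 2 *
        (2 * Real.pi * ħ) ^ n) * eLpNorm φ 2 volume ^ (2 : ℝ) *
        ENNReal.ofReal (‖ψ‖ + 1) ^ (2 : ℝ) with hK
  have hKtop : K < ⊤ := by
    refine ENNReal.mul_lt_top (ENNReal.mul_lt_top ENNReal.ofReal_lt_top ?_) ?_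
    · exact ENNReal.rpow_lt_top_of_nonneg (by norm_num) (φ.memLp 2 volume).2.ne
    · exact ENNReal.rpow_lt_top_of_nonneg (by norm_num) ENNReal.ofReal_ne_top
  have hle : eLpNorm (wavePacketFun ħ φ ψ) 2 volume ≤ K ^ (1 / 2 : ℝ) := by
    refine Lp.eLpNorm_le_of_ae_tendsto (u := Filter.atTop)
      (f := fun k => wavePacketFun ħ φ (v k)) ?_ ?_ ?_
    · filter_upwards [hbdd] with k hk
      rw [one_div, ENNReal.le_rpow_inv_iff (by norm_num), eLpNorm_wavePacketFun_schwartz hħ]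
      exact mul_le_mul_right (ENNReal.rpow_le_rpow hk (by norm_num)) _
    · exact fun k => (stronglyMeasurable_wavePacketFun ħ φ
        (v k).continuous.stronglyMeasurable).aestronglyMeasurable
    · filter_upwards with z
      simp_rw [hfun, wavePacketFun_eq_inner]
      exact (Filter.Tendsto.inner tendsto_const_nhds hlim).const_mul _
  exact hle.trans_lt (ENNReal.rpow_lt_top_of_nonneg (by norm_num) hKtop.ne)

/-- The wave-packet transform `U_φ : L²(ℝⁿ) → L²(ℝ²ⁿ)` with window `φ`. -/
def wavePacketTransform {ħ : ℝ} (hħ : 0 < ħ) (φ : 𝓢(Position n, ℂ)) (ψ : WaveFn n) : PhaseFn n :=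
  (memLp_wavePacketFun hħ φ ψ).toLp _

/-! ### Coherent states -/

/-- The standard coherent state as a function, `(πħ)^{-n/4} e^{-|x|²/(2ħ)}`. -/
def coherentFun (n : ℕ) (ħ : ℝ) (x : Position n) : ℂ :=
  (((1 / (Real.pi * ħ)) ^ ((n : ℝ) / 4) * Real.exp (-(1 / (2 * ħ)) * ‖x‖ ^ 2) : ℝ) : ℂ)

theorem memLp_coherentFun (n : ℕ) {ħ : ℝ} (hħ : 0 < ħ) : MemLp (coherentFun n ħ) 2 volume := by
  have hc : Continuous (coherentFun n ħ) := by unfold coherentFun; fun_prop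
  rw [memLp_two_iff_integrable_sq_norm hc.aestronglyMeasurable]
  have h1 := (GaussianFourier.integrable_cexp_neg_mul_sq_norm_add (V := Position n)
    (b := ((1 / ħ : ℝ) : ℂ)) (by rw [Complex.ofReal_re]; positivity) 0 0).norm
  refine (h1.const_mul (((1 / (Real.pi * ħ)) ^ ((n : ℝ) / 4)) ^ 2)).congr ?_
  filter_upwards with x
  rw [coherentFun, Complex.norm_real, Real.norm_of_nonneg (by positivity), mul_pow,
    Complex.norm_exp, ← Real.exp_nat_mul]
  congr 2
  rw [zero_mul, add_zero, ← Complex.ofReal_pow, ← Complex.ofReal_neg, ← Complex.ofReal_mul,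
    Complex.ofReal_re]
  push_cast
  field_simp

/-- The standard coherent state `φ^ħ` as an element of `L²(ℝⁿ)`. -/
def coherentState (n : ℕ) {ħ : ℝ} (hħ : 0 < ħ) : WaveFn n := (memLp_coherentFun n hħ).toLp _

/-- The coherent state `φ^ħ_{z₀} = T̂(z₀)φ^ħ` centred at `z₀`. -/
def coherentStateAt {ħ : ℝ} (hħ : 0 < ħ) (z₀ : Phase n) : WaveFn n :=
  heisenbergWeyl ħ z₀ (coherentState n hħ)

/-! ### The metaplectic group -/

/-- The quadratic form `W(x, x') = (1/2) Px·x - Lx·x' + (1/2) Qx'·x'`. -/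
def quadGen (P L Q : Matrix (Fin n) (Fin n) ℝ) (x x' : Position n) : ℝ :=
  1 / 2 * inner ℝ (Matrix.toEuclideanLin P x) x - inner ℝ (Matrix.toEuclideanLin L x) x' +
    1 / 2 * inner ℝ (Matrix.toEuclideanLin Q x') x'

/-- The admissible data `(W, m)`: `P` and `Q` are symmetric, `L` is invertible, and `mπ` is an
argument of `det L`. -/
structure IsGenerating (P L Q : Matrix (Fin n) (Fin n) ℝ) (m : ℤ) : Prop where
  symm_left : P.IsSymm
  symm_right : Q.IsSymm
  det_ne_zero : L.det ≠ 0
  arg_det : L.det = (-1) ^ m * |L.det|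

/-- `S` is the free symplectic map generated by `W`:
`(x, p) = S(x', p')` if and only if `p = ∂ₓW(x, x')` and `p' = -∂_{x'}W(x, x')`. -/
def IsFreeSymplectic (P L Q : Matrix (Fin n) (Fin n) ℝ) (S : Phase n ≃L[ℝ] Phase n) : Prop :=
  ∀ x p x' p' : Position n, (x, p) = S (x', p') ↔
    p = gradient (fun y => quadGen P L Q y x') x ∧ p' = -gradient (fun y => quadGen P L Q x y) x'

/-- `A` is the generalized Fourier transform `Ŝ_{W,m}`, that is, the unitary operator with
`Aψ(x) = (1/(2πiħ))^{n/2} i^m |det L|^{1/2} ∫ e^{(i/ħ)W(x,x')} ψ(x') dx'` for Schwartz `ψ`. -/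
def IsQuadraticFourier (ħ : ℝ) (P L Q : Matrix (Fin n) (Fin n) ℝ) (m : ℤ)
    (A : WaveFn n ≃ₗᵢ[ℂ] WaveFn n) : Prop :=
  ∀ ψ : 𝓢(Position n, ℂ), A (ψ.toLp 2 volume) =ᵐ[volume] fun x =>
    (1 / (2 * Real.pi * Complex.I * ħ) : ℂ) ^ ((n : ℂ) / 2) * Complex.I ^ m *
      (Real.sqrt |L.det| : ℝ) *
      ∫ x' : Position n, Complex.exp (Complex.I / ħ * (quadGen P L Q x x' : ℝ)) * ψ x'

/-- The metaplectic group `Mp(n)`: the group of unitary operators generated by the `Ŝ_{W,m}`. -/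
def metaplecticGroup (n : ℕ) (ħ : ℝ) : Subgroup (WaveFn n ≃ₗᵢ[ℂ] WaveFn n) :=
  Subgroup.closure {A | ∃ P L Q m, IsGenerating P L Q m ∧ IsQuadraticFourier ħ P L Q m A}

/-- The graph of the projection `π : Mp(n) → Sp(n)`, as the group of pairs `(S, Ŝ)` with
`π(Ŝ) = S`. The projection is the homomorphism with `π(Ŝ_{W,m}) = S_W`, hence its graph is the
group generated by the pairs `(S_W, Ŝ_{W,m})`. -/
def metaplecticCover (n : ℕ) (ħ : ℝ) :
    Subgroup ((Phase n ≃L[ℝ] Phase n) × (WaveFn n ≃ₗᵢ[ℂ] WaveFn n)) :=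
  Subgroup.closure {q | ∃ P L Q m, IsGenerating P L Q m ∧ IsFreeSymplectic P L Q q.1 ∧
    IsQuadraticFourier ħ P L Q m q.2}

/-! ### Metaplectic operators on phase space -/

/-- The dot product on `ℝ²ⁿ`. -/
def phaseDot (z z' : Phase n) : ℝ := inner ℝ z.1 z'.1 + inner ℝ z.2 z'.2

/-- The standard symplectic matrix: `J(x, p) = (p, -x)`. -/
def symplJ (n : ℕ) : Phase n →L[ℝ] Phase n :=
  (ContinuousLinearMap.snd ℝ (Position n) (Position n)).prod
    (-ContinuousLinearMap.fst ℝ (Position n) (Position n))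

theorem sympl_eq_phaseDot (z z' : Phase n) : sympl z z' = phaseDot z' (symplJ n z) := by
  simp [sympl, phaseDot, symplJ, real_inner_comm]
  ring

/-- The symplectic Cayley transform `M_S = (1/2) J (S + I)(S - I)⁻¹`, for `det(S - I) ≠ 0`. -/
def symplCayley (S : Phase n →L[ℝ] Phase n) : Phase n →L[ℝ] Phase n :=
  (1 / 2 : ℝ) • (symplJ n * (S + 1) * Ring.inverse (S - 1))

/-- The number of negative eigenvalues, with multiplicity, of the Hessian matrix
`W_xx = P + Q - L - Lᵀ` of `x ↦ W(x, x)`. -/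
def inertia (P L Q : Matrix (Fin n) (Fin n) ℝ) : ℕ :=
  (P + Q - L - L.transpose).charpoly.roots.countP (· < 0)

/-- `B` is the phase-space counterpart `(Ŝ_{W,m})_ph` of `Ŝ_{W,m}`, where `S = S_W` and
`det(S - I) ≠ 0`: the unitary operator on `L²(ℝ²ⁿ)` such that, for Schwartz `Ψ`,
`BΨ(z) = (2πħ)^{-n} i^{m - Inert W_xx} |det(S - I)|^{-1/2} ∫ e^{(i/2ħ) M_S z₀²} T̂_ph(z₀)Ψ(z) dz₀`.
The last factor of the integrand is written out; the integral converges absolutely. -/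
def IsQuadraticFourierPh (ħ : ℝ) (P L Q : Matrix (Fin n) (Fin n) ℝ) (m : ℤ)
    (S : Phase n ≃L[ℝ] Phase n) (B : PhaseFn n ≃ₗᵢ[ℂ] PhaseFn n) : Prop :=
  ∀ Ψ : 𝓢(Phase n, ℂ), B (Ψ.toLp 2 volume) =ᵐ[volume] fun z =>
    (((1 / (2 * Real.pi * ħ)) ^ n : ℝ) : ℂ) * Complex.I ^ (m - inertia P L Q) /
      (Real.sqrt |((S : Phase n →L[ℝ] Phase n) - 1).det| : ℝ) *
      ∫ z₀ : Phase n, Complex.exp (Complex.I / (2 * ħ) *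
          (phaseDot (symplCayley (S : Phase n →L[ℝ] Phase n) z₀) z₀ : ℝ)) *
        (Complex.exp (Complex.I * ((1 / (2 * ħ) * sympl z₀ z : ℝ) : ℂ)) * Ψ (z - z₀))

/-- The correspondence `Ŝ ↦ Ŝ_ph` between `Mp(n)` and `Mp_ph(n)`, as the group of pairs
`(Ŝ, Ŝ_ph)`: it is generated by the pairs `(Ŝ_{W,m}, (Ŝ_{W,m})_ph)` with `det(S_W - I) ≠ 0`. -/
def phaseSpaceCorrespondence (n : ℕ) (ħ : ℝ) :
    Subgroup ((WaveFn n ≃ₗᵢ[ℂ] WaveFn n) × (PhaseFn n ≃ₗᵢ[ℂ] PhaseFn n)) :=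
  Subgroup.closure {q | ∃ P L Q m S, IsGenerating P L Q m ∧ IsFreeSymplectic P L Q S ∧
    IsQuadraticFourier ħ P L Q m q.1 ∧ ((S : Phase n →L[ℝ] Phase n) - 1).det ≠ 0 ∧
    IsQuadraticFourierPh ħ P L Q m S q.2}

open Classical in
/-- The operator `Ŝ_ph` on `L²(ℝ²ⁿ)` attached to a metaplectic operator `Ŝ`. -/
def phaseSpaceMetaplectic (ħ : ℝ) (A : WaveFn n ≃ₗᵢ[ℂ] WaveFn n) : PhaseFn n ≃ₗᵢ[ℂ] PhaseFn n :=
  if h : ∃ B, (A, B) ∈ phaseSpaceCorrespondence n ħ then h.choose else 1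

/-! ### Hamiltonian flows and the nearby-orbit propagator -/

/-- A possibly time-dependent Hamiltonian function: `H(z, t)` is `C²` in `z`, and `H`, `∂_z H` and
`∂_z² H` are continuous in `(z, t)`. -/
structure IsHamiltonian (H : Phase n → ℝ → ℝ) : Prop where
  contDiff : ∀ t, ContDiff ℝ 2 (fun z => H z t)
  continuous : Continuous fun q : Phase n × ℝ => H q.1 q.2
  continuous_fderiv : Continuous fun q : Phase n × ℝ => fderiv ℝ (fun z => H z q.2) q.1
  continuous_fderiv_fderiv :
    Continuous fun q : Phase n × ℝ => fderiv ℝ (fderiv ℝ fun z => H z q.2) q.1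

/-- The Hamiltonian vector field `J ∂_z H(z, t)`, where `∂_z = (∂_x, ∂_p)`. -/
def hamiltonianField (H : Phase n → ℝ → ℝ) (z : Phase n) (t : ℝ) : Phase n :=
  symplJ n (gradient (fun x => H (x, z.2) t) z.1, gradient (fun p => H (z.1, p) t) z.2)

/-- `f` is the Hamiltonian flow of `H` on the set `D` of initial points and the time interval
`T`: for `z ∈ D`, `t ↦ f_t(z)` solves Hamilton's equations on `T` and `f_0(z) = z`. -/
structure IsHamiltonianFlow (H : Phase n → ℝ → ℝ) (T : Set ℝ) (D : Set (Phase n))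
    (f : ℝ → Phase n → Phase n) : Prop where
  initial : ∀ z ∈ D, f 0 z = z
  hamilton : ∀ z ∈ D, ∀ t ∈ T, HasDerivAt (fun s => f s z) (hamiltonianField H (f t z) t) t

/-- `Ŝ` is the lift to `Mp(n)`, on the time interval `T`, of the path `t ↦ S_t` in `Sp(n)`: a
(strongly) continuous path of metaplectic operators with `Ŝ_0 = I` and `π(Ŝ_t) = S_t`. -/
structure IsMetaplecticLift (ħ : ℝ) (T : Set ℝ) (S : ℝ → Phase n ≃L[ℝ] Phase n)
    (Shat : ℝ → WaveFn n ≃ₗᵢ[ℂ] WaveFn n) : Prop where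
  initial : Shat 0 = 1
  continuousOn : ∀ ψ, ContinuousOn (fun t => Shat t ψ) T
  mem : ∀ t ∈ T, Shat t ∈ metaplecticGroup n ħ
  proj : ∀ t ∈ T, (S t, Shat t) ∈ metaplecticCover n ħ

/-- The phase `γ(z₀, t) = ∫₀ᵗ ((1/2) σ(z(s), ż(s)) - H(z(s), s)) ds`, where `z(s) = f_s(z₀)`. -/
def orbitPhase (H : Phase n → ℝ → ℝ) (f : ℝ → Phase n → Phase n) (z₀ : Phase n) (t : ℝ) : ℝ :=
  ∫ s in (0 : ℝ)..t, (1 / 2 * sympl (f s z₀) (deriv (fun r => f r z₀) s) - H (f s z₀) s)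

/-- The phase factor `e^{(i/ħ) γ(z₀, t)}`. -/
def phaseFactor (ħ : ℝ) (H : Phase n → ℝ → ℝ) (f : ℝ → Phase n → Phase n) (z₀ : Phase n)
    (t : ℝ) : ℂ :=
  Complex.exp (Complex.I / ħ * (orbitPhase H f z₀ t : ℝ))

/-- The nearby-orbit semiclassical propagator
`U(t, z₀)ψ₀ = e^{(i/ħ) γ(z₀, t)} T̂(f_t(z₀)) Ŝ_t(z₀) T̂(z₀)⁻¹ ψ₀`. -/
def nearbyOrbitPropagator (ħ : ℝ) (H : Phase n → ℝ → ℝ) (f : ℝ → Phase n → Phase n)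
    (Shat : ℝ → WaveFn n ≃ₗᵢ[ℂ] WaveFn n) (z₀ : Phase n) (t : ℝ) (ψ₀ : WaveFn n) : WaveFn n :=
  phaseFactor ħ H f z₀ t •
    heisenbergWeyl ħ (f t z₀) (Shat t ((heisenbergWeyl ħ z₀)⁻¹ ψ₀))

end NearbyOrbit

end

open NearbyOrbit

/-! The transform `U_φ` intertwines each factor of the propagator with its phase-space counterpart.
For the Heisenberg–Weyl operators this is a change of variables
(`wavePacketTransform_heisenbergWeyl`). For metaplectic operators it is
`wavePacketTransform_of_mem_correspondence`. Part (i) follows by moving `U_φ` through the product,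
and (ii) because `T̂(z₀)⁻¹` cancels the `T̂(z₀)` in the coherent state.

The analytic core is `U_φ Ŝ_{W,m} = (Ŝ_{W,m})_ph U_φ` when `det(S_W - I) ≠ 0`. Since `S_W` is
symplectic, the kernel of `(Ŝ_{W,m})_ph` factors as chirp, Fourier kernel, chirp. Hence the operator
is unitary and its integral formula holds on all of `L¹ ∩ L²`. To get integrability, the wave packet
of a Schwartz function is cut off by `e^{-ε|q|²}` in momentum. As a function of `p₀`, the phase `M_S
z₀·z₀ / 2` is a Legendre transform of `y ↦ W(y + x₀/2, y - x₀/2)`, with quadratic part given by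
`-R⁻¹`, where `R = W_xx`. The momentum integral is therefore a Fresnel integral, and its limit
restores `W`. The limit also produces `√|det R|`, a power of `e^{-iπ/4}` and `i^{Inert R}`. The last
cancels the index in `Ŝ_ph`, and `|det R| = |det(S - I)| |det L|` leaves the normalisation of
`Ŝ_{W,m}`. Letting `ε → 0`, unitarity controls the `L²` side and dominated convergence the pointwise
side. Density of Schwartz functions and closure under group operations do the rest.

Existence of `Ŝ_ph`: a generator `A` with degenerate `W_xx` is `(cA)(c²A)⁻¹(cA)` for a chirp `c`
that makes both shifted Hessians invertible.

Uniqueness: two candidates agree on the range of `U_φ` for every window `φ`, and these ranges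
together are total (`eq_zero_of_inner_wavePacketTransform`). If `Θ` is orthogonal to all of them,
modulating window and state oppositely shows that the Fourier transform of `U_φψ · conj Θ` vanishes.
So this product is zero, and translating `U_φψ` over all of phase space forces `Θ = 0`. -/

noncomputable section

namespace NearbyOrbit

/-! ### The `L²` Fourier transform as an integral. -/

section FourierL2

variable {V : Type*} [NormedAddCommGroup V] [InnerProductSpace ℝ V] [FiniteDimensional ℝ V]
  [MeasurableSpace V] [BorelSpace V]

open FourierTransform in
/-- The Fourier transform on `L²` is given by the Fourier integral on `L¹ ∩ L²`. -/
theorem fourierTransformₗᵢ_toLp_ae {f : V → ℂ} (h1 : Integrable f) (h2 : MemLp f 2) :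
    Lp.fourierTransformₗᵢ V ℂ (h2.toLp f) =ᵐ[volume] 𝓕 f := by
  have hc : Continuous (𝓕 f) :=
    VectorFourier.fourierIntegral_continuous Real.continuous_fourierChar
      (L := innerₗ V) continuous_inner h1
  -- Both sides are tested against smooth compactly supported `g`. The left side is handled by the
  -- Fourier transform of tempered distributions, the right side by the multiplication formula `∫ 𝓕f
  -- · g = ∫ f · 𝓕g`.
  refine ae_eq_of_integral_contDiff_smul_eq
    ((Lp.memLp _).locallyIntegrable (by norm_num)) hc.locallyIntegrable fun g hg hgc => ?_
  have hg₁ : HasCompactSupport (Complex.ofRealCLM ∘ g) := hgc.comp_left rfl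
  have hg₂ : ContDiff ℝ (⊤ : ℕ∞) (Complex.ofRealCLM ∘ g) := by fun_prop
  have key := congrArg (fun u => u (hg₁.toSchwartzMap hg₂))
    (Lp.fourier_toTemperedDistribution_eq (h2.toLp f))
  simp only [TemperedDistribution.fourier_apply, Lp.toTemperedDistribution_apply] at key
  have e1 : ∫ x, g x • (Lp.fourierTransformₗᵢ V ℂ (h2.toLp f)) x =
      ∫ x, (hg₁.toSchwartzMap hg₂) x • (𝓕 (h2.toLp f) : Lp ℂ 2 (volume : Measure V)) x := by
    refine integral_congr_ae (Filter.Eventually.of_forall fun x => ?_)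
    simp only [HasCompactSupport.toSchwartzMap_toFun, Function.comp_apply,
      Complex.ofRealCLM_apply, Complex.real_smul, smul_eq_mul]
    rfl
  have e2 : ∫ x, g x • 𝓕 f x = ∫ x, (hg₁.toSchwartzMap hg₂) x • 𝓕 f x := by
    refine integral_congr_ae (Filter.Eventually.of_forall fun x => ?_)
    simp only [HasCompactSupport.toSchwartzMap_toFun, Function.comp_apply,
      Complex.ofRealCLM_apply, Complex.real_smul, smul_eq_mul]
  rw [e1, ← key, e2]
  have e3 := VectorFourier.integral_fourierIntegral_smul_eq_flip (L := innerₗ V)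
    (μ := volume) (ν := volume) Real.continuous_fourierChar continuous_inner
    (hg₁.toSchwartzMap hg₂).integrable h1
  rw [flip_innerₗ] at e3
  refine Eq.trans ?_ e3
  refine integral_congr_ae ?_
  filter_upwards [h2.coeFn_toLp] with x hx
  rw [hx]
  rfl

end FourierL2

/-! ### Unitary changes of variables. -/

section Dilation

variable {α β : Type*} [MeasurableSpace α] [MeasurableSpace β] {μ : Measure α} {ν : Measure β}

/-- The substitution scales the squared `L²` norm by `k⁻²`, and the prefactor `k` compensates
exactly. -/
theorem eLpNorm_comp_of_map_eq_smul {g : α → β} (hgm : Measurable g) {k : ℝ} (hk : 0 < k)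
    (hg : μ.map g = ENNReal.ofReal (k ^ 2)⁻¹ • ν) {f : β → ℂ} (hf : AEStronglyMeasurable f ν) :
    eLpNorm (fun x => (k : ℂ) * f (g x)) 2 μ = eLpNorm f 2 ν := by
  have h0 : ENNReal.ofReal (k ^ 2)⁻¹ ≠ 0 := by
    rw [Ne, ENNReal.ofReal_eq_zero, not_le]; positivity
  have hf' : AEStronglyMeasurable f (μ.map g) := by
    rw [hg]; exact hf.smul_measure _
  have h1 : eLpNorm (f ∘ g) 2 μ = eLpNorm f 2 (μ.map g) :=
    (eLpNorm_map_measure hf' hgm.aemeasurable).symm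
  have h2 : (fun x => (k : ℂ) * f (g x)) = (k : ℂ) • (f ∘ g) := rfl
  rw [h2, eLpNorm_const_smul, h1, hg, eLpNorm_smul_measure_of_ne_top (by norm_num), smul_eq_mul,
    ← mul_assoc]
  convert one_mul _
  rw [show (1 / 2 : ℝ≥0∞).toReal = 1 / 2 by simp,
    ENNReal.ofReal_rpow_of_nonneg (by positivity) (by norm_num),
    ← Real.sqrt_eq_rpow, Real.sqrt_inv, Real.sqrt_sq hk.le, ← ofReal_norm, Complex.norm_real,
    Real.norm_of_nonneg hk.le, ← ENNReal.ofReal_mul hk.le, mul_inv_cancel₀ hk.ne',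
    ENNReal.ofReal_one]

/-- Surjectivity holds because the pair `(g⁻¹, k⁻¹)` satisfies the same relation between the
measures, so the same formula produces preimages. -/
theorem exists_dilation_unitary (g : α ≃ᵐ β) {k : ℝ} (hk : 0 < k)
    (hg : μ.map g = ENNReal.ofReal (k ^ 2)⁻¹ • ν) :
    ∃ U : Lp ℂ 2 ν ≃ₗᵢ[ℂ] Lp ℂ 2 μ, ∀ f, U f =ᵐ[μ] fun x => (k : ℂ) * f (g x) := by
  have hqm : Measure.QuasiMeasurePreserving g μ ν := by
    refine ⟨g.measurable, ?_⟩
    rw [hg]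
    exact Measure.smul_absolutelyContinuous
  have hmem : ∀ f : β → ℂ, MemLp f 2 ν → MemLp (fun x => (k : ℂ) * f (g x)) 2 μ := by
    intro f hf
    refine ⟨(hf.1.comp_quasiMeasurePreserving hqm).const_mul _, ?_⟩
    rw [eLpNorm_comp_of_map_eq_smul g.measurable hk hg hf.1]
    exact hf.2
  let T : Lp ℂ 2 ν →ₗᵢ[ℂ] Lp ℂ 2 μ :=
    { toFun := fun f => (hmem f (Lp.memLp f)).toLp _
      map_add' := fun f h => by
        apply Lp.ext
        filter_upwards [(hmem _ (Lp.memLp (f + h))).coeFn_toLp, (hmem _ (Lp.memLp f)).coeFn_toLp,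
          (hmem _ (Lp.memLp h)).coeFn_toLp, Lp.coeFn_add ((hmem _ (Lp.memLp f)).toLp _)
          ((hmem _ (Lp.memLp h)).toLp _), hqm.ae (Lp.coeFn_add f h)] with x h1 h2 h3 h4 h5
        rw [h1, h4, Pi.add_apply, h2, h3, h5, Pi.add_apply, mul_add]
      map_smul' := fun c f => by
        apply Lp.ext
        filter_upwards [(hmem _ (Lp.memLp (c • f))).coeFn_toLp, (hmem _ (Lp.memLp f)).coeFn_toLp,
          Lp.coeFn_smul c ((hmem _ (Lp.memLp f)).toLp _),
          hqm.ae (Lp.coeFn_smul c f)] with x h1 h2 h3 h4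
        rw [RingHom.id_apply, h1, h3, Pi.smul_apply, h2, h4, Pi.smul_apply, smul_eq_mul,
          smul_eq_mul]
        ring
      norm_map' := fun f => by
        change ‖(hmem f (Lp.memLp f)).toLp _‖ = ‖f‖
        rw [Lp.norm_toLp, eLpNorm_comp_of_map_eq_smul g.measurable hk hg (Lp.memLp f).1,
          Lp.norm_def] }
  have hT : ∀ f, T f =ᵐ[μ] fun x => (k : ℂ) * f (g x) := fun f =>
    (hmem f (Lp.memLp f)).coeFn_toLp
  have hk' : 0 < k⁻¹ := by positivity
  have hg' : ν.map g.symm = ENNReal.ofReal ((k⁻¹) ^ 2)⁻¹ • μ := by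
    have h1 : ν = ENNReal.ofReal (k ^ 2) • μ.map g := by
      rw [hg, smul_smul, ← ENNReal.ofReal_mul (by positivity), mul_inv_cancel₀ (by positivity),
        ENNReal.ofReal_one, one_smul]
    rw [h1, Measure.map_smul, Measure.map_map g.symm.measurable g.measurable]
    simp
  have hqm' : Measure.QuasiMeasurePreserving g.symm ν μ := by
    refine ⟨g.symm.measurable, ?_⟩
    rw [hg']
    exact Measure.smul_absolutelyContinuous
  have hsurj : Function.Surjective T := by
    intro f
    have hm : MemLp (fun y => ((k⁻¹ : ℝ) : ℂ) * f (g.symm y)) 2 ν := by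
      refine ⟨((Lp.memLp f).1.comp_quasiMeasurePreserving hqm').const_mul _, ?_⟩
      rw [eLpNorm_comp_of_map_eq_smul g.symm.measurable hk' hg' (Lp.memLp f).1]
      exact (Lp.memLp f).2
    refine ⟨hm.toLp _, Lp.ext ?_⟩
    filter_upwards [hT (hm.toLp _), hqm.ae hm.coeFn_toLp] with x h1 h2
    rw [h1, h2, g.symm_apply_apply, ← mul_assoc, ← Complex.ofReal_mul, mul_inv_cancel₀ hk.ne',
      Complex.ofReal_one, one_mul]
  exact ⟨LinearIsometryEquiv.ofSurjective T hsurj, hT⟩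

end Dilation

/-! ### Oscillatory integral operators on phase space. -/

variable {n : ℕ}

theorem phaseTranslate_ae {E : Type*} [NormedAddCommGroup E] [MeasureSpace E] [BorelSpace E]
    [(volume : Measure E).IsAddRightInvariant] (θ : E → ℝ) (hθ : Continuous θ) (a : E)
    (ψ : Lp ℂ 2 (volume : Measure E)) :
    phaseTranslate θ hθ a ψ =ᵐ[volume] fun x => Complex.exp (Complex.I * θ x) * ψ (x - a) :=
  phaseTranslateFun_ae θ hθ a ψ

theorem norm_exp_I_mul_ofReal (r : ℝ) : ‖Complex.exp (Complex.I * r)‖ = 1 := by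
  rw [mul_comm, Complex.norm_exp_ofReal_mul_I]

/-- Oscillatory integral operators with a nondegenerate bilinear phase are unitary on `L²(ℝ²ⁿ)`. -/
theorem exists_oscillatory_unitary (a b : Phase n → ℝ) (ha : Continuous a) (hb : Continuous b)
    (T : Phase n ≃L[ℝ] Phase n) :
    ∃ B : PhaseFn n ≃ₗᵢ[ℂ] PhaseFn n, ∀ (Ψ : Phase n → ℂ) (_ : Integrable Ψ) (h2 : MemLp Ψ 2),
      B (h2.toLp Ψ) =ᵐ[volume] fun z =>
        (Real.sqrt |(T : Phase n →L[ℝ] Phase n).det| : ℝ) * Complex.exp (Complex.I * a z) *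
          ∫ u, Complex.exp (Complex.I * ((-2 * Real.pi * phaseDot (T z) u : ℝ) : ℂ)) *
            (Complex.exp (Complex.I * b u) * Ψ u) := by
  -- `Phase n` carries the sup norm of a product, while the Fourier transform needs an inner product
  -- space. The measure-preserving identification with the `L²`-product supplies one.
  let e : Phase n ≃L[ℝ] WithLp 2 (Position n × Position n) :=
    (WithLp.prodContinuousLinearEquiv 2 ℝ (Position n) (Position n)).symm
  have he : MeasurePreserving e volume volume :=
    WithLp.volume_preserving_toLp (Position n) (Position n)
  let em : Phase n ≃ᵐ WithLp 2 (Position n × Position n) := e.toHomeomorph.toMeasurableEquiv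
  have hem : ∀ z, em z = e z := fun _ => rfl
  have hdet : (T : Phase n →L[ℝ] Phase n).det ≠ 0 := T.toLinearEquiv.isUnit_det'.ne_zero
  let gm : Phase n ≃ᵐ WithLp 2 (Position n × Position n) :=
    (T.trans e).toHomeomorph.toMeasurableEquiv
  have hgm : ∀ z, gm z = e (T z) := fun _ => rfl
  obtain ⟨U1, hU1⟩ := exists_dilation_unitary (μ := (volume : Measure (WithLp 2 _)))
    (ν := (volume : Measure (Phase n))) em.symm (k := 1) one_pos (by
      rw [one_pow, inv_one, ENNReal.ofReal_one, one_smul]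
      exact (MeasurePreserving.symm em he).map_eq)
  set k := Real.sqrt |(T : Phase n →L[ℝ] Phase n).det| with hkdef
  have hk : 0 < k := Real.sqrt_pos.2 (abs_pos.2 hdet)
  obtain ⟨U2, hU2⟩ := exists_dilation_unitary (μ := (volume : Measure (Phase n)))
    (ν := (volume : Measure (WithLp 2 _))) gm (k := k) hk (by
      rw [Real.sq_sqrt (abs_nonneg _), ← abs_inv]
      have h1 : (gm : Phase n → _) = e ∘ ((T : Phase n →L[ℝ] Phase n) : Phase n →ₗ[ℝ] Phase n) :=
        rfl
      rw [h1, ← Measure.map_map e.continuous.measurable (by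
        exact T.continuous.measurable), Measure.map_linearMap_addHaar_eq_smul_addHaar _ hdet,
        Measure.map_smul, he.map_eq])
  -- Multiplication by `e^{ib}`, transfer to the Euclidean model, Fourier transform, substitution of
  -- `T z` with its Jacobian factor, multiplication by `e^{ia}`: each factor is unitary.
  refine ⟨(phaseTranslate b hb 0).trans (U1.trans ((Lp.fourierTransformₗᵢ _ ℂ).trans
    (U2.trans (phaseTranslate a ha 0)))), fun Ψ h1 h2 => ?_⟩
  let G : WithLp 2 (Position n × Position n) → ℂ :=
    fun v => Complex.exp (Complex.I * b (em.symm v)) * Ψ (em.symm v)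
  have hbΨ : Integrable fun u => Complex.exp (Complex.I * b u) * Ψ u := by
    refine h1.bdd_mul (c := 1) (Continuous.aestronglyMeasurable (by fun_prop)) ?_
    exact Filter.Eventually.of_forall fun x => (norm_exp_I_mul_ofReal _).le
  have hbΨ2 : MemLp (fun u => Complex.exp (Complex.I * b u) * Ψ u) 2 := by
    refine h2.of_le ((Continuous.aestronglyMeasurable (by fun_prop)).mul h2.1)
      (Filter.Eventually.of_forall fun x => ?_)
    rw [norm_mul, norm_exp_I_mul_ofReal, one_mul]
  have hG1 : Integrable G :=
    ((MeasurePreserving.symm em he).integrable_comp_emb em.symm.measurableEmbedding).2 hbΨ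
  have hG2 : MemLp G 2 := hbΨ2.comp_measurePreserving (MeasurePreserving.symm em he)
  have hGL : U1 (phaseTranslate b hb 0 (h2.toLp Ψ)) = hG2.toLp G := by
    apply Lp.ext
    have hqm := (MeasurePreserving.symm em he).quasiMeasurePreserving
    filter_upwards [hU1 (phaseTranslate b hb 0 (h2.toLp Ψ)), hG2.coeFn_toLp,
      hqm.ae (phaseTranslate_ae b hb 0 (h2.toLp Ψ)), hqm.ae h2.coeFn_toLp] with v h3 h4 h5 h6
    rw [h3, h4, h5, sub_zero, h6, Complex.ofReal_one, one_mul]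
  have hqg : Measure.QuasiMeasurePreserving gm (volume : Measure (Phase n)) volume := by
    have : (gm : Phase n → _) = e ∘ ((T : Phase n →L[ℝ] Phase n) : Phase n →ₗ[ℝ] Phase n) :=
        rfl
    rw [this]
    refine he.quasiMeasurePreserving.comp ⟨T.continuous.measurable, ?_⟩
    rw [Measure.map_linearMap_addHaar_eq_smul_addHaar _ hdet]
    exact Measure.smul_absolutelyContinuous
  have hF := hqg.ae (fourierTransformₗᵢ_toLp_ae hG1 hG2)
  filter_upwards [hF, phaseTranslate_ae a ha 0 (U2 (Lp.fourierTransformₗᵢ _ ℂ (hG2.toLp G))),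
    hU2 (Lp.fourierTransformₗᵢ _ ℂ (hG2.toLp G))] with z h3 h4 h5
  simp only [LinearIsometryEquiv.trans_apply]
  rw [hGL, h4, sub_zero, h5, h3, Real.fourier_eq', ← mul_assoc, mul_comm (Complex.exp _)]
  congr 1
  rw [← he.integral_comp em.measurableEmbedding]
  refine integral_congr_ae (Filter.Eventually.of_forall fun u => ?_)
  have h6 : em.symm (e u) = u := em.symm_apply_apply u
  have h7 : inner ℝ (e u) (gm z) = phaseDot (T z) u := by
    rw [hgm, WithLp.prod_inner_apply, phaseDot]
    exact congrArg₂ _ (real_inner_comm _ _) (real_inner_comm _ _)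
  simp only [G, smul_eq_mul, h6, h7]
  rw [mul_comm Complex.I ((-2 * Real.pi * _ : ℝ) : ℂ)]

/-! ### Quadratic generating functions and free symplectic maps. -/

section QuadraticForm

theorem inner_toEuclideanLin_left (A : Matrix (Fin n) (Fin n) ℝ) (x y : Position n) :
    inner ℝ (Matrix.toEuclideanLin A x) y = inner ℝ x (Matrix.toEuclideanLin A.transpose y) := by
  rw [← Matrix.conjTranspose_eq_transpose_of_trivial, Matrix.toEuclideanLin_conjTranspose_eq_adjoint,
    LinearMap.adjoint_inner_right]

theorem inner_toEuclideanLin_of_isSymm {A : Matrix (Fin n) (Fin n) ℝ} (hA : A.IsSymm)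
    (x y : Position n) :
    inner ℝ (Matrix.toEuclideanLin A x) y = inner ℝ x (Matrix.toEuclideanLin A y) := by
  rw [inner_toEuclideanLin_left, hA.eq]

theorem toEuclideanLin_mul_apply (A B : Matrix (Fin n) (Fin n) ℝ) (x : Position n) :
    Matrix.toEuclideanLin A (Matrix.toEuclideanLin B x) = Matrix.toEuclideanLin (A * B) x := by
  simp [Matrix.toEuclideanLin, Matrix.toLpLin_apply, Matrix.mulVec_mulVec]

theorem toEuclideanLin_one_apply (x : Position n) :
    Matrix.toEuclideanLin (1 : Matrix (Fin n) (Fin n) ℝ) x = x := by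
  simp [Matrix.toEuclideanLin]

theorem hasGradientAt_quadratic {A : Matrix (Fin n) (Fin n) ℝ} (hA : A.IsSymm) (b : Position n)
    (c : ℝ) (x : Position n) :
    HasGradientAt (fun y => 1 / 2 * inner ℝ (Matrix.toEuclideanLin A y) y - inner ℝ b y + c)
      (Matrix.toEuclideanLin A x - b) x := by
  rw [hasGradientAt_iff_hasFDerivAt]
  have h1 : HasFDerivAt (fun y => Matrix.toEuclideanLin A y)
      (LinearMap.toContinuousLinearMap (Matrix.toEuclideanLin A)) x :=
    (LinearMap.toContinuousLinearMap (Matrix.toEuclideanLin A)).hasFDerivAt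
  have h2 := (((h1.inner ℝ (hasFDerivAt_id x)).const_mul (1 / 2 : ℝ)).sub
    ((hasFDerivAt_const b x).inner ℝ (hasFDerivAt_id x))).add_const c
  refine h2.congr_fderiv ?_
  ext v
  simp [fderivInnerCLM_apply]
  rw [inner_toEuclideanLin_of_isSymm hA v x, real_inner_comm v]
  ring

variable {P L Q : Matrix (Fin n) (Fin n) ℝ}

theorem gradient_quadGen_left (hP : P.IsSymm) (x x' : Position n) :
    gradient (fun y => quadGen P L Q y x') x =
      Matrix.toEuclideanLin P x - Matrix.toEuclideanLin L.transpose x' := by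
  refine HasGradientAt.gradient ?_
  convert hasGradientAt_quadratic hP (Matrix.toEuclideanLin L.transpose x')
    (1 / 2 * inner ℝ (Matrix.toEuclideanLin Q x') x') x using 2 with y
  rw [quadGen, inner_toEuclideanLin_left L, real_inner_comm (Matrix.toEuclideanLin L.transpose x') y]

theorem gradient_quadGen_right (hQ : Q.IsSymm) (x x' : Position n) :
    gradient (fun y => quadGen P L Q x y) x' =
      Matrix.toEuclideanLin Q x' - Matrix.toEuclideanLin L x := by
  refine HasGradientAt.gradient ?_
  convert hasGradientAt_quadratic hQ (Matrix.toEuclideanLin L x)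
    (1 / 2 * inner ℝ (Matrix.toEuclideanLin P x) x) x' using 2 with y
  rw [quadGen]
  ring

theorem isFreeSymplectic_iff (hP : P.IsSymm) (hQ : Q.IsSymm) (S : Phase n ≃L[ℝ] Phase n) :
    IsFreeSymplectic P L Q S ↔ ∀ x p x' p' : Position n, (x, p) = S (x', p') ↔
      p = Matrix.toEuclideanLin P x - Matrix.toEuclideanLin L.transpose x' ∧
      p' = Matrix.toEuclideanLin L x - Matrix.toEuclideanLin Q x' := by
  simp only [IsFreeSymplectic, gradient_quadGen_left hP, gradient_quadGen_right hQ, neg_sub]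

theorem exists_isFreeSymplectic (hP : P.IsSymm) (hQ : Q.IsSymm) (hL : L.det ≠ 0) :
    ∃ S : Phase n ≃L[ℝ] Phase n, IsFreeSymplectic P L Q S := by
  have hu : IsUnit L.det := hL.isUnit
  have hut : IsUnit L.transpose.det := by rwa [Matrix.det_transpose]
  have e1 : ∀ x, Matrix.toEuclideanLin L⁻¹ (Matrix.toEuclideanLin L x) = x := fun x => by
    rw [toEuclideanLin_mul_apply, Matrix.nonsing_inv_mul _ hu, toEuclideanLin_one_apply]
  have e2 : ∀ x, Matrix.toEuclideanLin L (Matrix.toEuclideanLin L⁻¹ x) = x := fun x => by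
    rw [toEuclideanLin_mul_apply, Matrix.mul_nonsing_inv _ hu, toEuclideanLin_one_apply]
  have e3 : ∀ x, Matrix.toEuclideanLin L.transpose⁻¹ (Matrix.toEuclideanLin L.transpose x) = x :=
    fun x => by
      rw [toEuclideanLin_mul_apply, Matrix.nonsing_inv_mul _ hut, toEuclideanLin_one_apply]
  have e4 : ∀ x, Matrix.toEuclideanLin L.transpose (Matrix.toEuclideanLin L.transpose⁻¹ x) = x :=
    fun x => by
      rw [toEuclideanLin_mul_apply, Matrix.mul_nonsing_inv _ hut, toEuclideanLin_one_apply]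
  -- The relations `p = Px - Lᵀx'` and `p' = Lx - Qx'` are solved for `(x, p)` using `L⁻¹`, and for
  -- `(x', p')` using `(Lᵀ)⁻¹`.
  let S₀ : Phase n ≃ₗ[ℝ] Phase n :=
    { toFun := fun z => (Matrix.toEuclideanLin L⁻¹ (z.2 + Matrix.toEuclideanLin Q z.1),
        Matrix.toEuclideanLin P (Matrix.toEuclideanLin L⁻¹ (z.2 + Matrix.toEuclideanLin Q z.1)) -
          Matrix.toEuclideanLin L.transpose z.1)
      invFun := fun z => (Matrix.toEuclideanLin L.transpose⁻¹ (Matrix.toEuclideanLin P z.1 - z.2),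
        Matrix.toEuclideanLin L z.1 - Matrix.toEuclideanLin Q
          (Matrix.toEuclideanLin L.transpose⁻¹ (Matrix.toEuclideanLin P z.1 - z.2)))
      map_add' := fun z z' => by
        ext1 <;> simp only [Prod.fst_add, Prod.snd_add, map_add] <;> abel
      map_smul' := fun c z => by
        ext1 <;> simp only [Prod.smul_fst, Prod.smul_snd, map_add, map_smul, smul_add, smul_sub,
          RingHom.id_apply]
      left_inv := fun z => by
        ext1 <;> simp only [sub_sub_cancel, e3, e2, add_sub_cancel_right]
      right_inv := fun z => by
        ext1 <;> simp only [sub_add_cancel, e1, e4, sub_sub_cancel] }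
  refine ⟨S₀.toContinuousLinearEquiv, (isFreeSymplectic_iff hP hQ _).2 fun x p x' p' => ?_⟩
  change (x, p) = (Matrix.toEuclideanLin L⁻¹ (p' + Matrix.toEuclideanLin Q x'),
    Matrix.toEuclideanLin P (Matrix.toEuclideanLin L⁻¹ (p' + Matrix.toEuclideanLin Q x')) -
      Matrix.toEuclideanLin L.transpose x') ↔ _
  rw [Prod.mk.injEq]
  constructor
  · rintro ⟨h1, h2⟩
    refine ⟨by rw [h1, h2], ?_⟩
    rw [h1, e2, add_sub_cancel_right]
  · rintro ⟨h1, h2⟩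
    have h3 : x = Matrix.toEuclideanLin L⁻¹ (p' + Matrix.toEuclideanLin Q x') := by
      rw [h2, sub_add_cancel, e1]
    exact ⟨h3, by rw [← h3, h1]⟩

theorem IsFreeSymplectic.snd_apply (hP : P.IsSymm) (hQ : Q.IsSymm) {S : Phase n ≃L[ℝ] Phase n}
    (hS : IsFreeSymplectic P L Q S) (z : Phase n) :
    (S z).2 = Matrix.toEuclideanLin P (S z).1 - Matrix.toEuclideanLin L.transpose z.1 :=
  (((isFreeSymplectic_iff hP hQ S).1 hS (S z).1 (S z).2 z.1 z.2).1 rfl).1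

theorem IsFreeSymplectic.snd_eq (hP : P.IsSymm) (hQ : Q.IsSymm) {S : Phase n ≃L[ℝ] Phase n}
    (hS : IsFreeSymplectic P L Q S) (z : Phase n) :
    z.2 = Matrix.toEuclideanLin L (S z).1 - Matrix.toEuclideanLin Q z.1 :=
  (((isFreeSymplectic_iff hP hQ S).1 hS (S z).1 (S z).2 z.1 z.2).1 rfl).2

/-- Once the momenta are eliminated, the `P` and `Q` terms cancel by symmetry, and both sides reduce
to the same cross terms in `L`. -/
theorem IsFreeSymplectic.sympl_map (hP : P.IsSymm) (hQ : Q.IsSymm) {S : Phase n ≃L[ℝ] Phase n}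
    (hS : IsFreeSymplectic P L Q S) (z z' : Phase n) : sympl (S z) (S z') = sympl z z' := by
  simp only [sympl]
  rw [hS.snd_apply hP hQ z, hS.snd_apply hP hQ z', hS.snd_eq hP hQ z, hS.snd_eq hP hQ z']
  simp only [inner_sub_left]
  rw [inner_toEuclideanLin_of_isSymm hP (S z').1, real_inner_comm _ (S z').1,
    inner_toEuclideanLin_of_isSymm hQ z'.1, real_inner_comm _ z'.1,
    inner_toEuclideanLin_left L, inner_toEuclideanLin_left L,
    real_inner_comm _ (S z).1, real_inner_comm _ (S z').1]
  ring

end QuadraticForm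

/-! ### Determinants of `S - I` and `J`. -/

section Determinant

theorem det_eq_det_fromBlocks (A B C D : Matrix (Fin n) (Fin n) ℝ) (f : Phase n →ₗ[ℝ] Phase n)
    (hf : ∀ x y, f (x, y) = (Matrix.toEuclideanLin A x + Matrix.toEuclideanLin B y,
      Matrix.toEuclideanLin C x + Matrix.toEuclideanLin D y)) :
    LinearMap.det f = (Matrix.fromBlocks A B C D).det := by
  let b := (EuclideanSpace.basisFun (Fin n) ℝ).toBasis
  rw [← LinearMap.det_toMatrix (b.prod b)]
  congr 1
  ext (i | i) (j | j) <;>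
    simp [LinearMap.toMatrix_apply, b, hf, Matrix.toEuclideanLin, Matrix.toLpLin_apply]

variable {P L Q : Matrix (Fin n) (Fin n) ℝ}

/-- `|det(S_W - I)| |det L| = |det W_xx|`. -/
theorem IsFreeSymplectic.abs_det_sub_one_mul (hP : P.IsSymm) (hQ : Q.IsSymm)
    {S : Phase n ≃L[ℝ] Phase n} (hS : IsFreeSymplectic P L Q S) :
    |((S : Phase n →L[ℝ] Phase n) - 1).det| * |L.det| = |(P + Q - L - L.transpose).det| := by
  have hfree := (isFreeSymplectic_iff hP hQ S).1 hS
  -- Initial points are parametrised by the pair (initial position, final position), with Jacobian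
  -- `det L`. In these coordinates `S - I` has an upper left block `-1` whose Schur complement is
  -- `W_xx`.
  let F' : Phase n →ₗ[ℝ] Phase n :=
    (LinearMap.fst ℝ _ _).prod ((Matrix.toEuclideanLin L).comp (LinearMap.snd ℝ _ _) -
      (Matrix.toEuclideanLin Q).comp (LinearMap.fst ℝ _ _))
  have h1 : LinearMap.det F' = L.det := by
    rw [det_eq_det_fromBlocks 1 0 (-Q) L, Matrix.det_fromBlocks_zero₁₂, Matrix.det_one, one_mul]
    intro x y
    simp [F']
    abel
  have h2 : LinearMap.det ((((S : Phase n →L[ℝ] Phase n) - 1 : Phase n →L[ℝ] Phase n) :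
      Phase n →ₗ[ℝ] Phase n) ∘ₗ F') = (-1) ^ n * (P + Q - L - L.transpose).det := by
    rw [det_eq_det_fromBlocks (-1) 1 (Q - L.transpose) (P - L)]
    · let _ : Invertible (-1 : Matrix (Fin n) (Fin n) ℝ) := ⟨-1, by simp, by simp⟩
      rw [Matrix.det_fromBlocks₁₁, Matrix.det_neg, Matrix.det_one, Fintype.card_fin, mul_one]
      congr 2
      change P - L - (Q - L.transpose) * (-1) * 1 = _
      simp
      abel
    · intro x' x
      have h3 : S (x', Matrix.toEuclideanLin L x - Matrix.toEuclideanLin Q x') =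
          (x, Matrix.toEuclideanLin P x - Matrix.toEuclideanLin L.transpose x') :=
        ((hfree _ _ _ _).2 ⟨rfl, rfl⟩).symm
      have h4 : F' (x', x) = (x', Matrix.toEuclideanLin L x - Matrix.toEuclideanLin Q x') := rfl
      rw [LinearMap.comp_apply, h4]
      simp [h3]
      constructor <;> abel
  rw [LinearMap.det_comp, h1] at h2
  have h5 := congrArg abs h2
  rw [abs_mul, abs_mul, abs_pow, abs_neg, abs_one, one_pow, one_mul] at h5
  exact h5

theorem abs_det_symplJ : |(symplJ n).det| = 1 := by
  have h : (symplJ n).det = (Matrix.fromBlocks 0 1 (-1) 0 : Matrix (Fin n ⊕ Fin n) _ ℝ).det := by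
    refine det_eq_det_fromBlocks _ _ _ _ _ fun x y => ?_
    simp [symplJ]
  have h2 : (symplJ n).det * (symplJ n).det = 1 := by
    rw [h, ← Matrix.det_mul, Matrix.fromBlocks_multiply]
    simp [← Matrix.det_mul]
  rcases mul_self_eq_one_iff.1 h2 with h3 | h3 <;> simp [h3]

end Determinant

/-! ### Gaussian-regularised Fresnel integrals. -/

section Fresnel

open Filter Topology

/-- The coefficient `ε + i/(2ħr)` of a regularised Fresnel integral. -/
def fresnelCoeff (ħ r ε : ℝ) : ℂ := ε + Complex.I * ((1 / (2 * ħ * r) : ℝ) : ℂ)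

theorem fresnelCoeff_re (ħ r ε : ℝ) : (fresnelCoeff ħ r ε).re = ε := by
  simp only [fresnelCoeff, Complex.add_re, Complex.ofReal_re, Complex.mul_re, Complex.I_re,
    Complex.I_im, Complex.ofReal_im]
  ring

theorem fresnelCoeff_im (ħ r ε : ℝ) : (fresnelCoeff ħ r ε).im = 1 / (2 * ħ * r) := by
  simp only [fresnelCoeff, Complex.add_im, Complex.ofReal_im, Complex.mul_im, Complex.I_re,
    Complex.I_im, Complex.ofReal_re]
  ring

/-- The one-dimensional regularised Fresnel integral with linear term `(i/ħ)k`. -/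
def fresnelFactor (ħ r ε k : ℝ) : ℂ :=
  (Real.pi / fresnelCoeff ħ r ε) ^ (1 / 2 : ℂ) *
    Complex.exp ((Complex.I / ħ * k) ^ 2 / (4 * fresnelCoeff ħ r ε))

theorem fresnelCoeff_ne_zero {ħ r : ℝ} (hħ : 0 < ħ) (hr : r ≠ 0) (ε : ℝ) :
    fresnelCoeff ħ r ε ≠ 0 := by
  intro h
  have := fresnelCoeff_im ħ r ε
  rw [h, Complex.zero_im] at this
  have h2 : 1 / (2 * ħ * r) ≠ 0 := by positivity
  exact h2 this.symm

/-- The modulus of the coefficient is at least that of its imaginary part `1/(2ħr)`, which does not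
involve `ε`, and the exponent has nonpositive real part. Uniformity in `ε` and `k` is what dominated
convergence needs later. -/
theorem norm_fresnelFactor_le {ħ r ε : ℝ} (hħ : 0 < ħ) (hr : r ≠ 0) (hε : 0 < ε) (k : ℝ) :
    ‖fresnelFactor ħ r ε k‖ ≤ (Real.pi * |2 * ħ * r|) ^ (1 / 2 : ℝ) := by
  have h0 := fresnelCoeff_ne_zero hħ hr ε
  have hpos : 0 < |2 * ħ * r| := by positivity
  have h1 : ‖(Real.pi / fresnelCoeff ħ r ε) ^ (1 / 2 : ℂ)‖ ≤
      (Real.pi * |2 * ħ * r|) ^ (1 / 2 : ℝ) := by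
    rw [show (1 / 2 : ℂ) = ((1 / 2 : ℝ) : ℂ) by push_cast; rfl, Complex.norm_cpow_real]
    refine Real.rpow_le_rpow (norm_nonneg _) ?_ (by norm_num)
    rw [norm_div, Complex.norm_real, Real.norm_of_nonneg Real.pi_pos.le,
      div_le_iff₀ (norm_pos_iff.2 h0), mul_assoc]
    have h2 : 1 / |2 * ħ * r| ≤ ‖fresnelCoeff ħ r ε‖ := by
      have := Complex.abs_im_le_norm (fresnelCoeff ħ r ε)
      rwa [fresnelCoeff_im, abs_div, abs_one] at this
    have h3 : 1 ≤ |2 * ħ * r| * ‖fresnelCoeff ħ r ε‖ := by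
      rw [div_le_iff₀ hpos] at h2
      linarith
    nlinarith [Real.pi_pos]
  have h2 : ‖Complex.exp ((Complex.I / ħ * k) ^ 2 / (4 * fresnelCoeff ħ r ε))‖ ≤ 1 := by
    rw [Complex.norm_exp, Real.exp_le_one_iff]
    have h3 : (Complex.I / ħ * k) ^ 2 / (4 * fresnelCoeff ħ r ε) =
        ((-((k / ħ) ^ 2 / 4) : ℝ) : ℂ) * (fresnelCoeff ħ r ε)⁻¹ := by
      rw [mul_pow, div_pow, Complex.I_sq]
      push_cast
      have : (ħ : ℂ) ≠ 0 := by exact_mod_cast hħ.ne'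
      field_simp
    rw [h3, Complex.re_ofReal_mul, Complex.inv_re, fresnelCoeff_re]
    have h4 : 0 ≤ ε / Complex.normSq (fresnelCoeff ħ r ε) :=
      div_nonneg hε.le (Complex.normSq_nonneg _)
    nlinarith [sq_nonneg (k / ħ)]
  rw [fresnelFactor, norm_mul]
  calc _ ≤ (Real.pi * |2 * ħ * r|) ^ (1 / 2 : ℝ) * 1 :=
        mul_le_mul h1 h2 (norm_nonneg _) (by positivity)
    _ = _ := mul_one _

theorem polar_cpow {a θ : ℝ} (ha : 0 < a) (h1 : -Real.pi < θ) (h2 : θ ≤ Real.pi) (w : ℂ) :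
    ((a : ℂ) * Complex.exp (θ * Complex.I)) ^ w = (a : ℂ) ^ w * Complex.exp (w * θ * Complex.I) := by
  have ha' : (a : ℂ) ≠ 0 := by exact_mod_cast ha.ne'
  rw [Complex.cpow_def_of_ne_zero (mul_ne_zero ha' (Complex.exp_ne_zero _)),
    Complex.cpow_def_of_ne_zero ha', Complex.log_ofReal_mul ha (Complex.exp_ne_zero _),
    Complex.log_exp (by simpa using h1) (by simpa using h2), ← Complex.exp_add, Complex.ofReal_log
    ha.le]
  congr 1
  ring

theorem pi_div_fresnelCoeff_zero {ħ r : ℝ} (hħ : 0 < ħ) (hr : r ≠ 0) :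
    (Real.pi : ℂ) / fresnelCoeff ħ r 0 = ((2 * Real.pi * ħ * r : ℝ) : ℂ) * (-Complex.I) := by
  have hħ' : (ħ : ℂ) ≠ 0 := by exact_mod_cast hħ.ne'
  have hr' : (r : ℂ) ≠ 0 := by exact_mod_cast hr
  rw [div_eq_iff (fresnelCoeff_ne_zero hħ hr 0), fresnelCoeff, Complex.ofReal_zero, zero_add]
  push_cast
  field_simp
  linear_combination Complex.I_mul_I

/-- On the principal branch a positive `r` gives `e^{-iπ/4}` and a negative one `e^{iπ/4} =
e^{-iπ/4} i`. Multiplied over the eigenvalues, these extra factors `i` produce the inertia index. -/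
theorem cpow_half_fresnel {ħ r : ℝ} (hħ : 0 < ħ) (hr : r ≠ 0) :
    (Real.pi / fresnelCoeff ħ r 0) ^ (1 / 2 : ℂ) =
      (Real.sqrt (2 * Real.pi * ħ) : ℂ) * (Real.sqrt |r| : ℂ) *
        (Complex.exp (-(Real.pi / 4 : ℝ) * Complex.I) * (if r < 0 then Complex.I else 1)) := by
  have hpos : 0 < 2 * Real.pi * ħ * |r| := by positivity
  have hsqrt : ((2 * Real.pi * ħ * |r| : ℝ) : ℂ) ^ (1 / 2 : ℂ) =
      (Real.sqrt (2 * Real.pi * ħ) : ℂ) * (Real.sqrt |r| : ℂ) := by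
    rw [← Complex.ofReal_mul, ← Real.sqrt_mul (by positivity), Real.sqrt_eq_rpow,
      Complex.ofReal_cpow hpos.le]
    push_cast
    rfl
  rw [pi_div_fresnelCoeff_zero hħ hr, ← hsqrt]
  split_ifs with h
  · have h1 : ((2 * Real.pi * ħ * r : ℝ) : ℂ) * (-Complex.I) = ((2 * Real.pi * ħ * |r| : ℝ) : ℂ) *
        Complex.exp ((Real.pi / 2 : ℝ) * Complex.I) := by
      push_cast
      rw [Complex.exp_pi_div_two_mul_I, abs_of_neg h]
      push_cast
      ring
    rw [h1, polar_cpow hpos (by linarith [Real.pi_pos]) (by linarith [Real.pi_pos])]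
    congr 1
    refine Eq.trans ?_ (congrArg _ Complex.exp_pi_div_two_mul_I)
    rw [← Complex.exp_add]
    congr 1
    push_cast
    ring
  · have h1 : ((2 * Real.pi * ħ * r : ℝ) : ℂ) * (-Complex.I) = ((2 * Real.pi * ħ * |r| : ℝ) : ℂ) *
        Complex.exp ((-Real.pi / 2 : ℝ) * Complex.I) := by
      push_cast
      rw [Complex.exp_neg_pi_div_two_mul_I, abs_of_nonneg (not_lt.1 h)]
    rw [h1, polar_cpow hpos (by linarith [Real.pi_pos]) (by linarith [Real.pi_pos]), mul_one]
    congr 2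
    push_cast
    ring

theorem tendsto_fresnelFactor {ħ r : ℝ} (hħ : 0 < ħ) (hr : r ≠ 0) (k : ℝ) :
    Tendsto (fun ε => fresnelFactor ħ r ε k) (𝓝[>] 0) (𝓝
      ((Real.sqrt (2 * Real.pi * ħ) : ℂ) * (Real.sqrt |r| : ℂ) *
        (Complex.exp (-(Real.pi / 4 : ℝ) * Complex.I) * (if r < 0 then Complex.I else 1)) *
        Complex.exp (Complex.I / ħ * ((1 / 2 * (r * k ^ 2) : ℝ) : ℂ)))) := by
  have hħ' : (ħ : ℂ) ≠ 0 := by exact_mod_cast hħ.ne'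
  have hr' : (r : ℂ) ≠ 0 := by exact_mod_cast hr
  have h0 := fresnelCoeff_ne_zero hħ hr 0
  have hc : ContinuousAt (fun ε => fresnelCoeff ħ r ε) 0 := by
    unfold fresnelCoeff; fun_prop
  have e1 : Complex.exp (Complex.I / ħ * ((1 / 2 * (r * k ^ 2) : ℝ) : ℂ)) =
      Complex.exp ((Complex.I / ħ * k) ^ 2 / (4 * fresnelCoeff ħ r 0)) := by
    congr 1
    rw [fresnelCoeff, mul_pow, div_pow, Complex.I_sq, Complex.ofReal_zero, zero_add]
    push_cast
    field_simp
    linear_combination (4 * k ^ 2 : ℂ) * Complex.I_mul_I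
  rw [← cpow_half_fresnel hħ hr, e1]
  refine tendsto_nhdsWithin_of_tendsto_nhds (ContinuousAt.tendsto (f := fun ε =>
    fresnelFactor ħ r ε k) ?_)
  refine ContinuousAt.mul (ContinuousAt.cpow (continuousAt_const.div hc h0) continuousAt_const ?_)
    (ContinuousAt.cexp (continuousAt_const.div (hc.const_mul _) (mul_ne_zero (by norm_num) h0)))
  -- At `ε = 0` the base of the power is a nonzero real multiple of `i`, hence off the branch cut.
  right
  rw [pi_div_fresnelCoeff_zero hħ hr, mul_neg, Complex.neg_im, Complex.im_ofReal_mul, Complex.I_im, neg_ne_zero]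
  positivity

/-- In orthonormal coordinates that diagonalise the quadratic part, the integrand is a product of
one-dimensional Gaussians with complex coefficients. -/
theorem integral_regularised_fresnel (b : OrthonormalBasis (Fin n) ℝ (Position n)) {r : Fin n → ℝ}
    {ħ ε : ℝ} (hħ : 0 < ħ) (hε : 0 < ε) (k : Position n) :
    ∫ q : Position n, Complex.exp (-ε * ‖q‖ ^ 2) * Complex.exp (Complex.I / ħ *
      ((-(1 / 2) * ∑ j, (r j)⁻¹ * b.repr q j ^ 2 + inner ℝ q k : ℝ) : ℂ)) =
      ∏ j, fresnelFactor ħ (r j) ε (b.repr k j) := by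
  have h1 := GaussianFourier.integral_cexp_neg_sum_mul_add (ι := Fin n)
    (b := fun j => fresnelCoeff ħ (r j) ε) (by simpa [fresnelCoeff_re] using fun _ => hε)
    (fun j => Complex.I / ħ * b.repr k j)
  rw [show (∏ j, fresnelFactor ħ (r j) ε (b.repr k j)) = _ from h1.symm, ← (PiLp.volume_preserving_ofLp (Fin n)).integral_comp
    (MeasurableEquiv.toLp 2 (Fin n → ℝ)).symm.measurableEmbedding]
  refine Eq.trans ?_ ((b.repr.measurePreserving).integral_comp
    b.repr.toHomeomorph.measurableEmbedding _)
  congr 1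
  ext q
  rw [← Complex.exp_add]
  congr 1
  have e1 : ‖q‖ ^ 2 = ∑ j, b.repr q j ^ 2 := by
    rw [← b.repr.norm_map, EuclideanSpace.real_norm_sq_eq]
  have e2 : inner ℝ q k = ∑ j, b.repr q j * b.repr k j := by
    rw [← b.repr.inner_map_map, PiLp.inner_apply]
    simp [mul_comm]
  rw [← Complex.ofReal_pow, e1, e2]
  push_cast
  have hħ' : (ħ : ℂ) ≠ 0 := by exact_mod_cast hħ.ne'
  rw [mul_add, ← add_assoc, Finset.mul_sum, Finset.mul_sum, Finset.mul_sum, Finset.mul_sum,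
    ← Finset.sum_neg_distrib, ← Finset.sum_add_distrib]
  congr 1
  · refine Finset.sum_congr rfl fun j _ => ?_
    rw [fresnelCoeff]
    push_cast
    simp only [one_div, mul_inv]
    ring
  · refine Finset.sum_congr rfl fun j _ => ?_
    ring

/-- The regularised Fresnel integral
`∫ e^{-ε|q|²} e^{(i/ħ)(-(1/2) R⁻¹(s - q)·(s - q) - q·y)} dq`. -/
def regularisedFresnel (ħ : ℝ) (R : Matrix (Fin n) (Fin n) ℝ) (ε : ℝ) (s y : Position n) : ℂ :=
  ∫ q : Position n, Complex.exp (-ε * ‖q‖ ^ 2) * Complex.exp (Complex.I / ħ *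
    ((-(1 / 2) * inner ℝ (Matrix.toEuclideanLin R⁻¹ (s - q)) (s - q) - inner ℝ q y : ℝ) : ℂ))

variable {R : Matrix (Fin n) (Fin n) ℝ}

theorem repr_toEuclideanLin (hR : R.IsHermitian) (q : Position n) (j : Fin n) :
    hR.eigenvectorBasis.repr (Matrix.toEuclideanLin R q) j =
      hR.eigenvalues j * hR.eigenvectorBasis.repr q j := by
  have hsymm : R.IsSymm := by
    rw [Matrix.IsSymm, ← Matrix.conjTranspose_eq_transpose_of_trivial]; exact hR
  rw [OrthonormalBasis.repr_apply_apply, OrthonormalBasis.repr_apply_apply,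
    ← inner_toEuclideanLin_of_isSymm hsymm, ← real_inner_smul_left]
  congr 1
  apply PiLp.ext fun i => ?_
  exact congrFun (hR.mulVec_eigenvectorBasis j) i

theorem inner_toEuclideanLin_self_eq_sum (hR : R.IsHermitian) (q : Position n) :
    inner ℝ (Matrix.toEuclideanLin R q) q =
      ∑ j, hR.eigenvalues j * hR.eigenvectorBasis.repr q j ^ 2 := by
  rw [← hR.eigenvectorBasis.repr.inner_map_map, PiLp.inner_apply]
  refine Finset.sum_congr rfl fun j _ => ?_
  rw [repr_toEuclideanLin]
  simp
  ring

theorem inner_toEuclideanLin_inv_self_eq_sum (hR : R.IsHermitian) (hdet : R.det ≠ 0)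
    (q : Position n) :
    inner ℝ (Matrix.toEuclideanLin R⁻¹ q) q =
      ∑ j, (hR.eigenvalues j)⁻¹ * hR.eigenvectorBasis.repr q j ^ 2 := by
  have hsymm : R.IsSymm := by
    rw [Matrix.IsSymm, ← Matrix.conjTranspose_eq_transpose_of_trivial]; exact hR
  have hne : ∀ j, hR.eigenvalues j ≠ 0 := by
    rw [hR.det_eq_prod_eigenvalues] at hdet
    simpa [Finset.prod_ne_zero_iff] using hdet
  have h1 : Matrix.toEuclideanLin R (Matrix.toEuclideanLin R⁻¹ q) = q := by
    rw [toEuclideanLin_mul_apply, Matrix.mul_nonsing_inv _ hdet.isUnit, toEuclideanLin_one_apply]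
  conv_lhs => rw [← h1, toEuclideanLin_mul_apply R⁻¹ R, Matrix.nonsing_inv_mul _ hdet.isUnit,
    toEuclideanLin_one_apply, real_inner_comm]
  rw [inner_toEuclideanLin_self_eq_sum hR]
  refine Finset.sum_congr rfl fun j _ => ?_
  conv_rhs => rw [← h1, repr_toEuclideanLin]
  have := hne j
  field_simp

/-- Expanding the quadratic form at `s - q` leaves a constant, the diagonalisable part `-R⁻¹q·q /
2`, and the linear term `q·(R⁻¹s - y)`. -/
theorem regularisedFresnel_eq (hR : R.IsHermitian) (hdet : R.det ≠ 0) {ħ ε : ℝ} (hħ : 0 < ħ)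
    (hε : 0 < ε) (s y : Position n) :
    regularisedFresnel ħ R ε s y = Complex.exp (Complex.I / ħ *
      ((-(1 / 2) * inner ℝ (Matrix.toEuclideanLin R⁻¹ s) s : ℝ) : ℂ)) *
        ∏ j, fresnelFactor ħ (hR.eigenvalues j) ε
          (hR.eigenvectorBasis.repr (Matrix.toEuclideanLin R⁻¹ s - y) j) := by
  have hsymm : R⁻¹.IsSymm := by
    have : R.IsSymm := by
      rw [Matrix.IsSymm, ← Matrix.conjTranspose_eq_transpose_of_trivial]; exact hR
    rw [Matrix.IsSymm, Matrix.transpose_nonsing_inv, this.eq]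
  rw [← integral_regularised_fresnel _ hħ hε, ← integral_const_mul, regularisedFresnel]
  refine integral_congr_ae (Eventually.of_forall fun q => ?_)
  simp only
  rw [← inner_toEuclideanLin_inv_self_eq_sum hR hdet, mul_left_comm]
  congr 1
  rw [← Complex.exp_add, ← mul_add, ← Complex.ofReal_add]
  congr 3
  simp only [map_sub, inner_sub_left, inner_sub_right]
  rw [inner_toEuclideanLin_of_isSymm hsymm q s, real_inner_comm q (Matrix.toEuclideanLin R⁻¹ s)]
  ring

theorem exists_norm_regularisedFresnel_le (hR : R.IsHermitian) (hdet : R.det ≠ 0) {ħ : ℝ}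
    (hħ : 0 < ħ) :
    ∃ K, ∀ ε > 0, ∀ s y, ‖regularisedFresnel ħ R ε s y‖ ≤ K := by
  have hne : ∀ j, hR.eigenvalues j ≠ 0 := by
    rw [hR.det_eq_prod_eigenvalues] at hdet
    simpa [Finset.prod_ne_zero_iff] using hdet
  refine ⟨∏ j, (Real.pi * |2 * ħ * hR.eigenvalues j|) ^ (1 / 2 : ℝ), fun ε hε s y => ?_⟩
  have h1 : ∀ r : ℝ, Complex.I / ħ * (r : ℂ) = Complex.I * ((r / ħ : ℝ) : ℂ) := fun r => by
    push_cast; ring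
  rw [regularisedFresnel_eq hR hdet hħ hε, norm_mul, h1, norm_exp_I_mul_ofReal, one_mul, norm_prod]
  exact Finset.prod_le_prod (fun _ _ => norm_nonneg _)
    fun j _ => norm_fresnelFactor_le hħ (hne j) hε _

/-- The Fresnel integral of the quadratic form of `-R⁻¹`. -/
theorem tendsto_regularisedFresnel (hR : R.IsHermitian) (hdet : R.det ≠ 0) {ħ : ℝ}
    (hħ : 0 < ħ) (s y : Position n) :
    Tendsto (fun ε => regularisedFresnel ħ R ε s y) (𝓝[>] 0) (𝓝
      ((Real.sqrt (2 * Real.pi * ħ) : ℂ) ^ n * (Real.sqrt |R.det| : ℂ) *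
        (Complex.exp (-(Real.pi / 4 : ℝ) * Complex.I) ^ n *
          Complex.I ^ (R.charpoly.roots.countP (· < 0))) *
        Complex.exp (Complex.I / ħ * ((1 / 2 * inner ℝ (Matrix.toEuclideanLin R y) y -
          inner ℝ s y : ℝ) : ℂ)))) := by
  have hne : ∀ j, hR.eigenvalues j ≠ 0 := by
    rw [hR.det_eq_prod_eigenvalues] at hdet
    simpa [Finset.prod_ne_zero_iff] using hdet
  have hsymm : R.IsSymm := by
    rw [Matrix.IsSymm, ← Matrix.conjTranspose_eq_transpose_of_trivial]; exact hR
  set k := Matrix.toEuclideanLin R⁻¹ s - y with hk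
  have hlim := (tendsto_finsetProd Finset.univ fun j _ =>
    tendsto_fresnelFactor hħ (hne j) (hR.eigenvectorBasis.repr k j)).const_mul
      (Complex.exp (Complex.I / ħ *
      ((-(1 / 2) * inner ℝ (Matrix.toEuclideanLin R⁻¹ s) s : ℝ) : ℂ)))
  have hev : (fun ε => regularisedFresnel ħ R ε s y) =ᶠ[𝓝[>] 0] fun ε =>
      Complex.exp (Complex.I / ħ *
        ((-(1 / 2) * inner ℝ (Matrix.toEuclideanLin R⁻¹ s) s : ℝ) : ℂ)) *
        ∏ j, fresnelFactor ħ (hR.eigenvalues j) ε (hR.eigenvectorBasis.repr k j) := by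
    filter_upwards [self_mem_nhdsWithin] with ε hε
    exact regularisedFresnel_eq hR hdet hħ hε s y
  refine Tendsto.congr' hev.symm ?_
  convert hlim using 2
  -- The roots of the characteristic polynomial, with multiplicity, are the eigenvalues, so the
  -- product of the signs is `i` to the power of the inertia.
  have hcount : R.charpoly.roots.countP (· < 0) =
      (Finset.univ.filter fun j => hR.eigenvalues j < 0).card := by
    rw [hR.roots_charpoly_eq_eigenvalues, Multiset.countP_map]
    rfl
  have hphase : ∏ j, (if hR.eigenvalues j < 0 then Complex.I else 1) =
      Complex.I ^ (R.charpoly.roots.countP (· < 0)) := by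
    rw [hcount, Finset.prod_ite, Finset.prod_const, Finset.prod_const_one, mul_one]
  have hdet' : ∏ j, (Real.sqrt |hR.eigenvalues j| : ℂ) = (Real.sqrt |R.det| : ℂ) := by
    rw [hR.det_eq_prod_eigenvalues, ← Complex.ofReal_prod, ← Real.sqrt_prod,
      ← Finset.abs_prod]
    · rfl
    · intros; positivity
  have h1 : Matrix.toEuclideanLin R (Matrix.toEuclideanLin R⁻¹ s) = s := by
    rw [toEuclideanLin_mul_apply, Matrix.mul_nonsing_inv _ hdet.isUnit, toEuclideanLin_one_apply]
  have hexp : ∏ j, Complex.exp (Complex.I / ħ *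
      ((1 / 2 * (hR.eigenvalues j * hR.eigenvectorBasis.repr k j ^ 2) : ℝ) : ℂ)) =
      Complex.exp (Complex.I / ħ * ((1 / 2 * inner ℝ (Matrix.toEuclideanLin R k) k : ℝ) : ℂ)) := by
    rw [← Complex.exp_sum, ← Finset.mul_sum, ← Complex.ofReal_sum, ← Finset.mul_sum,
      inner_toEuclideanLin_self_eq_sum hR]
  simp only [Finset.prod_mul_distrib, Finset.prod_const, Finset.card_univ, Fintype.card_fin, hphase,
    hdet', hexp]
  rw [mul_left_comm (Complex.exp (Complex.I / ħ * _)) _ (Complex.exp (Complex.I / ħ * _)),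
    ← Complex.exp_add, ← mul_add, ← Complex.ofReal_add]
  -- With `k = R⁻¹s - y`, the term `R⁻¹s·s / 2` in `Rk·k / 2` cancels against the constant
  -- prefactor.
  congr 4
  simp only [hk, map_sub, inner_sub_left, inner_sub_right, h1]
  rw [inner_toEuclideanLin_of_isSymm hsymm y y,
    inner_toEuclideanLin_of_isSymm hsymm y (Matrix.toEuclideanLin R⁻¹ s), h1, real_inner_comm s y,
    real_inner_comm s (Matrix.toEuclideanLin R⁻¹ s)]
  ring

end Fresnel

/-! ### Unitarity and integral formula of `(Ŝ_{W,m})_ph`. -/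

section PhaseSpaceOperator

variable {P L Q : Matrix (Fin n) (Fin n) ℝ} {S : Phase n ≃L[ℝ] Phase n}

/-- The resolvent `(S - I)⁻¹`. -/
def resolvent (S : Phase n ≃L[ℝ] Phase n) : Phase n →L[ℝ] Phase n :=
  Ring.inverse ((S : Phase n →L[ℝ] Phase n) - 1)

theorem isUnit_of_det_ne_zero {A : Phase n →L[ℝ] Phase n} (h : A.det ≠ 0) : IsUnit A :=
  ⟨(ContinuousLinearEquiv.unitsEquiv ℝ (Phase n)).symm
    (A.toContinuousLinearEquivOfDetNeZero h), ContinuousLinearMap.ext fun _ => rfl⟩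

theorem map_resolvent (h : ((S : Phase n →L[ℝ] Phase n) - 1).det ≠ 0) (z : Phase n) :
    S (resolvent S z) = resolvent S z + z := by
  have h1 := congrArg (fun A : Phase n →L[ℝ] Phase n => A z)
    (Ring.mul_inverse_cancel _ (isUnit_of_det_ne_zero h))
  simp only [mul_apply_eq_comp, sub_apply,
    ContinuousLinearEquiv.coe_coe, one_apply_eq_self] at h1
  rw [resolvent]
  exact (sub_eq_iff_eq_add'.1 h1)

theorem sympl_add_left (a b c : Phase n) : sympl (a + b) c = sympl a c + sympl b c := by
  simp only [sympl, Prod.fst_add, Prod.snd_add, inner_add_left, inner_add_right]; ring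

theorem sympl_add_right (a b c : Phase n) : sympl a (b + c) = sympl a b + sympl a c := by
  simp only [sympl, Prod.fst_add, Prod.snd_add, inner_add_left, inner_add_right]; ring

theorem sympl_sub_left (a b c : Phase n) : sympl (a - b) c = sympl a c - sympl b c := by
  simp only [sympl, Prod.fst_sub, Prod.snd_sub, inner_sub_left, inner_sub_right]; ring

theorem sympl_sub_right (a b c : Phase n) : sympl a (b - c) = sympl a b - sympl a c := by
  simp only [sympl, Prod.fst_sub, Prod.snd_sub, inner_sub_left, inner_sub_right]; ring

theorem sympl_swap (a b : Phase n) : sympl a b = -sympl b a := by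
  simp only [sympl]; ring

theorem sympl_self (a : Phase n) : sympl a a = 0 := by
  simp [sympl]

theorem phaseDot_symplJ (a b : Phase n) : phaseDot (symplJ n a) b = sympl a b := by
  simp [sympl, phaseDot, symplJ, real_inner_comm]
  ring

theorem continuous_phaseDot_apply (A : Phase n →L[ℝ] Phase n) :
    Continuous fun z => phaseDot (A z) z := by
  unfold phaseDot; fun_prop

/-- With `ζ = (S - I)⁻¹z` one has `(S + I)ζ = 2ζ + z`, and the contribution of `z` drops out because
`σ(z, z) = 0`. -/
theorem phaseDot_symplCayley (z : Phase n) (h : ((S : Phase n →L[ℝ] Phase n) - 1).det ≠ 0) :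
    phaseDot (symplCayley (S : Phase n →L[ℝ] Phase n) z) z = sympl (resolvent S z) z := by
  have h1 : symplCayley (S : Phase n →L[ℝ] Phase n) z =
      symplJ n ((1 / 2 : ℝ) • (S (resolvent S z) + resolvent S z)) := by
    rw [map_smul]
    rfl
  have h2 : (1 / 2 : ℝ) • (resolvent S z + z + resolvent S z) =
      resolvent S z + (1 / 2 : ℝ) • z := by
    module
  rw [h1, map_resolvent h, h2, phaseDot_symplJ, sympl_add_left]
  simp [sympl, real_inner_smul_left, real_inner_smul_right]

/-- Polarisation of the phase of the kernel of `Ŝ_ph`. -/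
theorem phaseDot_symplCayley_sub (hP : P.IsSymm) (hQ : Q.IsSymm) (hS : IsFreeSymplectic P L Q S)
    (h : ((S : Phase n →L[ℝ] Phase n) - 1).det ≠ 0) (z u : Phase n) :
    phaseDot (symplCayley (S : Phase n →L[ℝ] Phase n) (z - u)) (z - u) + sympl z u =
      phaseDot (symplCayley (S : Phase n →L[ℝ] Phase n) z) z +
      phaseDot (symplCayley (S : Phase n →L[ℝ] Phase n) u) u -
      2 * phaseDot (symplJ n (resolvent S z)) u := by
  simp only [phaseDot_symplCayley _ h, phaseDot_symplJ]
  -- Writing `ζ` for the resolvent of `z` and `η` for that of `u`, symplecticity gives `σ(ζ, u) +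
  -- σ(z, η) + σ(z, u) = 0`. This merges all cross terms into one bilinear form.
  have h1 := hS.sympl_map hP hQ (resolvent S z) (resolvent S u)
  rw [map_resolvent h, map_resolvent h] at h1
  simp only [sympl_add_left, sympl_add_right] at h1
  simp only [map_sub, sympl_sub_left, sympl_sub_right]
  linarith [sympl_swap (resolvent S u) z]

/-- The integral operator defining `(Ŝ_{W,m})_ph`. -/
def quadraticFourierPhFun (ħ : ℝ) (P L Q : Matrix (Fin n) (Fin n) ℝ) (m : ℤ)
    (S : Phase n ≃L[ℝ] Phase n) (Ψ : Phase n → ℂ) (z : Phase n) : ℂ :=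
  (((1 / (2 * Real.pi * ħ)) ^ n : ℝ) : ℂ) * Complex.I ^ (m - inertia P L Q) /
    (Real.sqrt |((S : Phase n →L[ℝ] Phase n) - 1).det| : ℝ) *
    ∫ z₀ : Phase n, Complex.exp (Complex.I / (2 * ħ) *
        (phaseDot (symplCayley (S : Phase n →L[ℝ] Phase n) z₀) z₀ : ℝ)) *
      (Complex.exp (Complex.I * ((1 / (2 * ħ) * sympl z₀ z : ℝ) : ℂ)) * Ψ (z - z₀))

/-- The substitution `z₀ = z - u` exhibits the integral kernel. -/
theorem quadraticFourierPhFun_eq (ħ : ℝ) (P L Q : Matrix (Fin n) (Fin n) ℝ) (m : ℤ)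
    (S : Phase n ≃L[ℝ] Phase n) (Ψ : Phase n → ℂ) (z : Phase n) :
    quadraticFourierPhFun ħ P L Q m S Ψ z =
    (((1 / (2 * Real.pi * ħ)) ^ n : ℝ) : ℂ) * Complex.I ^ (m - inertia P L Q) /
    (Real.sqrt |((S : Phase n →L[ℝ] Phase n) - 1).det| : ℝ) *
    ∫ u : Phase n, Complex.exp (Complex.I * ((1 / (2 * ħ) *
      (phaseDot (symplCayley (S : Phase n →L[ℝ] Phase n) (z - u)) (z - u) + sympl z u) : ℝ) : ℂ)) *
        Ψ u := by
  have : (volume : Measure (Phase n)).IsNegInvariant :=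
    Measure.IsAddHaarMeasure.isNegInvariant_of_regular _
  rw [quadraticFourierPhFun]
  congr 1
  rw [← integral_sub_left_eq_self _ _ z]
  congr 1
  ext u
  rw [sub_sub_cancel, ← mul_assoc, ← Complex.exp_add, sympl_sub_left, sympl_self,
    zero_sub, ← sympl_swap]
  congr 2
  push_cast
  ring

theorem I_zpow_eq_exp (k : ℤ) : Complex.I ^ k = Complex.exp (Complex.I * ((Real.pi / 2 * k : ℝ) : ℂ)) := by
  conv_lhs => rw [← Complex.exp_pi_div_two_mul_I]
  rw [← Complex.exp_int_mul]
  congr 1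
  push_cast
  ring

/-- The polarised phase makes the operator an oscillatory one with bilinear part `A = (2πħ)⁻¹ J (S -
I)⁻¹`. Since `|det J| = 1`, the factor `√|det A|` is exactly `(2πħ)⁻ⁿ |det(S - I)|^{-1/2}`. -/
theorem exists_quadraticFourierPh_unitary {ħ : ℝ} (hħ : 0 < ħ) (m : ℤ) (hP : P.IsSymm)
    (hQ : Q.IsSymm) (hS : IsFreeSymplectic P L Q S)
    (h : ((S : Phase n →L[ℝ] Phase n) - 1).det ≠ 0) :
    ∃ B : PhaseFn n ≃ₗᵢ[ℂ] PhaseFn n, ∀ (Ψ : Phase n → ℂ) (_ : Integrable Ψ) (h2 : MemLp Ψ 2),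
      B (h2.toLp Ψ) =ᵐ[volume] quadraticFourierPhFun ħ P L Q m S Ψ := by
  have hpos : 0 < 2 * Real.pi * ħ := by positivity
  let Φ : Phase n → ℝ := fun z => phaseDot (symplCayley (S : Phase n →L[ℝ] Phase n) z) z
  have hΦ : Continuous Φ := continuous_phaseDot_apply _
  have hres : (resolvent S).det * ((S : Phase n →L[ℝ] Phase n) - 1).det = 1 := by
    have h1 : LinearMap.det ((resolvent S : Phase n →ₗ[ℝ] Phase n) ∘ₗ
        (((S : Phase n →L[ℝ] Phase n) - 1 : Phase n →L[ℝ] Phase n) : Phase n →ₗ[ℝ] Phase n)) = 1 := by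
      have := Ring.inverse_mul_cancel _ (isUnit_of_det_ne_zero h)
      change LinearMap.det ((resolvent S * ((S : Phase n →L[ℝ] Phase n) - 1) :
        Phase n →L[ℝ] Phase n) : Phase n →ₗ[ℝ] Phase n) = 1
      rw [resolvent, this]
      exact LinearMap.det_id
    rwa [LinearMap.det_comp] at h1
  set A : Phase n →L[ℝ] Phase n := (1 / (2 * Real.pi * ħ)) • (symplJ n * resolvent S) with hA
  have hAdet : |A.det| = ((1 / (2 * Real.pi * ħ)) ^ n) ^ 2 /
      |((S : Phase n →L[ℝ] Phase n) - 1).det| := by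
    have h1 : A.det = (1 / (2 * Real.pi * ħ)) ^ (n + n) * ((symplJ n).det * (resolvent S).det) := by
      have h2 : A.det = LinearMap.det ((1 / (2 * Real.pi * ħ)) • ((symplJ n : Phase n →ₗ[ℝ] Phase n)
        ∘ₗ (resolvent S : Phase n →ₗ[ℝ] Phase n))) := rfl
      rw [h2, LinearMap.det_smul, LinearMap.det_comp]
      simp
    rw [h1, abs_mul, abs_mul, abs_det_symplJ, one_mul, abs_of_pos (by positivity), ← two_mul,
      pow_mul', eq_div_iff (abs_ne_zero.2 h), mul_assoc, ← abs_mul, hres, abs_one, mul_one]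
  have hAne : A.det ≠ 0 := by
    rw [← abs_ne_zero, hAdet]
    have := abs_pos.2 h
    positivity
  -- The constant added to the outer phase encodes `i^{m - Inert W_xx}`.
  obtain ⟨B, hB⟩ := exists_oscillatory_unitary
    (fun z => 1 / (2 * ħ) * Φ z + Real.pi / 2 * ((m - inertia P L Q : ℤ) : ℝ))
    (fun z => 1 / (2 * ħ) * Φ z) (by fun_prop) (by fun_prop)
    (A.toContinuousLinearEquivOfDetNeZero hAne)
  refine ⟨B, fun Ψ h1 h2 => ?_⟩
  filter_upwards [hB Ψ h1 h2] with z hz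
  have hdet : (((A.toContinuousLinearEquivOfDetNeZero hAne : Phase n ≃L[ℝ] Phase n) :
    Phase n →L[ℝ] Phase n)).det = A.det := rfl
  have hap : ∀ z, A.toContinuousLinearEquivOfDetNeZero hAne z =
    (1 / (2 * Real.pi * ħ)) • symplJ n (resolvent S z) := fun _ => rfl
  rw [hz, quadraticFourierPhFun_eq, hdet, hAdet, Real.sqrt_div (sq_nonneg _),
    Real.sqrt_sq (by positivity), Complex.ofReal_add, mul_add, Complex.exp_add, ← I_zpow_eq_exp]
  simp only [phaseDot_symplCayley_sub hP hQ hS h, hap]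
  have e1 : ∀ u : Phase n, Complex.exp (Complex.I * ((1 / (2 * ħ) * (Φ z + Φ u -
      2 * phaseDot (symplJ n (resolvent S z)) u) : ℝ) : ℂ)) * Ψ u =
      Complex.exp (Complex.I * ((1 / (2 * ħ) * Φ z : ℝ) : ℂ)) *
      (Complex.exp (Complex.I * ((-2 * Real.pi * phaseDot ((1 / (2 * Real.pi * ħ)) •
        symplJ n (resolvent S z)) u : ℝ) : ℂ)) *
        (Complex.exp (Complex.I * ((1 / (2 * ħ) * Φ u : ℝ) : ℂ)) * Ψ u)) := by
    intro u
    rw [← mul_assoc, ← mul_assoc, ← Complex.exp_add, ← Complex.exp_add, ← mul_add, ← mul_add,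
      ← Complex.ofReal_add, ← Complex.ofReal_add]
    congr 4
    simp only [phaseDot, Prod.smul_fst, Prod.smul_snd, real_inner_smul_left]
    have := Real.pi_pos.ne'
    field_simp
    ring
  simp only [Φ] at e1
  rw [funext e1, integral_const_mul]
  simp only [Φ]
  push_cast
  ring

/-- The definition prescribes the operator on Schwartz functions only. By density it coincides with
the unitary already constructed, so the integral formula becomes available for the cut-off wave
packets. -/
theorem IsQuadraticFourierPh.ae_of_integrable {ħ : ℝ} (hħ : 0 < ħ) {m : ℤ} (hP : P.IsSymm)
    (hQ : Q.IsSymm) (hS : IsFreeSymplectic P L Q S)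
    (h : ((S : Phase n →L[ℝ] Phase n) - 1).det ≠ 0) {B : PhaseFn n ≃ₗᵢ[ℂ] PhaseFn n}
    (hB : IsQuadraticFourierPh ħ P L Q m S B) {Ψ : Phase n → ℂ} (h1 : Integrable Ψ)
    (h2 : MemLp Ψ 2) : B (h2.toLp Ψ) =ᵐ[volume] quadraticFourierPhFun ħ P L Q m S Ψ := by
  obtain ⟨B', hB'⟩ := exists_quadraticFourierPh_unitary hħ m hP hQ hS h
  have heq : (B : PhaseFn n → PhaseFn n) = B' := by
    refine (SchwartzMap.denseRange_toLpCLM (E := Phase n) (F := ℂ) (p := 2) (μ := volume)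
      (by norm_num)).equalizer B.continuous B'.continuous (funext fun Ψ => ?_)
    exact Lp.ext ((hB Ψ).trans (hB' Ψ (Ψ.integrable) (Ψ.memLp 2 volume)).symm)
  rw [heq]
  exact hB' Ψ h1 h2

theorem exists_isQuadraticFourierPh {ħ : ℝ} (hħ : 0 < ħ) (m : ℤ) (hP : P.IsSymm)
    (hQ : Q.IsSymm) (hS : IsFreeSymplectic P L Q S)
    (h : ((S : Phase n →L[ℝ] Phase n) - 1).det ≠ 0) :
    ∃ B : PhaseFn n ≃ₗᵢ[ℂ] PhaseFn n, IsQuadraticFourierPh ħ P L Q m S B := by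
  obtain ⟨B, hB⟩ := exists_quadraticFourierPh_unitary hħ m hP hQ hS h
  exact ⟨B, fun Ψ => hB Ψ Ψ.integrable (Ψ.memLp 2 volume)⟩

end PhaseSpaceOperator

/-! ### The Cayley phase as a Legendre transform of `W`. -/

section PhaseIdentities

variable {P L Q : Matrix (Fin n) (Fin n) ℝ} {S : Phase n ≃L[ℝ] Phase n}

/-- The gradient at `0` of `y ↦ W(y + x₀/2, y - x₀/2)`. -/
def midpointGradient (P L Q : Matrix (Fin n) (Fin n) ℝ) (x₀ : Position n) : Position n :=
  (1 / 2 : ℝ) • Matrix.toEuclideanLin (P - Q + L.transpose - L) x₀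

/-- `W(x₀/2, -x₀/2)`. -/
def midpointValue (P L Q : Matrix (Fin n) (Fin n) ℝ) (x₀ : Position n) : ℝ :=
  1 / 8 * inner ℝ (Matrix.toEuclideanLin P x₀) x₀ + 1 / 4 * inner ℝ (Matrix.toEuclideanLin L x₀) x₀ +
    1 / 8 * inner ℝ (Matrix.toEuclideanLin Q x₀) x₀

theorem inner_toEuclideanLin_swap {A : Matrix (Fin n) (Fin n) ℝ} (hA : A.IsSymm)
    (x y : Position n) :
    inner ℝ (Matrix.toEuclideanLin A x) y = inner ℝ (Matrix.toEuclideanLin A y) x := by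
  rw [inner_toEuclideanLin_of_isSymm hA, real_inner_comm]

theorem inner_toEuclideanLin_transpose_swap (A : Matrix (Fin n) (Fin n) ℝ) (x y : Position n) :
    inner ℝ (Matrix.toEuclideanLin A.transpose x) y = inner ℝ (Matrix.toEuclideanLin A y) x := by
  rw [inner_toEuclideanLin_left A, real_inner_comm]

theorem hessian_isSymm (hP : P.IsSymm) (hQ : Q.IsSymm) :
    (P + Q - L - L.transpose).IsSymm := by
  rw [Matrix.IsSymm]
  simp only [Matrix.transpose_sub, Matrix.transpose_add, hP.eq, hQ.eq, Matrix.transpose_transpose]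
  abel

theorem hessian_isHermitian (hP : P.IsSymm) (hQ : Q.IsSymm) :
    (P + Q - L - L.transpose).IsHermitian := by
  rw [Matrix.IsHermitian, Matrix.conjTranspose_eq_transpose_of_trivial]
  exact hessian_isSymm hP hQ

/-- The phase of the kernel of `Ŝ_ph` is the critical value of
`y ↦ W(y + x₀/2, y - x₀/2) - p₀·y`. -/
theorem half_phaseDot_symplCayley (hP : P.IsSymm) (hQ : Q.IsSymm) (hS : IsFreeSymplectic P L Q S)
    (h : ((S : Phase n →L[ℝ] Phase n) - 1).det ≠ 0) (hR : (P + Q - L - L.transpose).det ≠ 0)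
    (x₀ p₀ : Position n) :
    1 / 2 * phaseDot (symplCayley (S : Phase n →L[ℝ] Phase n) (x₀, p₀)) (x₀, p₀) =
      -(1 / 2) * inner ℝ (Matrix.toEuclideanLin (P + Q - L - L.transpose)⁻¹
        (p₀ - midpointGradient P L Q x₀)) (p₀ - midpointGradient P L Q x₀) +
        midpointValue P L Q x₀ := by
  rw [phaseDot_symplCayley _ h]
  have h1 := map_resolvent h (x₀, p₀)
  set ζ := resolvent S (x₀, p₀)
  have h2 := hS.snd_apply hP hQ ζ
  have h3 := hS.snd_eq hP hQ ζ
  rw [h1] at h2 h3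
  simp only [Prod.fst_add, Prod.snd_add] at h2 h3
  -- Since `Sζ = ζ + (x₀, p₀)`, the positions of `ζ` and `Sζ` differ by `x₀`. Their midpoint `y` is
  -- the critical point sought: the generating relations become `p₀ = Ry + midpointGradient`.
  obtain ⟨y, hy⟩ : ∃ y, ζ.1 = y - (1 / 2 : ℝ) • x₀ := ⟨ζ.1 + (1 / 2 : ℝ) • x₀, by abel⟩
  have hyx : ζ.1 + x₀ = y + (1 / 2 : ℝ) • x₀ := by rw [hy]; module
  rw [hyx, hy] at h2 h3
  have h4 : p₀ - midpointGradient P L Q x₀ = Matrix.toEuclideanLin (P + Q - L - L.transpose) y := by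
    rw [← add_sub_cancel_left ζ.2 p₀, h2, h3, midpointGradient]
    simp only [map_add, map_sub, map_smul, LinearMap.add_apply, LinearMap.sub_apply]
    module
  have h5 : p₀ = Matrix.toEuclideanLin (P + Q - L - L.transpose) y + midpointGradient P L Q x₀ :=
    sub_eq_iff_eq_add.1 h4
  rw [h4, toEuclideanLin_mul_apply, Matrix.nonsing_inv_mul _ hR.isUnit, toEuclideanLin_one_apply,
    real_inner_comm]
  simp only [sympl]
  rw [h3, hy, h5, midpointGradient, midpointValue]
  simp only [map_add, map_sub, map_smul, LinearMap.add_apply, LinearMap.sub_apply, inner_add_left,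
    inner_sub_left, inner_smul_left, inner_sub_right, inner_smul_right, smul_add, smul_sub,
    RCLike.conj_to_real]
  have a1 := inner_toEuclideanLin_swap hP y x₀
  have a2 := inner_toEuclideanLin_swap hQ y x₀
  have a3 := inner_toEuclideanLin_transpose_swap L y x₀
  have a4 := inner_toEuclideanLin_transpose_swap L x₀ y
  have a5 := inner_toEuclideanLin_transpose_swap L x₀ x₀
  have a6 := inner_toEuclideanLin_transpose_swap L y y
  linarith

/-- The points `x' + x - w` and `x'` have midpoint `x' + (x - w)/2` and difference `x - w`. The left
side is the exact second-order expansion of `W` in the midpoint variable, together with the terms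
linear in `p`. -/
theorem quadGen_midpoint (hP : P.IsSymm) (hQ : Q.IsSymm) (x w p x' : Position n) :
    (1 / 2 * inner ℝ (Matrix.toEuclideanLin (P + Q - L - L.transpose) (x' + (1 / 2 : ℝ) • (x - w)))
      (x' + (1 / 2 : ℝ) • (x - w)) - inner ℝ (p - midpointGradient P L Q (x - w))
        (x' + (1 / 2 : ℝ) • (x - w))) + (midpointValue P L Q (x - w) + 1 / 2 * inner ℝ p w) =
      quadGen P L Q (x' + x - w) x' - inner ℝ p (x' + x - w) + 1 / 2 * inner ℝ p x := by
  obtain ⟨x₀, rfl⟩ : ∃ x₀, x = w + x₀ := ⟨x - w, by abel⟩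
  have e1 : x' + (w + x₀) - w = x' + x₀ := by abel
  rw [e1, add_sub_cancel_left, midpointGradient, midpointValue, quadGen]
  simp only [map_add, map_sub, map_smul, LinearMap.add_apply, LinearMap.sub_apply, inner_add_left,
    inner_sub_left, inner_add_right, inner_smul_right, smul_add, smul_sub,
    real_inner_smul_left]
  have a1 := inner_toEuclideanLin_swap hP x' x₀
  have a2 := inner_toEuclideanLin_swap hQ x' x₀
  have a3 := inner_toEuclideanLin_transpose_swap L x' x₀
  have a4 := inner_toEuclideanLin_transpose_swap L x₀ x'
  have a5 := inner_toEuclideanLin_transpose_swap L x₀ x₀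
  have a6 := inner_toEuclideanLin_transpose_swap L x' x'
  linarith

/-- The exponent in the momentum integral of `Ŝ_ph U_φ ψ`. -/
theorem momentum_exponent (hP : P.IsSymm) (hQ : Q.IsSymm) (hS : IsFreeSymplectic P L Q S)
    (h : ((S : Phase n →L[ℝ] Phase n) - 1).det ≠ 0) (hR : (P + Q - L - L.transpose).det ≠ 0)
    (x p w q x' : Position n) :
    1 / 2 * (phaseDot (symplCayley (S : Phase n →L[ℝ] Phase n) ((x, p) - (w, q)))
      ((x, p) - (w, q)) + sympl (x, p) (w, q)) + 1 / 2 * inner ℝ q w - inner ℝ q x' =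
      (-(1 / 2) * inner ℝ (Matrix.toEuclideanLin (P + Q - L - L.transpose)⁻¹
        (p - midpointGradient P L Q (x - w) - q)) (p - midpointGradient P L Q (x - w) - q) -
          inner ℝ q (x' + (1 / 2 : ℝ) • (x - w))) +
        (midpointValue P L Q (x - w) + 1 / 2 * inner ℝ p w) := by
  rw [mul_add, Prod.mk_sub_mk, half_phaseDot_symplCayley hP hQ hS h hR, sub_right_comm p q]
  simp only [sympl, inner_add_right, inner_sub_right, inner_smul_right]
  ring

/-- Matching of the normalisations of `Ŝ_{W,m}` and `(Ŝ_{W,m})_ph`. -/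
theorem normalisation_eq {ħ : ℝ} (hħ : 0 < ħ) (m : ℤ) (hP : P.IsSymm) (hQ : Q.IsSymm)
    (hS : IsFreeSymplectic P L Q S) (h : ((S : Phase n →L[ℝ] Phase n) - 1).det ≠ 0) :
    (((1 / (2 * Real.pi * ħ)) ^ n : ℝ) : ℂ) * Complex.I ^ (m - inertia P L Q) /
      (Real.sqrt |((S : Phase n →L[ℝ] Phase n) - 1).det| : ℝ) *
      ((Real.sqrt (2 * Real.pi * ħ) : ℂ) ^ n * (Real.sqrt |(P + Q - L - L.transpose).det| : ℂ) *
        (Complex.exp (-(Real.pi / 4 : ℝ) * Complex.I) ^ n * Complex.I ^ (inertia P L Q))) =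
      (1 / (2 * Real.pi * Complex.I * ħ) : ℂ) ^ ((n : ℂ) / 2) * Complex.I ^ m *
      (Real.sqrt |L.det| : ℝ) := by
  have hpos : 0 < 2 * Real.pi * ħ := by positivity
  rw [← hS.abs_det_sub_one_mul hP hQ, Real.sqrt_mul (abs_nonneg _)]
  have h1 : (Real.sqrt |((S : Phase n →L[ℝ] Phase n) - 1).det| : ℂ) ≠ 0 := by
    exact_mod_cast (Real.sqrt_pos.2 (abs_pos.2 h)).ne'
  -- On the principal branch `1/i = e^{-iπ/2}`, so the power `n/2` gives `e^{-iπn/4}`. The modulus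
  -- `(2πħ)^{-n/2}` is split as `(2πħ)⁻ⁿ (2πħ)^{n/2}`, the product of the phase-space and Fresnel
  -- constants.
  have h2 : (1 / (2 * Real.pi * Complex.I * ħ) : ℂ) ^ ((n : ℂ) / 2) =
      (((1 / (2 * Real.pi * ħ)) ^ n : ℝ) : ℂ) * (Real.sqrt (2 * Real.pi * ħ) : ℂ) ^ n *
        Complex.exp (-(Real.pi / 4 : ℝ) * Complex.I) ^ n := by
    have h3 : (1 / (2 * Real.pi * Complex.I * ħ) : ℂ) = ((1 / (2 * Real.pi * ħ) : ℝ) : ℂ) *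
        Complex.exp ((-Real.pi / 2 : ℝ) * Complex.I) := by
      push_cast
      rw [Complex.exp_neg_pi_div_two_mul_I]
      have : (ħ : ℂ) ≠ 0 := by exact_mod_cast hħ.ne'
      have : (Real.pi : ℂ) ≠ 0 := by exact_mod_cast Real.pi_ne_zero
      field_simp
      simp
    rw [h3, polar_cpow (by positivity) (by linarith [Real.pi_pos]) (by linarith [Real.pi_pos]),
      ← Complex.exp_nat_mul]
    congr 1
    · rw [show (n : ℂ) / 2 = (((n : ℝ) / 2 : ℝ) : ℂ) by push_cast; rfl,
        ← Complex.ofReal_cpow (by positivity), ← Complex.ofReal_pow, ← Complex.ofReal_mul,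
        ← mul_pow]
      congr 1
      rw [div_eq_mul_one_div (n : ℝ) 2, mul_comm (n : ℝ), Real.rpow_mul (by positivity),
        Real.rpow_natCast, ← Real.sqrt_eq_rpow]
      congr 1
      have h5 := Real.sqrt_pos.2 hpos
      rw [one_div, Real.sqrt_inv, inv_mul_eq_div, eq_div_iff hpos.ne', inv_mul_eq_iff_eq_mul₀ h5.ne',
        Real.mul_self_sqrt hpos.le]
    · congr 1
      push_cast
      ring
  rw [h2, zpow_sub₀ Complex.I_ne_zero, zpow_natCast]
  have h4 : Complex.I ^ inertia P L Q ≠ 0 := pow_ne_zero _ Complex.I_ne_zero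
  push_cast
  field_simp

end PhaseIdentities

/-! ### Gaussian cut-off of the wave-packet transform. -/

section Regularisation

open Filter Topology

theorem wavePacketFun_congr (ħ : ℝ) (φ : 𝓢(Position n, ℂ)) {ψ ψ' : Position n → ℂ}
    (h : ψ =ᵐ[volume] ψ') : wavePacketFun ħ φ ψ = wavePacketFun ħ φ ψ' := by
  ext z
  unfold wavePacketFun
  congr 1
  refine integral_congr_ae ?_
  filter_upwards [h] with x hx
  rw [hx]

theorem memLp_wavePacketFun_schwartz {ħ : ℝ} (hħ : 0 < ħ) (φ ψ : 𝓢(Position n, ℂ)) :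
    MemLp (wavePacketFun ħ φ ψ) 2 volume := by
  rw [← wavePacketFun_congr ħ φ (ψ.coeFn_toLp 2 volume)]
  exact memLp_wavePacketFun hħ φ _

theorem wavePacketTransform_toLp {ħ : ℝ} (hħ : 0 < ħ) (φ ψ : 𝓢(Position n, ℂ)) :
    wavePacketTransform hħ φ (ψ.toLp 2 volume) = (memLp_wavePacketFun_schwartz hħ φ ψ).toLp _ :=
  MemLp.toLp_congr _ _ (.of_eq (wavePacketFun_congr ħ φ (ψ.coeFn_toLp 2 volume)))

/-- Multiplying by factors of modulus at most `1` tending to `1` converges to the identity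
on `L²`. -/
theorem tendsto_toLp_mul {α ι : Type*} [MeasurableSpace α] {μ : Measure α} {l : Filter ι}
    [l.IsCountablyGenerated] {f : α → ℂ} (hf : MemLp f 2 μ) {g : ι → α → ℂ}
    (hg : ∀ i x, ‖g i x‖ ≤ 1) (hgm : ∀ i, AEStronglyMeasurable (g i) μ)
    (hlim : ∀ x, Tendsto (fun i => g i x) l (𝓝 1)) (hgf : ∀ i, MemLp (fun x => g i x * f x) 2 μ) :
    Tendsto (fun i => (hgf i).toLp _) l (𝓝 (hf.toLp f)) := by
  rw [Lp.tendsto_Lp_iff_tendsto_eLpNorm'']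
  have e1 : ∀ i, eLpNorm ((fun x => g i x * f x) - f) 2 μ =
      (∫⁻ x, ‖g i x * f x - f x‖ₑ ^ (2 : ℝ) ∂μ) ^ (1 / 2 : ℝ) := by
    intro i
    rw [eLpNorm_eq_lintegral_rpow_enorm_toReal (by norm_num) (by norm_num)]
    simp
  simp only [e1]
  rw [show (0 : ℝ≥0∞) = (∫⁻ x, 0 ∂μ) ^ (1 / 2 : ℝ) by
    rw [lintegral_zero, ENNReal.zero_rpow_of_pos (by norm_num)]]
  refine (ENNReal.continuous_rpow_const.tendsto _).comp ?_
  refine tendsto_lintegral_filter_of_dominated_convergence' (fun x => 4 * ‖f x‖ₑ ^ (2 : ℝ))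
    (Eventually.of_forall fun i => ?_) (Eventually.of_forall fun i => Eventually.of_forall
      fun x => ?_) ?_ (Eventually.of_forall fun x => ?_)
  · exact (((hgm i).mul hf.1).sub hf.1).enorm.pow_const _
  · have h1 : ‖g i x * f x - f x‖ₑ ≤ 2 * ‖f x‖ₑ := by
      refine (enorm_sub_le).trans ?_
      rw [enorm_mul, two_mul]
      gcongr
      have : ‖g i x‖ₑ ≤ 1 := by
        rw [← ofReal_norm, ← ENNReal.ofReal_one]
        exact ENNReal.ofReal_le_ofReal (hg i x)
      calc ‖g i x‖ₑ * ‖f x‖ₑ ≤ 1 * ‖f x‖ₑ := by gcongr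
        _ = _ := one_mul _
    refine (ENNReal.rpow_le_rpow h1 (by norm_num)).trans ?_
    rw [ENNReal.mul_rpow_of_nonneg _ _ (by norm_num)]
    norm_num
  · rw [lintegral_const_mul' _ _ (by norm_num)]
    have h2 := lintegral_rpow_enorm_lt_top_of_eLpNorm_lt_top (by norm_num) (by norm_num) hf.2
    rw [ENNReal.toReal_ofNat] at h2
    exact (ENNReal.mul_lt_top (by norm_num) h2).ne
  · have h1 : Tendsto (fun i => g i x * f x - f x) l (𝓝 0) := by
      have := ((hlim x).mul_const (f x)).sub_const (f x)
      rwa [one_mul, sub_self] at this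
    have h2 := (ENNReal.continuous_rpow_const (y := 2)).tendsto _ |>.comp h1.enorm
    simpa [Function.comp_def] using h2

theorem integrable_window_mul (φ ψ : 𝓢(Position n, ℂ)) :
    Integrable (fun p : Position n × Position n => ψ p.2 * conj (φ (p.1 - p.2))) := by
  have h1 : Integrable fun x => conj (φ x) := by
    have h2 := φ.integrable (μ := volume)
    exact (Complex.conjCLE : ℂ →L[ℝ] ℂ).integrable_comp h2
  exact ψ.integrable.convolution_integrand (ContinuousLinearMap.mul ℂ ℂ) h1

theorem integrable_gaussian {ε : ℝ} (hε : 0 < ε) :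
    Integrable fun q : Position n => Complex.exp (-ε * ‖q‖ ^ 2) := by
  simpa using GaussianFourier.integrable_cexp_neg_mul_sq_norm_add (V := Position n)
    (b := (ε : ℂ)) (by simpa using hε) 0 0

theorem norm_gaussian_le {ε : ℝ} (hε : 0 ≤ ε) (q : Position n) :
    ‖Complex.exp (-ε * ‖q‖ ^ 2)‖ ≤ 1 := by
  rw [← Complex.ofReal_pow, ← Complex.ofReal_neg, ← Complex.ofReal_mul, ← Complex.ofReal_exp,
    Complex.norm_real, Real.norm_of_nonneg (Real.exp_pos _).le, Real.exp_le_one_iff]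
  nlinarith [sq_nonneg ‖q‖]

theorem norm_exp_I_div_mul (ħ r : ℝ) : ‖Complex.exp (Complex.I / ħ * r)‖ = 1 := by
  have : Complex.I / ħ * r = Complex.I * ((r / ħ : ℝ) : ℂ) := by push_cast; ring
  rw [this, norm_exp_I_mul_ofReal]

/-- The wave-packet transform with a Gaussian cut-off in momentum. -/
def regularisedWavePacket (ħ : ℝ) (φ ψ : 𝓢(Position n, ℂ)) (ε : ℝ) (u : Phase n) : ℂ :=
  Complex.exp (-ε * ‖u.2‖ ^ 2) * wavePacketFun ħ φ ψ u

/-- The wave packet is bounded, uniformly in momentum, by an integrable function of position (a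
convolution of `|ψ|` and `|φ|`). The Gaussian supplies integrability in momentum. -/
theorem integrable_regularisedWavePacket {ħ : ℝ} (φ ψ : 𝓢(Position n, ℂ)) {ε : ℝ}
    (hε : 0 < ε) : Integrable (regularisedWavePacket ħ φ ψ ε) := by
  have h1 : Integrable fun w => ∫ x', ‖ψ x' * conj (φ (w - x'))‖ :=
    (integrable_window_mul φ ψ).norm.integral_prod_left
  have h2 := (h1.mul_prod (integrable_gaussian (n := n) hε).norm).const_mul
    ‖(((1 / (2 * Real.pi * ħ)) ^ ((n : ℝ) / 2) : ℝ) : ℂ)‖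
  refine h2.mono' ?_ (Eventually.of_forall fun u => ?_)
  · exact (Continuous.aestronglyMeasurable (by fun_prop)).mul
      (stronglyMeasurable_wavePacketFun ħ φ ψ.continuous.stronglyMeasurable).aestronglyMeasurable
  · rw [regularisedWavePacket, norm_mul, wavePacketFun, norm_mul, norm_mul]
    have e2 : ‖Complex.exp (Complex.I / (2 * ħ) * (inner ℝ u.2 u.1 : ℝ))‖ = 1 := by
      have := norm_exp_I_div_mul (2 * ħ) (inner ℝ u.2 u.1)
      rw [← this]
      push_cast
      rfl
    rw [e2, mul_one, mul_comm ‖Complex.exp _‖, mul_assoc, mul_assoc]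
    refine mul_le_mul_of_nonneg_left (mul_le_mul_of_nonneg_right ?_ (norm_nonneg _))
      (norm_nonneg _)
    refine (norm_integral_le_integral_norm _).trans (le_of_eq ?_)
    congr 1
    ext x'
    have e3 : ‖Complex.exp (-(Complex.I / ħ) * (inner ℝ u.2 x' : ℝ))‖ = 1 := by
      have := norm_exp_I_div_mul ħ (-inner ℝ u.2 x')
      rw [← this]
      push_cast
      congr 2
      ring
    rw [norm_mul, norm_mul, norm_mul, e3, one_mul]

theorem memLp_regularisedWavePacket {ħ : ℝ} (hħ : 0 < ħ) (φ ψ : 𝓢(Position n, ℂ)) {ε : ℝ}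
    (hε : 0 ≤ ε) : MemLp (regularisedWavePacket ħ φ ψ ε) 2 := by
  refine (memLp_wavePacketFun_schwartz hħ φ ψ).of_le ?_ (Eventually.of_forall fun u => ?_)
  · exact (Continuous.aestronglyMeasurable (by fun_prop)).mul
      (stronglyMeasurable_wavePacketFun ħ φ ψ.continuous.stronglyMeasurable).aestronglyMeasurable
  · rw [regularisedWavePacket, norm_mul]
    exact mul_le_of_le_one_left (norm_nonneg _) (norm_gaussian_le hε _)

end Regularisation

/-! ### The momentum integral in `Ŝ_ph U_φ ψ`. -/

section Intertwining

open Filter Topology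

variable {P L Q : Matrix (Fin n) (Fin n) ℝ} {S : Phase n ≃L[ℝ] Phase n}

/-- The kernel obtained from `Ŝ_ph` applied to a regularised wave-packet transform after the
momentum integration. -/
def regularisedKernel (ħ : ℝ) (P L Q : Matrix (Fin n) (Fin n) ℝ) (ε : ℝ) (z : Phase n)
    (v : Position n × Position n) : ℂ :=
  Complex.exp (Complex.I / ħ * ((midpointValue P L Q (z.1 - v.1) + 1 / 2 * inner ℝ z.2 v.1 : ℝ) : ℂ)) *
    regularisedFresnel ħ (P + Q - L - L.transpose) ε (z.2 - midpointGradient P L Q (z.1 - v.1))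
      (v.2 + (1 / 2 : ℝ) • (z.1 - v.1))

theorem continuous_midpointGradient (P L Q : Matrix (Fin n) (Fin n) ℝ) :
    Continuous (midpointGradient P L Q) := by
  unfold midpointGradient
  have := (Matrix.toEuclideanLin (P - Q + L.transpose - L)).continuous_of_finiteDimensional
  fun_prop

theorem continuous_midpointValue (P L Q : Matrix (Fin n) (Fin n) ℝ) :
    Continuous (midpointValue P L Q) := by
  unfold midpointValue
  have h1 := (Matrix.toEuclideanLin P).continuous_of_finiteDimensional
  have h2 := (Matrix.toEuclideanLin L).continuous_of_finiteDimensional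
  have h3 := (Matrix.toEuclideanLin Q).continuous_of_finiteDimensional
  fun_prop

theorem continuous_quadGen (P L Q : Matrix (Fin n) (Fin n) ℝ) :
    Continuous fun v : Position n × Position n => quadGen P L Q v.1 v.2 := by
  unfold quadGen
  have h1 := (Matrix.toEuclideanLin P).continuous_of_finiteDimensional
  have h2 := (Matrix.toEuclideanLin L).continuous_of_finiteDimensional
  have h3 := (Matrix.toEuclideanLin Q).continuous_of_finiteDimensional
  fun_prop

theorem stronglyMeasurable_regularisedKernel (ħ : ℝ) (P L Q : Matrix (Fin n) (Fin n) ℝ) (ε : ℝ)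
    (z : Phase n) : StronglyMeasurable (regularisedKernel ħ P L Q ε z) := by
  have h1 := continuous_midpointGradient P L Q
  have h2 := continuous_midpointValue P L Q
  have h3 := (Matrix.toEuclideanLin
    (P + Q - L - L.transpose)⁻¹).continuous_of_finiteDimensional
  refine StronglyMeasurable.mul (Continuous.stronglyMeasurable (by fun_prop)) ?_
  refine StronglyMeasurable.integral_prod_right (f := fun (v : Position n × Position n)
    (q : Position n) => Complex.exp (-ε * ‖q‖ ^ 2) * Complex.exp (Complex.I / ħ *
    ((-(1 / 2) * inner ℝ (Matrix.toEuclideanLin (P + Q - L - L.transpose)⁻¹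
      (z.2 - midpointGradient P L Q (z.1 - v.1) - q))
        (z.2 - midpointGradient P L Q (z.1 - v.1) - q) -
      inner ℝ q (v.2 + (1 / 2 : ℝ) • (z.1 - v.1)) : ℝ) : ℂ))) ?_
  exact Continuous.stronglyMeasurable (by fun_prop)

theorem exists_norm_regularisedKernel_le {ħ : ℝ} (hħ : 0 < ħ) (hP : P.IsSymm) (hQ : Q.IsSymm)
    (hR : (P + Q - L - L.transpose).det ≠ 0) :
    ∃ K, ∀ ε > 0, ∀ z v, ‖regularisedKernel ħ P L Q ε z v‖ ≤ K := by
  obtain ⟨K, hK⟩ := exists_norm_regularisedFresnel_le (hessian_isHermitian (L := L) hP hQ) hR hħ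
  refine ⟨K, fun ε hε z v => ?_⟩
  rw [regularisedKernel, norm_mul, norm_exp_I_div_mul, one_mul]
  exact hK ε hε _ _

/-- The momentum integral in `Ŝ_ph U_φ ψ`, with a Gaussian cut-off. -/
theorem quadraticFourierPhFun_regularised {ħ : ℝ} (hħ : 0 < ħ) (m : ℤ) (hP : P.IsSymm)
    (hQ : Q.IsSymm) (hS : IsFreeSymplectic P L Q S)
    (h : ((S : Phase n →L[ℝ] Phase n) - 1).det ≠ 0) (hR : (P + Q - L - L.transpose).det ≠ 0)
    (φ ψ : 𝓢(Position n, ℂ)) {ε : ℝ} (hε : 0 < ε) (z : Phase n) :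
    quadraticFourierPhFun ħ P L Q m S (regularisedWavePacket ħ φ ψ ε) z =
      (((1 / (2 * Real.pi * ħ)) ^ n : ℝ) : ℂ) * Complex.I ^ (m - inertia P L Q) /
      (Real.sqrt |((S : Phase n →L[ℝ] Phase n) - 1).det| : ℝ) *
      ((((1 / (2 * Real.pi * ħ)) ^ ((n : ℝ) / 2) : ℝ) : ℂ) *
        ∫ v : Position n × Position n, regularisedKernel ħ P L Q ε z v *
          (ψ v.2 * conj (φ (v.1 - v.2)))) := by
  rw [quadraticFourierPhFun_eq]
  congr 1
  set c : ℂ := (((1 / (2 * Real.pi * ħ)) ^ ((n : ℝ) / 2) : ℝ) : ℂ)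
  have hk : Continuous fun u : Phase n => 1 / (2 * ħ) *
      (phaseDot (symplCayley (S : Phase n →L[ℝ] Phase n) (z - u)) (z - u) + sympl z u) := by
    have h1 := (continuous_phaseDot_apply (symplCayley (S : Phase n →L[ℝ] Phase n))).comp
      (continuous_const.sub continuous_id : Continuous fun u : Phase n => z - u)
    have h2 : Continuous fun u : Phase n => sympl z u := by unfold sympl; fun_prop
    exact continuous_const.mul (h1.add h2)
  have hint : Integrable fun u : Phase n => Complex.exp (Complex.I * ((1 / (2 * ħ) *
      (phaseDot (symplCayley (S : Phase n →L[ℝ] Phase n) (z - u)) (z - u) + sympl z u) : ℝ) : ℂ)) *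
        regularisedWavePacket ħ φ ψ ε u := by
    refine (integrable_regularisedWavePacket φ ψ hε).bdd_mul (c := 1)
      (Continuous.aestronglyMeasurable (by fun_prop)) ?_
    exact Eventually.of_forall fun x => (norm_exp_I_mul_ofReal _).le
  obtain ⟨K, hK⟩ := exists_norm_regularisedKernel_le (L := L) hħ hP hQ hR
  have hint2 : Integrable fun v : Position n × Position n => regularisedKernel ħ P L Q ε z v *
          (ψ v.2 * conj (φ (v.1 - v.2))) := by
    refine (integrable_window_mul φ ψ).bdd_mul (c := K)
      (stronglyMeasurable_regularisedKernel ħ P L Q ε z).aestronglyMeasurable ?_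
    exact Eventually.of_forall fun v => hK ε hε z v
  rw [Measure.volume_eq_prod, integral_prod _ hint, integral_prod _ hint2, ← integral_const_mul]
  refine integral_congr_ae (Eventually.of_forall fun w => ?_)
  simp only
  -- For fixed `w`, the Gaussian in `q` and the integrable factor in `x'` give absolute convergence.
  -- So the momentum integral may be done first, where it becomes the regularised Fresnel integral.
  have hint3 : Integrable (Function.uncurry fun (q x' : Position n) =>
      Complex.exp (-ε * ‖q‖ ^ 2) * Complex.exp (Complex.I / ħ * ((1 / 2 *
        (phaseDot (symplCayley (S : Phase n →L[ℝ] Phase n) (z - (w, q))) (z - (w, q)) +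
          sympl z (w, q)) + 1 / 2 * inner ℝ q w - inner ℝ q x' : ℝ) : ℂ)) *
            (ψ x' * conj (φ (w - x')))) (volume.prod volume) := by
    have hφc := φ.continuous
    have hψc := ψ.continuous
    have hψφ : Integrable fun x' => conj (φ (w - x')) * ψ x' := by
      refine ψ.integrable.bdd_mul (c := ‖φ.toBoundedContinuousFunction‖)
        (Continuous.aestronglyMeasurable (by fun_prop)) (Eventually.of_forall fun x' => ?_)
      rw [RCLike.norm_conj]
      exact φ.toBoundedContinuousFunction.norm_coe_le_norm _
    refine ((integrable_gaussian (n := n) hε).mul_prod hψφ).mono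
      (Continuous.aestronglyMeasurable ?_) (Eventually.of_forall fun v => le_of_eq ?_)
    · have h4 : Continuous fun q => 1 / 2 * (phaseDot (symplCayley (S : Phase n →L[ℝ] Phase n)
          (z - (w, q))) (z - (w, q)) + sympl z (w, q)) := by
        have h1 := (continuous_phaseDot_apply (symplCayley (S : Phase n →L[ℝ] Phase n))).comp
          (continuous_const.sub (Continuous.prodMk continuous_const continuous_id) :
            Continuous fun q : Position n => z - (w, q))
        have h2 : Continuous fun q : Position n => sympl z (w, q) := by unfold sympl; fun_prop
        exact continuous_const.mul (h1.add h2)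
      have h5 : Continuous fun v : Position n × Position n => 1 / 2 * inner ℝ v.1 w := by fun_prop
      have h6 : Continuous fun v : Position n × Position n => (inner ℝ v.1 v.2 : ℝ) := by fun_prop
      exact (Continuous.mul (by fun_prop) (Continuous.cexp (continuous_const.mul
        (Complex.continuous_ofReal.comp (((h4.comp continuous_fst).add h5).sub h6))))).mul
          (by fun_prop)
    · rw [Function.uncurry, norm_mul, norm_mul, norm_exp_I_div_mul, mul_one, norm_mul, norm_mul,
        norm_mul, mul_comm ‖ψ _‖]
  calc ∫ q, Complex.exp (Complex.I * ((1 / (2 * ħ) *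
      (phaseDot (symplCayley (S : Phase n →L[ℝ] Phase n) (z - (w, q))) (z - (w, q)) +
        sympl z (w, q)) : ℝ) : ℂ)) * regularisedWavePacket ħ φ ψ ε (w, q)
      = c * ∫ q, ∫ x', Complex.exp (-ε * ‖q‖ ^ 2) * Complex.exp (Complex.I / ħ * ((1 / 2 *
        (phaseDot (symplCayley (S : Phase n →L[ℝ] Phase n) (z - (w, q))) (z - (w, q)) +
          sympl z (w, q)) + 1 / 2 * inner ℝ q w - inner ℝ q x' : ℝ) : ℂ)) *
            (ψ x' * conj (φ (w - x'))) := by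
        rw [← integral_const_mul]
        congr 1
        ext q
        rw [regularisedWavePacket, wavePacketFun, ← integral_const_mul, ← integral_const_mul,
          ← integral_const_mul, ← integral_const_mul]
        congr 1
        ext x'
        have e1 : Complex.exp (Complex.I / ħ * ((1 / 2 *
            (phaseDot (symplCayley (S : Phase n →L[ℝ] Phase n) (z - (w, q))) (z - (w, q)) +
            sympl z (w, q)) + 1 / 2 * inner ℝ q w - inner ℝ q x' : ℝ) : ℂ)) =
            Complex.exp (Complex.I * ((1 / (2 * ħ) *
            (phaseDot (symplCayley (S : Phase n →L[ℝ] Phase n) (z - (w, q))) (z - (w, q)) +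
              sympl z (w, q)) : ℝ) : ℂ)) *
            Complex.exp (Complex.I / (2 * ħ) * (inner ℝ q w : ℝ)) *
            Complex.exp (-(Complex.I / ħ) * (inner ℝ q x' : ℝ)) := by
          rw [← Complex.exp_add, ← Complex.exp_add]
          congr 1
          push_cast
          ring
        rw [e1]
        simp only [c]
        ring
    _ = c * ∫ x', ∫ q, Complex.exp (-ε * ‖q‖ ^ 2) * Complex.exp (Complex.I / ħ * ((1 / 2 *
        (phaseDot (symplCayley (S : Phase n →L[ℝ] Phase n) (z - (w, q))) (z - (w, q)) +
          sympl z (w, q)) + 1 / 2 * inner ℝ q w - inner ℝ q x' : ℝ) : ℂ)) *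
            (ψ x' * conj (φ (w - x'))) := by
        rw [integral_integral_swap hint3]
    _ = _ := by
        congr 2
        ext x'
        rw [integral_mul_const]
        congr 1
        rw [regularisedKernel, regularisedFresnel, ← integral_const_mul]
        congr 1
        ext q
        obtain ⟨x, p⟩ := z
        rw [momentum_exponent hP hQ hS h hR, Complex.ofReal_add, mul_add, Complex.exp_add]
        ring

end Intertwining

/-! ### Removing the cut-off pointwise. -/

section Intertwining

open Filter Topology

variable {P L Q : Matrix (Fin n) (Fin n) ℝ} {S : Phase n ≃L[ℝ] Phase n}

/-- The Fresnel limit inverts the Legendre transform: it replaces `-R⁻¹` by `R` and evaluates at the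
midpoint, where the expansion of `W` reassembles the generating function. -/
theorem tendsto_regularisedKernel {ħ : ℝ} (hħ : 0 < ħ) (hP : P.IsSymm) (hQ : Q.IsSymm)
    (hR : (P + Q - L - L.transpose).det ≠ 0) (z : Phase n) (v : Position n × Position n) :
    Tendsto (fun ε => regularisedKernel ħ P L Q ε z v) (𝓝[>] 0) (𝓝
      (((Real.sqrt (2 * Real.pi * ħ) : ℂ) ^ n * (Real.sqrt |(P + Q - L - L.transpose).det| : ℂ) *
        (Complex.exp (-(Real.pi / 4 : ℝ) * Complex.I) ^ n * Complex.I ^ (inertia P L Q))) *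
        Complex.exp (Complex.I / ħ * ((quadGen P L Q (v.2 + z.1 - v.1) v.2 -
          inner ℝ z.2 (v.2 + z.1 - v.1) + 1 / 2 * inner ℝ z.2 z.1 : ℝ) : ℂ)))) := by
  have h1 := (tendsto_regularisedFresnel (hessian_isHermitian (L := L) hP hQ) hR hħ
    (z.2 - midpointGradient P L Q (z.1 - v.1)) (v.2 + (1 / 2 : ℝ) • (z.1 - v.1))).const_mul
    (Complex.exp (Complex.I / ħ * ((midpointValue P L Q (z.1 - v.1) +
      1 / 2 * inner ℝ z.2 v.1 : ℝ) : ℂ)))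
  rw [← quadGen_midpoint hP hQ, Complex.ofReal_add _ (midpointValue _ _ _ _ + _), mul_add,
    Complex.exp_add]
  convert h1 using 2
  · rfl
  · rw [inertia]
    ring

/-- The substitution `v = x' + x - w`, with `x` the position of `z`, turns the window `φ(x - v)`
into `φ(w - x')`. This matches the variables left by the momentum integration. -/
theorem wavePacketFun_quadraticFourier (ħ : ℝ) (P L Q : Matrix (Fin n) (Fin n) ℝ) (c : ℂ)
    (φ ψ : 𝓢(Position n, ℂ)) (z : Phase n) :
    wavePacketFun ħ φ (fun x => c * ∫ x', Complex.exp (Complex.I / ħ * (quadGen P L Q x x' : ℝ)) *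
      ψ x') z =
      c * ((((1 / (2 * Real.pi * ħ)) ^ ((n : ℝ) / 2) : ℝ) : ℂ) *
        ∫ v : Position n × Position n, Complex.exp (Complex.I / ħ *
          ((quadGen P L Q (v.2 + z.1 - v.1) v.2 - inner ℝ z.2 (v.2 + z.1 - v.1) +
            1 / 2 * inner ℝ z.2 z.1 : ℝ) : ℂ)) * (ψ v.2 * conj (φ (v.1 - v.2)))) := by
  have hψc := ψ.continuous
  have hφc := φ.continuous
  have hW := continuous_quadGen P L Q
  let G : Position n → Position n → ℂ := fun v x' => Complex.exp (Complex.I / ħ *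
    ((quadGen P L Q v x' - inner ℝ z.2 v + 1 / 2 * inner ℝ z.2 z.1 : ℝ) : ℂ))
  have hG : Continuous fun v : Position n × Position n => G v.1 v.2 := by
    have h1 : Continuous fun v : Position n × Position n => (inner ℝ z.2 v.1 : ℝ) := by fun_prop
    exact Continuous.cexp (continuous_const.mul (Complex.continuous_ofReal.comp
      ((hW.sub h1).add continuous_const)))
  have hGn : ∀ v x', ‖G v x'‖ = 1 := fun v x' => norm_exp_I_div_mul _ _
  have hφi : Integrable fun v => conj (φ (z.1 - v)) := by
    have h2 := (φ.integrable (μ := volume)).comp_sub_left z.1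
    exact (Complex.conjCLE : ℂ →L[ℝ] ℂ).integrable_comp h2
  have hint1 : Integrable (Function.uncurry fun v x' => G v x' * (ψ x' * conj (φ (z.1 - v))))
      (volume.prod volume) := by
    refine (hφi.mul_prod ψ.integrable).mono (Continuous.aestronglyMeasurable ?_)
      (Eventually.of_forall fun v => le_of_eq ?_)
    · exact hG.mul (by fun_prop)
    · rw [Function.uncurry, norm_mul, hGn, one_mul, norm_mul, norm_mul, mul_comm]
  have hint2 : Integrable (fun v : Position n × Position n => G (v.2 + z.1 - v.1) v.2 *
      (ψ v.2 * conj (φ (v.1 - v.2)))) (volume.prod volume) := by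
    refine (integrable_window_mul φ ψ).mono (Continuous.aestronglyMeasurable ?_)
      (Eventually.of_forall fun v => le_of_eq ?_)
    · exact (hG.comp (by fun_prop : Continuous fun v : Position n × Position n =>
        (v.2 + z.1 - v.1, v.2))).mul (by fun_prop)
    · rw [norm_mul, hGn, one_mul]
  change _ = c * (_ * ∫ v : Position n × Position n, G (v.2 + z.1 - v.1) v.2 *
    (ψ v.2 * conj (φ (v.1 - v.2))))
  rw [Measure.volume_eq_prod, integral_prod_symm _ hint2]
  have e1 : ∀ x', ∫ w, G (x' + z.1 - w) x' * (ψ x' * conj (φ (w - x'))) =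
      ∫ v, G v x' * (ψ x' * conj (φ (z.1 - v))) := by
    intro x'
    rw [← integral_sub_left_eq_self (fun v => G v x' * (ψ x' * conj (φ (z.1 - v)))) volume
      (x' + z.1)]
    congr 1
    ext w
    congr 4
    abel
  simp only [e1]
  rw [← integral_integral_swap hint1, wavePacketFun, mul_assoc, mul_left_comm c]
  congr 1
  rw [← integral_const_mul, ← integral_const_mul]
  congr 1
  ext v
  rw [← integral_const_mul, ← integral_const_mul, ← integral_const_mul, ← integral_mul_const,
    ← integral_const_mul]
  congr 1
  ext x'
  have e2 : G v x' = Complex.exp (Complex.I / (2 * ħ) * (inner ℝ z.2 z.1 : ℝ)) *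
      Complex.exp (-(Complex.I / ħ) * (inner ℝ z.2 v : ℝ)) *
      Complex.exp (Complex.I / ħ * (quadGen P L Q v x' : ℝ)) := by
    rw [← Complex.exp_add, ← Complex.exp_add]
    change Complex.exp _ = Complex.exp _
    congr 1
    push_cast
    ring
  rw [e2]
  ring

theorem tendsto_quadraticFourierPhFun_regularised {ħ : ℝ} (hħ : 0 < ħ) (m : ℤ) (hP : P.IsSymm)
    (hQ : Q.IsSymm) (hS : IsFreeSymplectic P L Q S)
    (h : ((S : Phase n →L[ℝ] Phase n) - 1).det ≠ 0) (hR : (P + Q - L - L.transpose).det ≠ 0)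
    (φ ψ : 𝓢(Position n, ℂ)) (z : Phase n) :
    Tendsto (fun ε => quadraticFourierPhFun ħ P L Q m S (regularisedWavePacket ħ φ ψ ε) z)
      (𝓝[>] 0) (𝓝 (wavePacketFun ħ φ (fun x =>
        ((1 / (2 * Real.pi * Complex.I * ħ) : ℂ) ^ ((n : ℂ) / 2) * Complex.I ^ m *
          (Real.sqrt |L.det| : ℝ)) *
        ∫ x', Complex.exp (Complex.I / ħ * (quadGen P L Q x x' : ℝ)) * ψ x') z)) := by
  rw [wavePacketFun_quadraticFourier, ← normalisation_eq hħ m hP hQ hS h]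
  obtain ⟨K, hK⟩ := exists_norm_regularisedKernel_le (L := L) hħ hP hQ hR
  have hwin := integrable_window_mul φ ψ
  have hlim := tendsto_integral_filter_of_dominated_convergence
    (F := fun ε (v : Position n × Position n) => regularisedKernel ħ P L Q ε z v *
      (ψ v.2 * conj (φ (v.1 - v.2)))) (l := 𝓝[>] (0 : ℝ)) (μ := volume)
    (fun v => K * ‖ψ v.2 * conj (φ (v.1 - v.2))‖)
    (Eventually.of_forall fun ε =>
      (stronglyMeasurable_regularisedKernel ħ P L Q ε z).aestronglyMeasurable.mul hwin.1)
    (by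
      filter_upwards [self_mem_nhdsWithin] with ε hε
      refine Eventually.of_forall fun v => ?_
      rw [norm_mul]
      exact mul_le_mul_of_nonneg_right (hK ε hε z v) (norm_nonneg _))
    (hwin.norm.const_mul K)
    (Eventually.of_forall fun v => (tendsto_regularisedKernel hħ hP hQ hR z v).mul_const _)
  have hlim' := (hlim.const_mul (((1 / (2 * Real.pi * ħ)) ^ ((n : ℝ) / 2) : ℝ) : ℂ)).const_mul
    ((((1 / (2 * Real.pi * ħ)) ^ n : ℝ) : ℂ) * Complex.I ^ (m - inertia P L Q) /
      (Real.sqrt |((S : Phase n →L[ℝ] Phase n) - 1).det| : ℝ))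
  refine Tendsto.congr' ?_ (hlim'.trans (le_of_eq ?_))
  · filter_upwards [self_mem_nhdsWithin] with ε hε
    exact (quadraticFourierPhFun_regularised hħ m hP hQ hS h hR φ ψ hε z).symm
  · congr 1
    simp only [mul_assoc, integral_const_mul]
    ring

end Intertwining

/-! ### Continuity of `U_φ` and the intertwining relation for generators. -/

section Continuity

open Filter Topology

theorem wavePacketTransform_ae {ħ : ℝ} (hħ : 0 < ħ) (φ : 𝓢(Position n, ℂ)) (ψ : WaveFn n) :
    wavePacketTransform hħ φ ψ =ᵐ[volume] wavePacketFun ħ φ ψ :=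
  MemLp.coeFn_toLp _

/-- The wave-packet transform as a linear map. -/
def wavePacketLinear {ħ : ℝ} (hħ : 0 < ħ) (φ : 𝓢(Position n, ℂ)) : WaveFn n →ₗ[ℂ] PhaseFn n where
  toFun := wavePacketTransform hħ φ
  map_add' ψ χ := by
    apply Lp.ext
    filter_upwards [wavePacketTransform_ae hħ φ (ψ + χ), wavePacketTransform_ae hħ φ ψ,
      wavePacketTransform_ae hħ φ χ,
      Lp.coeFn_add (wavePacketTransform hħ φ ψ) (wavePacketTransform hħ φ χ)] with z h1 h2 h3 h4
    rw [h1, h4, Pi.add_apply, h2, h3]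
    simp only [wavePacketFun_eq_inner, inner_add_right, mul_add]
  map_smul' c ψ := by
    apply Lp.ext
    filter_upwards [wavePacketTransform_ae hħ φ (c • ψ), wavePacketTransform_ae hħ φ ψ,
      Lp.coeFn_smul c (wavePacketTransform hħ φ ψ)] with z h1 h2 h3
    rw [h1, RingHom.id_apply, h3, Pi.smul_apply, h2]
    simp only [wavePacketFun_eq_inner, inner_smul_right, smul_eq_mul]
    ring

/-- By the closed graph theorem it suffices to identify limits. An `L²` limit is an almost
everywhere limit along a subsequence, while each value of the transform is an inner product, hence
continuous in `ψ`. -/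
theorem continuous_wavePacketTransform {ħ : ℝ} (hħ : 0 < ħ) (φ : 𝓢(Position n, ℂ)) :
    Continuous (wavePacketTransform hħ φ) := by
  refine (wavePacketLinear hħ φ).continuous_of_seq_closed_graph fun u ψ Θ hu hΘ => ?_
  apply Lp.ext
  obtain ⟨ns, hns, hlim⟩ := (tendstoInMeasure_of_tendsto_Lp hΘ).exists_seq_tendsto_ae
  have hall : ∀ᵐ z, ∀ k, wavePacketTransform hħ φ (u k) z = wavePacketFun ħ φ (u k) z :=
    ae_all_iff.2 fun k => wavePacketTransform_ae hħ φ (u k)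
  filter_upwards [hlim, hall, wavePacketTransform_ae hħ φ ψ] with z h1 h2 h3
  have h4 : Tendsto (fun k => wavePacketFun ħ φ (u (ns k)) z) atTop (𝓝 (wavePacketFun ħ φ ψ z)) := by
    simp_rw [wavePacketFun_eq_inner]
    exact (Filter.Tendsto.inner tendsto_const_nhds (hu.comp hns.tendsto_atTop)).const_mul _
  refine tendsto_nhds_unique h1 ?_
  change Tendsto _ _ (𝓝 (wavePacketTransform hħ φ ψ z))
  rw [h3]
  refine h4.congr fun k => (h2 (ns k)).symm

variable {P L Q : Matrix (Fin n) (Fin n) ℝ} {S : Phase n ≃L[ℝ] Phase n}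

/-- `U_φ Ŝ_{W,m} = (Ŝ_{W,m})_ph U_φ`. -/
theorem wavePacketTransform_quadraticFourier {ħ : ℝ} (hħ : 0 < ħ) {m : ℤ}
    (hP : P.IsSymm) (hQ : Q.IsSymm) (hL : L.det ≠ 0) (hS : IsFreeSymplectic P L Q S)
    (h : ((S : Phase n →L[ℝ] Phase n) - 1).det ≠ 0)
    {A : WaveFn n ≃ₗᵢ[ℂ] WaveFn n} (hA : IsQuadraticFourier ħ P L Q m A)
    {B : PhaseFn n ≃ₗᵢ[ℂ] PhaseFn n} (hB : IsQuadraticFourierPh ħ P L Q m S B)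
    (φ : 𝓢(Position n, ℂ)) (ψ : WaveFn n) :
    wavePacketTransform hħ φ (A ψ) = B (wavePacketTransform hħ φ ψ) := by
  have hR : (P + Q - L - L.transpose).det ≠ 0 := by
    rw [← abs_ne_zero, ← hS.abs_det_sub_one_mul hP hQ]
    exact mul_ne_zero (abs_ne_zero.2 h) (abs_ne_zero.2 hL)
  have hcU := continuous_wavePacketTransform hħ φ
  refine congrFun ((SchwartzMap.denseRange_toLpCLM (E := Position n) (F := ℂ) (p := 2)
    (μ := volume) (by norm_num)).equalizer (hcU.comp A.continuous) (B.continuous.comp hcU)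
    (funext fun ψ => ?_)) ψ
  change wavePacketTransform hħ φ (A (ψ.toLp 2 volume)) =
    B (wavePacketTransform hħ φ (ψ.toLp 2 volume))
  rw [wavePacketTransform_toLp]
  have hlimL := tendsto_toLp_mul (l := 𝓝[>] (0 : ℝ)) (memLp_wavePacketFun_schwartz hħ φ ψ)
    -- The maximum with `0` keeps the cut-off bounded by `1` for every real `ε`. It is inert on the
    -- positive values used in the limit.
    (g := fun ε u => Complex.exp (-(max ε 0 : ℝ) * ‖u.2‖ ^ 2))
    (fun ε u => norm_gaussian_le (le_max_right _ _) _)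
    (fun ε => Continuous.aestronglyMeasurable (by fun_prop))
    (fun u => by
      have hc : Continuous fun ε : ℝ => Complex.exp (-(max ε 0 : ℝ) * ‖u.2‖ ^ 2) := by fun_prop
      have := hc.tendsto 0
      simp only [max_self, Complex.ofReal_zero, neg_zero, zero_mul, Complex.exp_zero] at this
      exact tendsto_nhdsWithin_of_tendsto_nhds this)
    (fun ε => memLp_regularisedWavePacket hħ φ ψ (le_max_right ε 0))
  -- A sequence of values of `ε` leaves only countably many exceptional null sets, and allows an
  -- almost everywhere convergent subsequence to be extracted from the `L²` limit.
  have hseq : Tendsto (fun k : ℕ => 1 / ((k : ℝ) + 1)) atTop (𝓝[>] 0) :=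
    tendsto_nhdsWithin_iff.2 ⟨tendsto_one_div_add_atTop_nhds_zero_nat,
      Eventually.of_forall fun k => Set.mem_Ioi.2 (by positivity)⟩
  have hlimB := (B.continuous.tendsto _).comp (hlimL.comp hseq)
  obtain ⟨ns, hns, hlim⟩ := (tendstoInMeasure_of_tendsto_Lp hlimB).exists_seq_tendsto_ae
  have hpos : ∀ k : ℕ, 0 < max (1 / ((k : ℝ) + 1)) 0 := fun k => lt_max_of_lt_left (by positivity)
  have hall : ∀ᵐ z, ∀ k : ℕ, B ((memLp_regularisedWavePacket hħ φ ψ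
      (le_max_right (1 / ((k : ℝ) + 1)) 0)).toLp _) z =
      quadraticFourierPhFun ħ P L Q m S
        (regularisedWavePacket ħ φ ψ (max (1 / ((k : ℝ) + 1)) 0)) z :=
    ae_all_iff.2 fun k => hB.ae_of_integrable hħ hP hQ hS h
      (integrable_regularisedWavePacket φ ψ (hpos k)) _
  apply Lp.ext
  filter_upwards [hlim, hall, wavePacketTransform_ae hħ φ (A (ψ.toLp 2 volume))] with z h1 h2 h3
  rw [h3, wavePacketFun_congr ħ φ (hA ψ)]
  -- The same sequence has the `L²` limit `B(U_φψ)` and the pointwise limit `U_φ(Aψ)`, which must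
  -- agree almost everywhere.
  refine tendsto_nhds_unique ?_ h1
  have h4 := (tendsto_quadraticFourierPhFun_regularised hħ m hP hQ hS h hR φ ψ z).comp
    (hseq.comp hns.tendsto_atTop)
  refine h4.congr fun k => ?_
  refine Eq.trans ?_ (h2 (ns k)).symm
  rw [max_eq_left (by positivity)]
  rfl

end Continuity

/-! ### Intertwining on the whole group and existence of `Ŝ_ph`. -/

section Correspondence

open Filter Topology

variable {ħ : ℝ} {P L Q : Matrix (Fin n) (Fin n) ℝ}

/-- `U_φ` intertwines `Ŝ` and `Ŝ_ph`. -/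
theorem wavePacketTransform_of_mem_correspondence (hħ : 0 < ħ) (φ : 𝓢(Position n, ℂ))
    {q : (WaveFn n ≃ₗᵢ[ℂ] WaveFn n) × (PhaseFn n ≃ₗᵢ[ℂ] PhaseFn n)}
    (hq : q ∈ phaseSpaceCorrespondence n ħ) (ψ : WaveFn n) :
    wavePacketTransform hħ φ (q.1 ψ) = q.2 (wavePacketTransform hħ φ ψ) := by
  induction hq using Subgroup.closure_induction generalizing ψ with
  | mem q hq =>
    obtain ⟨P, L, Q, m, S, hW, hS, hA, h, hB⟩ := hq
    exact wavePacketTransform_quadraticFourier hħ hW.symm_left hW.symm_right hW.det_ne_zero hS h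
      hA hB φ ψ
  | one => rfl
  | mul q r _ _ hq hr =>
    change wavePacketTransform hħ φ (q.1 (r.1 ψ)) = q.2 (r.2 _)
    rw [hq, hr]
  | inv q _ hq =>
    change wavePacketTransform hħ φ (q.1.symm ψ) = q.2.symm _
    rw [LinearIsometryEquiv.eq_symm_apply, ← hq, LinearIsometryEquiv.apply_symm_apply]

/-- Multiplication by `e^{(i/2ħ) s|x|²}`. -/
def chirp (n : ℕ) (ħ s : ℝ) : WaveFn n ≃ₗᵢ[ℂ] WaveFn n :=
  phaseTranslate (fun x => s / (2 * ħ) * ‖x‖ ^ 2) (by fun_prop) 0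

theorem chirp_ae (s : ℝ) (ψ : WaveFn n) :
    chirp n ħ s ψ =ᵐ[volume] fun x => Complex.exp (Complex.I * (s / (2 * ħ) * ‖x‖ ^ 2 : ℝ)) *
      ψ x := by
  filter_upwards [phaseTranslate_ae (fun x => s / (2 * ħ) * ‖x‖ ^ 2) (by fun_prop) 0 ψ] with x h
  rw [chirp, h, sub_zero]

theorem quadGen_add_smul_one (P L Q : Matrix (Fin n) (Fin n) ℝ) (s : ℝ) (x x' : Position n) :
    quadGen (P + s • 1) L Q x x' = s / 2 * ‖x‖ ^ 2 + quadGen P L Q x x' := by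
  have h1 : Matrix.toEuclideanLin (P + s • (1 : Matrix (Fin n) (Fin n) ℝ)) x =
      Matrix.toEuclideanLin P x + s • x := by
    rw [map_add, map_smul, LinearMap.add_apply, LinearMap.smul_apply, toEuclideanLin_one_apply]
  rw [quadGen, quadGen, h1, inner_add_left, real_inner_smul_left, real_inner_self_eq_norm_sq]
  ring

theorem IsQuadraticFourier.chirp_mul {m : ℤ} {A : WaveFn n ≃ₗᵢ[ℂ] WaveFn n}
    (hA : IsQuadraticFourier ħ P L Q m A) (s : ℝ) :
    IsQuadraticFourier ħ (P + s • 1) L Q m (chirp n ħ s * A) := by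
  intro ψ
  filter_upwards [chirp_ae (ħ := ħ) s (A (ψ.toLp 2 volume)), hA ψ] with x h1 h2
  change chirp n ħ s (A (ψ.toLp 2 volume)) x = _
  rw [h1, h2, mul_left_comm]
  congr 1
  rw [← integral_const_mul]
  congr 1
  ext x'
  rw [quadGen_add_smul_one, ← mul_assoc, ← Complex.exp_add]
  congr 2
  push_cast
  ring

theorem IsGenerating.add_smul_one {m : ℤ} (h : IsGenerating P L Q m) (s : ℝ) :
    IsGenerating (P + s • 1) L Q m where
  symm_left := h.symm_left.add (Matrix.isSymm_one.smul s)
  symm_right := h.symm_right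
  det_ne_zero := h.det_ne_zero
  arg_det := h.arg_det

/-- `det(R + s)` is the characteristic polynomial of `-R` at `s`, hence nonzero for all large
arguments, in particular at some `s` and `2s` simultaneously. -/
theorem exists_det_add_smul_one_ne_zero (R : Matrix (Fin n) (Fin n) ℝ) :
    ∃ s : ℝ, (R + s • 1).det ≠ 0 ∧ (R + (s • 1 + s • 1)).det ≠ 0 := by
  have hev := (-R).charpoly.eventually_atTop_not_isRoot (-R).charpoly_monic.ne_zero
  have hdet : ∀ s : ℝ, (-R).charpoly.eval s = (R + s • 1).det := by
    intro s
    rw [Matrix.eval_charpoly, sub_neg_eq_add, add_comm, Matrix.smul_one_eq_diagonal]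
    rfl
  obtain ⟨s, h1, h2⟩ := (hev.and ((tendsto_id.atTop_add_atTop tendsto_id).eventually hev)).exists
  refine ⟨s, ?_, ?_⟩
  · rwa [← hdet]
  · rwa [← add_smul, ← hdet]

theorem exists_mem_correspondence_of_det_ne_zero (hħ : 0 < ħ) {m : ℤ} (hW : IsGenerating P L Q m)
    {A : WaveFn n ≃ₗᵢ[ℂ] WaveFn n} (hA : IsQuadraticFourier ħ P L Q m A)
    (hR : (P + Q - L - L.transpose).det ≠ 0) :
    ∃ B, (A, B) ∈ phaseSpaceCorrespondence n ħ := by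
  obtain ⟨S, hS⟩ := exists_isFreeSymplectic hW.symm_left hW.symm_right hW.det_ne_zero
  have h : ((S : Phase n →L[ℝ] Phase n) - 1).det ≠ 0 := by
    intro h0
    have h1 := hS.abs_det_sub_one_mul hW.symm_left hW.symm_right
    rw [h0, abs_zero, zero_mul] at h1
    exact hR (abs_eq_zero.1 h1.symm)
  obtain ⟨B, hB⟩ := exists_isQuadraticFourierPh hħ m hW.symm_left hW.symm_right hS h
  exact ⟨B, Subgroup.subset_closure ⟨P, L, Q, m, S, hW, hS, hA, h, hB⟩⟩

/-- Every metaplectic operator has a phase-space counterpart. -/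
theorem exists_mem_correspondence (hħ : 0 < ħ) {A : WaveFn n ≃ₗᵢ[ℂ] WaveFn n}
    (hA : A ∈ metaplecticGroup n ħ) : ∃ B, (A, B) ∈ phaseSpaceCorrespondence n ħ := by
  induction hA using Subgroup.closure_induction with
  | mem A hA =>
    obtain ⟨P, L, Q, m, hW, hA⟩ := hA
    obtain ⟨s, hs, hs'⟩ := exists_det_add_smul_one_ne_zero (P + Q - L - L.transpose)
    obtain ⟨B₁, h1⟩ := exists_mem_correspondence_of_det_ne_zero hħ (hW.add_smul_one s)
      (hA.chirp_mul s) (by convert hs using 2; abel)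
    obtain ⟨B₂, h2⟩ := exists_mem_correspondence_of_det_ne_zero hħ
      ((hW.add_smul_one s).add_smul_one s) ((hA.chirp_mul s).chirp_mul s)
      (by convert hs' using 2; abel)
    -- With `c` the chirp, `B₁` corresponds to `cA` and `B₂` to `c²A`, and `(cA)(c²A)⁻¹(cA) = A`.
    refine ⟨B₁ * B₂⁻¹ * B₁, ?_⟩
    have h3 := mul_mem (mul_mem h1 (inv_mem h2)) h1
    rw [Prod.inv_mk, Prod.mk_mul_mk, Prod.mk_mul_mk] at h3
    convert h3 using 2
    group
  | one => exact ⟨1, one_mem _⟩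
  | mul A A' _ _ hA hA' =>
    obtain ⟨B, hB⟩ := hA
    obtain ⟨B', hB'⟩ := hA'
    exact ⟨B * B', mul_mem hB hB'⟩
  | inv A _ hA =>
    obtain ⟨B, hB⟩ := hA
    exact ⟨B⁻¹, inv_mem hB⟩

end Correspondence

variable {ħ : ℝ}

/-! ### Covariance under Heisenberg–Weyl operators. -/

section Covariance

theorem heisenbergWeyl_ae (z₀ : Phase n) (ψ : WaveFn n) :
    heisenbergWeyl ħ z₀ ψ =ᵐ[volume] fun x => Complex.exp (Complex.I *
      ((1 / ħ) * (inner ℝ z₀.2 x - 1 / 2 * inner ℝ z₀.2 z₀.1) : ℝ)) * ψ (x - z₀.1) :=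
  phaseTranslate_ae _ _ _ _

theorem heisenbergWeylPh_ae (z₀ : Phase n) (Ψ : PhaseFn n) :
    heisenbergWeylPh ħ z₀ Ψ =ᵐ[volume] fun z => Complex.exp (Complex.I *
      ((1 / (2 * ħ)) * sympl z₀ z : ℝ)) * Ψ (z - z₀) :=
  phaseTranslate_ae _ _ _ _

/-- `U_φ T̂(z₀) = T̂_ph(z₀) U_φ`. -/
theorem wavePacketTransform_heisenbergWeyl (hħ : 0 < ħ) (φ : 𝓢(Position n, ℂ)) (z₀ : Phase n)
    (ψ : WaveFn n) :
    wavePacketTransform hħ φ (heisenbergWeyl ħ z₀ ψ) =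
      heisenbergWeylPh ħ z₀ (wavePacketTransform hħ φ ψ) := by
  apply Lp.ext
  filter_upwards [wavePacketTransform_ae hħ φ (heisenbergWeyl ħ z₀ ψ),
    heisenbergWeylPh_ae (ħ := ħ) z₀ (wavePacketTransform hħ φ ψ),
    ae_sub z₀ (wavePacketTransform_ae hħ φ ψ)] with z h1 h2 h3
  rw [h1, h2, h3, wavePacketFun_congr ħ φ (heisenbergWeyl_ae z₀ ψ), wavePacketFun, wavePacketFun,
    ← integral_add_right_eq_self _ z₀.1, mul_assoc (Complex.ofReal _),
    mul_assoc (Complex.ofReal _), mul_left_comm (Complex.exp _)]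
  congr 1
  rw [← integral_const_mul, ← integral_const_mul, ← integral_const_mul]
  congr 1
  ext y
  rw [add_sub_cancel_right, Prod.fst_sub, Prod.snd_sub, sub_add_eq_sub_sub_swap]
  simp only [← mul_assoc, ← Complex.exp_add]
  congr 3
  simp only [sympl, inner_add_right, inner_sub_right, inner_sub_left]
  rw [real_inner_comm]
  push_cast
  ring

theorem wavePacketTransform_heisenbergWeyl_inv (hħ : 0 < ħ) (φ : 𝓢(Position n, ℂ)) (z₀ : Phase n)
    (ψ : WaveFn n) :
    wavePacketTransform hħ φ ((heisenbergWeyl ħ z₀)⁻¹ ψ) =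
      (heisenbergWeylPh ħ z₀)⁻¹ (wavePacketTransform hħ φ ψ) := by
  change wavePacketTransform hħ φ ((heisenbergWeyl ħ z₀).symm ψ) = (heisenbergWeylPh ħ z₀).symm _
  rw [LinearIsometryEquiv.eq_symm_apply, ← wavePacketTransform_heisenbergWeyl,
    LinearIsometryEquiv.apply_symm_apply]

end Covariance

/-! ### Totality of the ranges of the wave-packet transforms. -/

section Density

open Filter Topology

/-- This is Cauchy–Schwarz, as the window has constant `L²` norm in `z`. Boundedness ensures that
the product of a wave packet with an `L²` function is again in `L²`. -/
theorem norm_wavePacketFun_le (φ : 𝓢(Position n, ℂ)) (ψ : WaveFn n) :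
    ∃ C, ∀ z, ‖wavePacketFun ħ φ ψ z‖ ≤ C := by
  refine ⟨|(1 / (2 * Real.pi * ħ)) ^ ((n : ℝ) / 2)| * ((eLpNorm φ 2 volume).toReal * ‖ψ‖),
    fun z => ?_⟩
  have h2 : ‖(memLp_windowFun ħ φ z).toLp _‖ = (eLpNorm φ 2 volume).toReal := by
    rw [Lp.norm_toLp, ← eLpNorm_comp_measurePreserving
      (φ.memLp 2 volume).1 (Measure.measurePreserving_sub_left volume z.1)]
    congr 1
    refine eLpNorm_congr_norm_ae (Eventually.of_forall fun x => ?_)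
    rw [norm_mul, norm_exp_I_mul_ofReal, one_mul]
    rfl
  have h1 : ‖Complex.exp (Complex.I / (2 * ħ) * (inner ℝ z.2 z.1 : ℝ))‖ = 1 := by
    rw [← norm_exp_I_mul_ofReal (1 / (2 * ħ) * inner ℝ z.2 z.1)]
    push_cast
    congr 2
    ring
  rw [wavePacketFun_eq_inner, norm_mul, norm_mul, h1, mul_one, Complex.norm_real, Real.norm_eq_abs,
    ← h2]
  exact mul_le_mul_of_nonneg_left (norm_inner_le_norm _ _) (abs_nonneg _)

/-- Modulating and translating window and state in opposite senses multiplies the wave-packet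
transform by a character of phase space. -/
theorem wavePacketFun_character {φ φ' : 𝓢(Position n, ℂ)} (a k : Position n)
    (hφ : ∀ y, φ' y = Complex.exp (-(Complex.I / ħ) * (inner ℝ k y : ℝ)) * φ (y + a))
    (ψ : Position n → ℂ) (z : Phase n) :
    wavePacketFun ħ φ' (fun x => Complex.exp (Complex.I * ((1 / ħ) * inner ℝ k x : ℝ)) *
      ψ (x - a)) z =
      Complex.exp (Complex.I / ħ * ((inner ℝ k z.1 - inner ℝ z.2 a : ℝ) : ℂ)) *
        wavePacketFun ħ φ ψ z := by
  rw [wavePacketFun, wavePacketFun, ← integral_add_right_eq_self _ a, mul_left_comm]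
  congr 1
  rw [← integral_const_mul]
  congr 1
  ext y
  rw [add_sub_cancel_right, hφ, map_mul, ← Complex.exp_conj, show z.1 - (y + a) + a = z.1 - y by abel]
  simp only [← mul_assoc, ← Complex.exp_add]
  congr 1
  rw [mul_right_comm, ← Complex.exp_add]
  congr 2
  simp only [map_mul, map_neg, map_div₀, Complex.conj_I, Complex.conj_ofReal, inner_add_right,
    inner_sub_right]
  push_cast
  ring

/-- Compact support makes the modulated translate a Schwartz function with no decay estimates. -/
theorem exists_modulated_window {φ : 𝓢(Position n, ℂ)} (hφ : HasCompactSupport φ)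
    (a k : Position n) : ∃ φ' : 𝓢(Position n, ℂ),
      ∀ y, φ' y = Complex.exp (-(Complex.I / ħ) * (inner ℝ k y : ℝ)) * φ (y + a) := by
  have h1 : HasCompactSupport fun y => Complex.exp (-(Complex.I / ħ) * (inner ℝ k y : ℝ)) *
      φ (y + a) :=
    HasCompactSupport.mul_left (hφ.comp_homeomorph (Homeomorph.addRight a))
  have h2 : ContDiff ℝ (⊤ : ℕ∞) fun y => Complex.exp (-(Complex.I / ħ) * (inner ℝ k y : ℝ)) *
      φ (y + a) := by
    have h3 : ContDiff ℝ (⊤ : ℕ∞) φ := φ.smooth _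
    have h4 : ContDiff ℝ (⊤ : ℕ∞) fun y : Position n => ((inner ℝ k y : ℝ) : ℂ) :=
      Complex.ofRealCLM.contDiff.comp (contDiff_const.inner ℝ contDiff_id)
    exact (contDiff_const.mul h4).cexp.mul (h3.comp (contDiff_id.add contDiff_const))
  exact ⟨h1.toSchwartzMap h2, fun y => rfl⟩

/-- An integrable and square integrable function with vanishing Fourier transform is zero. -/
theorem ae_eq_zero_of_fourier_eq_zero {f : Phase n → ℂ} (h1 : Integrable f) (h2 : MemLp f 2)
    (h : ∀ w : Phase n, ∫ u, Complex.exp (Complex.I * ((-2 * Real.pi * phaseDot w u : ℝ) : ℂ)) *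
      f u = 0) : f =ᵐ[volume] 0 := by
  -- With zero phases and `T = 1` this operator is the Fourier transform itself, and its unitarity
  -- gives injectivity.
  obtain ⟨B, hB⟩ := exists_oscillatory_unitary (n := n) (fun _ => 0) (fun _ => 0)
    continuous_const continuous_const (ContinuousLinearEquiv.refl ℝ _)
  have h3 : B (h2.toLp f) = 0 := by
    apply Lp.ext
    filter_upwards [hB f h1 h2, Lp.coeFn_zero ℂ 2 (volume : Measure (Phase n))] with z h4 h5
    rw [h4, h5]
    simp only [Complex.ofReal_zero, mul_zero, Complex.exp_zero, one_mul]
    rw [ContinuousLinearEquiv.refl_apply, h z, mul_zero, Pi.zero_apply]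
  rw [LinearIsometryEquiv.map_eq_zero_iff] at h3
  have h4 := h2.coeFn_toLp
  rw [h3] at h4
  exact h4.symm.trans (Lp.coeFn_zero ℂ 2 volume)

/-- A state orthogonal to all wave-packet transforms vanishes where they do not. -/
theorem ae_mul_wavePacketFun_eq_zero (hħ : 0 < ħ) {Θ : PhaseFn n}
    (hΘ : ∀ (φ : 𝓢(Position n, ℂ)) (ψ : WaveFn n), inner ℂ Θ (wavePacketTransform hħ φ ψ) = 0)
    {φ : 𝓢(Position n, ℂ)} (hφ : HasCompactSupport φ) (ψ : WaveFn n) :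
    (fun z => wavePacketFun ħ φ ψ z * conj (Θ z)) =ᵐ[volume] 0 := by
  obtain ⟨C, hC⟩ := norm_wavePacketFun_le (ħ := ħ) φ ψ
  have hF := memLp_wavePacketFun hħ φ ψ
  have hΘc : MemLp (fun z => conj (Θ z)) 2 volume := (Lp.memLp Θ).star
  refine ae_eq_zero_of_fourier_eq_zero (hF.integrable_mul hΘc) ?_ fun w => ?_
  · exact hΘc.mul (memLp_top_of_bound hF.1 C (Eventually.of_forall hC))
  · obtain ⟨φ', hφ'⟩ := exists_modulated_window (ħ := ħ) hφ ((2 * Real.pi * ħ) • w.2)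
      (-(2 * Real.pi * ħ) • w.1)
    rw [← hΘ φ' (phaseTranslate (fun x => (1 / ħ) * inner ℝ (-(2 * Real.pi * ħ) • w.1) x)
      (by fun_prop) ((2 * Real.pi * ħ) • w.2) ψ), L2.inner_def]
    apply integral_congr_ae
    filter_upwards [wavePacketTransform_ae hħ φ'
      (phaseTranslate (fun x => (1 / ħ) * inner ℝ (-(2 * Real.pi * ħ) • w.1) x)
        (by fun_prop) ((2 * Real.pi * ħ) • w.2) ψ)] with z h1
    rw [h1, wavePacketFun_congr ħ φ' (phaseTranslate_ae _ _ _ _), wavePacketFun_character _ _ hφ',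
      RCLike.inner_apply, mul_assoc (Complex.exp _)]
    refine congrArg₂ (· * ·) (congrArg Complex.exp ?_) rfl
    have : (ħ : ℂ) ≠ 0 := by exact_mod_cast hħ.ne'
    rw [phaseDot, real_inner_smul_left, real_inner_smul_right, real_inner_comm w.2]
    push_cast
    field_simp
    ring

theorem exists_window (n : ℕ) : ∃ φ : 𝓢(Position n, ℂ), HasCompactSupport φ ∧
    eLpNorm φ 2 volume ≠ 0 := by
  obtain ⟨b⟩ : Nonempty (ContDiffBump (0 : Position n)) := ⟨default⟩
  have h1 : HasCompactSupport fun x => (b x : ℂ) :=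
    b.hasCompactSupport.comp_left (g := Complex.ofReal) Complex.ofReal_zero
  have h2 : ContDiff ℝ (⊤ : ℕ∞) fun x => (b x : ℂ) := Complex.ofRealCLM.contDiff.comp b.contDiff
  obtain ⟨φ, hφ⟩ : ∃ φ : 𝓢(Position n, ℂ), ⇑φ = fun x => (b x : ℂ) :=
    ⟨h1.toSchwartzMap h2, rfl⟩
  refine ⟨φ, hφ ▸ h1, fun h => ?_⟩
  rw [eLpNorm_eq_zero_iff φ.continuous.aestronglyMeasurable (by norm_num),
    Continuous.ae_eq_iff_eq volume φ.continuous continuous_zero, hφ] at h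
  have h3 : (b 0 : ℂ) = 0 := congrFun h 0
  rw [b.one_of_mem_closedBall (Metric.mem_closedBall_self b.rIn_pos.le)] at h3
  norm_num at h3

/-- For every translate `b`, `|Θ(z)| |F(z - b)|` vanishes almost everywhere. Integrating over `b`
and exchanging integrals gives `∫|Θ| · ∫|F| = 0`, so `Θ = 0` once `F` is nonzero. -/
theorem eq_zero_of_inner_wavePacketTransform (hħ : 0 < ħ) {Θ : PhaseFn n}
    (hΘ : ∀ (φ : 𝓢(Position n, ℂ)) (ψ : WaveFn n), inner ℂ Θ (wavePacketTransform hħ φ ψ) = 0) :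
    Θ = 0 := by
  obtain ⟨φ, hφ, hφ0⟩ := exists_window n
  set F : Phase n → ℂ := wavePacketFun ħ φ φ with hFdef
  have hFF : wavePacketFun ħ φ (φ.toLp 2 volume) = F :=
    funext fun z => by rw [wavePacketFun_congr ħ φ (φ.coeFn_toLp 2 volume)]
  have hF : StronglyMeasurable F := stronglyMeasurable_wavePacketFun ħ φ φ.continuous.stronglyMeasurable
  have hb : ∀ b : Phase n, ∫⁻ z, ‖Θ z‖ₑ * ‖F (z - b)‖ₑ = 0 := by
    intro b
    rw [lintegral_eq_zero_iff' (by
      exact ((Lp.stronglyMeasurable Θ).measurable.enorm.mul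
        (hF.measurable.comp (measurable_sub_const b)).enorm).aemeasurable)]
    have h1 := wavePacketTransform_heisenbergWeyl hħ φ b (φ.toLp 2 volume)
    filter_upwards [ae_mul_wavePacketFun_eq_zero hħ hΘ hφ (heisenbergWeyl ħ b (φ.toLp 2 volume)),
      wavePacketTransform_ae hħ φ (heisenbergWeyl ħ b (φ.toLp 2 volume)),
      heisenbergWeylPh_ae (ħ := ħ) b (wavePacketTransform hħ φ (φ.toLp 2 volume)),
      ae_sub b (wavePacketTransform_ae hħ φ (φ.toLp 2 volume))] with z h2 h3 h4 h5
    rw [← h3, h1, h4, h5, hFF] at h2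
    have h6 := congrArg (‖·‖ₑ) h2
    simp only [enorm_mul, Pi.zero_apply, enorm_zero, RCLike.enorm_conj, mul_eq_zero,
      enorm_eq_zero, Complex.exp_ne_zero, false_or] at h6
    rw [Pi.zero_apply, mul_eq_zero, enorm_eq_zero, enorm_eq_zero]
    exact h6.symm
  have h1 : ∫⁻ z, ‖Θ z‖ₑ * ∫⁻ u, ‖F u‖ₑ = 0 := by
    have h2 : ∫⁻ b : Phase n, ∫⁻ z, ‖Θ z‖ₑ * ‖F (z + b)‖ₑ = 0 := by
      rw [← lintegral_zero (μ := (volume : Measure (Phase n)))]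
      refine lintegral_congr fun b => ?_
      rw [← hb (-b)]
      simp only [sub_neg_eq_add]
    rw [lintegral_lintegral_swap (by
      exact (((Lp.stronglyMeasurable Θ).measurable.comp measurable_snd).enorm.mul
        (hF.measurable.comp (measurable_snd.add measurable_fst)).enorm).aemeasurable)] at h2
    rw [← h2]
    refine lintegral_congr fun z => ?_
    rw [lintegral_const_mul' _ _ enorm_ne_top,
      lintegral_add_left_eq_self (fun u => ‖F u‖ₑ) z]
  rw [lintegral_mul_const _ (Lp.stronglyMeasurable Θ).measurable.enorm, mul_eq_zero] at h1
  rcases h1 with h1 | h1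
  · rw [lintegral_eq_zero_iff (Lp.stronglyMeasurable Θ).measurable.enorm] at h1
    rw [Lp.eq_zero_iff_ae_eq_zero]
    filter_upwards [h1] with z hz
    exact enorm_eq_zero.1 hz
  · rw [lintegral_eq_zero_iff hF.measurable.enorm] at h1
    have h3 : eLpNorm F 2 volume = 0 := by
      rw [eLpNorm_eq_zero_iff hF.aestronglyMeasurable (by norm_num)]
      filter_upwards [h1] with z hz
      exact enorm_eq_zero.1 hz
    -- The norm of `F` is a positive multiple of the squared norm of `φ`, so `F` cannot vanish
    -- almost everywhere.
    have h4 := eLpNorm_wavePacketFun_schwartz hħ φ φ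
    rw [← hFdef, h3, ENNReal.zero_rpow_of_pos (by norm_num)] at h4
    have hpos : 0 < ((1 / (2 * Real.pi * ħ)) ^ ((n : ℝ) / 2)) ^ 2 * (2 * Real.pi * ħ) ^ n := by
      positivity
    have h5 : eLpNorm φ 2 volume ^ (2 : ℝ) ≠ 0 := fun h =>
      hφ0 ((ENNReal.rpow_eq_zero_iff_of_pos (by norm_num)).1 h)
    exact absurd h4.symm (mul_ne_zero (mul_ne_zero (ENNReal.ofReal_pos.2 hpos).ne' h5) h5)

/-- The ranges of the wave-packet transforms, for all windows together, are total. -/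
theorem eq_of_apply_wavePacketTransform (hħ : 0 < ħ) {B B' : PhaseFn n ≃ₗᵢ[ℂ] PhaseFn n}
    (h : ∀ (φ : 𝓢(Position n, ℂ)) (ψ : WaveFn n),
      B (wavePacketTransform hħ φ ψ) = B' (wavePacketTransform hħ φ ψ)) : B = B' := by
  let K : Submodule ℂ (PhaseFn n) :=
    LinearMap.eqLocus (B.toLinearEquiv : PhaseFn n →ₗ[ℂ] PhaseFn n) B'.toLinearEquiv
  have hmem : ∀ Ψ, Ψ ∈ K ↔ B Ψ = B' Ψ := fun Ψ => Iff.rfl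
  have hclosed : IsClosed (K : Set (PhaseFn n)) := isClosed_eq B.continuous B'.continuous
  have : CompleteSpace K := hclosed.completeSpace_coe
  have hK : K = ⊤ := by
    rw [← Submodule.orthogonal_eq_bot_iff, Submodule.eq_bot_iff]
    intro Θ hΘ
    rw [Submodule.mem_orthogonal'] at hΘ
    exact eq_zero_of_inner_wavePacketTransform hħ fun φ ψ => hΘ _ ((hmem _).2 (h φ ψ))
  exact LinearIsometryEquiv.ext fun Ψ => (hmem Ψ).1 (hK ▸ Submodule.mem_top)

end Density

/-! ### Uniqueness of `Ŝ_ph` and the proposition. -/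

theorem correspondence_unique (hħ : 0 < ħ) {A : WaveFn n ≃ₗᵢ[ℂ] WaveFn n}
    {B B' : PhaseFn n ≃ₗᵢ[ℂ] PhaseFn n} (hB : (A, B) ∈ phaseSpaceCorrespondence n ħ)
    (hB' : (A, B') ∈ phaseSpaceCorrespondence n ħ) : B = B' :=
  eq_of_apply_wavePacketTransform hħ fun φ ψ =>
    (wavePacketTransform_of_mem_correspondence hħ φ hB ψ).symm.trans
      (wavePacketTransform_of_mem_correspondence hħ φ hB' ψ)

/-- Existence of a counterpart rules out the default value `1` in `phaseSpaceMetaplectic`, so the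
chosen operator belongs to the correspondence. -/
theorem wavePacketTransform_phaseSpaceMetaplectic (hħ : 0 < ħ) (φ : 𝓢(Position n, ℂ))
    {A : WaveFn n ≃ₗᵢ[ℂ] WaveFn n} (hA : A ∈ metaplecticGroup n ħ) (ψ : WaveFn n) :
    wavePacketTransform hħ φ (A ψ) =
      phaseSpaceMetaplectic ħ A (wavePacketTransform hħ φ ψ) := by
  have h := exists_mem_correspondence hħ hA
  rw [phaseSpaceMetaplectic, dif_pos h]
  exact wavePacketTransform_of_mem_correspondence hħ φ h.choose_spec ψ

end NearbyOrbit

end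

theorem mainTheorem1 (n : ℕ) (ħ : ℝ) (hħ : 0 < ħ)
    (H : Phase n → ℝ → ℝ) (hH : IsHamiltonian H)
    (T : Set ℝ) (hTo : IsOpen T) (hTc : T.OrdConnected) (hT0 : (0 : ℝ) ∈ T)
    (D : Set (Phase n)) (hD : IsOpen D) (z₀ : Phase n) (hz₀ : z₀ ∈ D)
    (f : ℝ → Phase n → Phase n) (hf : IsHamiltonianFlow H T D f)
    (S : ℝ → Phase n ≃L[ℝ] Phase n)
    (hS : ∀ t ∈ T, HasFDerivAt (f t) (S t : Phase n →L[ℝ] Phase n) z₀)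
    (Shat : ℝ → WaveFn n ≃ₗᵢ[ℂ] WaveFn n) (hShat : IsMetaplecticLift ħ T S Shat)
    (φ : 𝓢(Position n, ℂ)) (t : ℝ) (ht : t ∈ T) :
    (∃! B : PhaseFn n ≃ₗᵢ[ℂ] PhaseFn n, (Shat t, B) ∈ phaseSpaceCorrespondence n ħ) ∧
    (∀ ψ₀ : WaveFn n,
      wavePacketTransform hħ φ (nearbyOrbitPropagator ħ H f Shat z₀ t ψ₀) =
        phaseFactor ħ H f z₀ t •
          heisenbergWeylPh ħ (f t z₀) (phaseSpaceMetaplectic ħ (Shat t)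
            ((heisenbergWeylPh ħ z₀)⁻¹ (wavePacketTransform hħ φ ψ₀)))) ∧
    wavePacketTransform hħ φ (nearbyOrbitPropagator ħ H f Shat z₀ t (coherentStateAt hħ z₀)) =
      phaseFactor ħ H f z₀ t •
        heisenbergWeylPh ħ (f t z₀) (phaseSpaceMetaplectic ħ (Shat t)
          (wavePacketTransform hħ φ (coherentState n hħ))) := by
  have hex := exists_mem_correspondence hħ (hShat.mem t ht)
  have hcomm := wavePacketTransform_phaseSpaceMetaplectic hħ φ (hShat.mem t ht)
  have hmain : ∀ ψ₀ : WaveFn n,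
      wavePacketTransform hħ φ (nearbyOrbitPropagator ħ H f Shat z₀ t ψ₀) =
        phaseFactor ħ H f z₀ t •
          heisenbergWeylPh ħ (f t z₀) (phaseSpaceMetaplectic ħ (Shat t)
            ((heisenbergWeylPh ħ z₀)⁻¹ (wavePacketTransform hħ φ ψ₀))) := fun ψ₀ => by
    -- The three intertwining relations pull `U_φ` to the outside, and its linearity accounts for
    -- the phase factor.
    rw [← wavePacketTransform_heisenbergWeyl_inv, ← hcomm, ← wavePacketTransform_heisenbergWeyl]
    exact (wavePacketLinear hħ φ).map_smul _ _
  refine ⟨?_, hmain, ?_⟩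
  · obtain ⟨B, hB⟩ := hex
    exact ⟨B, hB, fun B' hB' => correspondence_unique hħ hB' hB⟩
  · rw [hmain, ← wavePacketTransform_heisenbergWeyl_inv, coherentStateAt]
    congr 4
    exact (heisenbergWeyl ħ z₀).symm_apply_apply _
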